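/- Let $M$ be a compact smooth Riemannian manifold without boundary, with Riemannian distance $d$, and let $f:M\to M$ be a $C^1$ diffeomorphism. Let $TM=E^{cs}\oplus E^u$ be a splitting into continuous subbundles that are invariant under $Df$, and assume that $Df|_{E^u}$ is expanding: there are $c>0$ and $\mu>1$ with $\|Df^n v\|\ge c\,\mu^n\|v\|$ for all $v\in E^u$ and $n\ge 0$. Assume that $f$ is Lyapunov stable in the direction $E^{cs}$: for every $\epsilon>0$ there is $\delta>0$ such that for every $C^1$ path $\gamma$ tangent to $E^{cs}$, $\mathrm{length}(\gamma)<\delta$ implies $\mathrm{length}(f^n\circ\gamma)<\epsilon$ for every $n\ge 0$. A lamination of $M$ (with $C^1$ leaves) is given by an atlas of open embeddings $\varphi:\mathbb{R}^k\times T\to M$ whose images cover $M$, such that each $\varphi(\cdot,t)$ is a $C^1$ immersion whose derivative depends continuously on both variables, and such that the plaques $\varphi(\mathbb{R}^k\times\{t\})$ of any two charts of the atlas meet in relatively open subsets. Its leaves are the classes of points that can be joined by finite chains of plaques, and it is tangent to $E$ if the tangent space of the plaques at each point $x$ is $E_x$. For a lamination $W$ let $W_\epsilon(x)$ be the set of points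 that can be joined to $x$ by a $C^1$ path of length less than $\epsilon$ inside the leaf $W(x)$. Then there is a lamination $W^{cs}$ of $M$ tangent to $E^{cs}$ such that 1. $W^{cs}$ is invariant: $f(W^{cs}(x))=W^{cs}(f(x))$ for every $x\in M$; 2. $W^{cs}$ is unique: every lamination of $M$ tangent to $E^{cs}$ has the same leaves as $W^{cs}$; 3. $f$ is plaque expansive at $W^{cs}$: for every plaque size $\eta>0$ there is $\epsilon>0$ such that, if $(x_n)_{n\in\mathbb{Z}}$ and $(y_n)_{n\in\mathbb{Z}}$ are $\epsilon$-pseudo-orbits respecting the plaques, that is, $f(x_n)\in W^{cs}_\epsilon(x_{n+1})$ and $f(y_n)\in W^{cs}_\epsilon(y_{n+1})$ for all $n\in\mathbb{Z}$, and $d(x_n,y_n)<\epsilon$ for all $n\in\mathbb{Z}$, then $x_0\in W^{cs}_\eta(y_0)$. -/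

import Mathlib

open Set Manifold Topology Bundle
open scoped ContDiff ENNReal

noncomputable section

namespace PlaqueExp

variable {d : ℕ} {M : Type*}

section Bundles

variable [TopologicalSpace M] [ChartedSpace (EuclideanSpace ℝ (Fin d)) M] [IsManifold (𝓡 d) ∞ M]

/-- A continuous subbundle of `TM`: around each point the subspaces `E x` admit a continuous
local frame. (The rank is locally constant.) -/
def IsContinuousSubbundle (E : ∀ x : M, Submodule ℝ (TangentSpace (𝓡 d) x)) : Prop :=
  ∀ x₀ : M, ∃ U : Set M, IsOpen U ∧ x₀ ∈ U ∧
    ∃ (k : ℕ) (s : Fin k → ∀ x : M, TangentSpace (𝓡 d) x),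
      (∀ i, ContinuousOn (fun x => (⟨x, s i x⟩ : TangentBundle (𝓡 d) M)) U) ∧
      ∀ x ∈ U, LinearIndependent ℝ (fun i => s i x) ∧
        Submodule.span ℝ (range fun i => s i x) = E x

/-- The subbundle `E` is invariant under `Df`: `Df(E x) = E (f x)` for every `x`. -/
def IsInvariantSubbundle (f : M → M) (E : ∀ x : M, Submodule ℝ (TangentSpace (𝓡 d) x)) : Prop :=
  ∀ x : M, (E x).map (mfderiv (𝓡 d) (𝓡 d) f x).toLinearMap = E (f x)

end Bundles

section Riemannian

variable [TopologicalSpace M] [ChartedSpace (EuclideanSpace ℝ (Fin d)) M] [IsManifold (𝓡 d) ∞ M]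
  [RiemannianBundle (fun x : M => TangentSpace (𝓡 d) x)]

/-- `Df` uniformly expands the vectors of `E`:
`‖Dfⁿ v‖ ≥ c μⁿ ‖v‖` for all `n ≥ 0` and `v` in `E`, with constants `c > 0` and `μ > 1`. -/
def IsExpandingOn (f : M → M) (E : ∀ x : M, Submodule ℝ (TangentSpace (𝓡 d) x)) : Prop :=
  ∃ c : ℝ, 0 < c ∧ ∃ μ : ℝ, 1 < μ ∧ ∀ (n : ℕ) (x : M), ∀ v ∈ E x,
    c * μ ^ n * ‖v‖ ≤ ‖mfderiv (𝓡 d) (𝓡 d) (f^[n]) x v‖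

variable (d) in
/-- `γ` restricts to a `C¹` path `[0,1] → M`. -/
def IsC1Path (γ : ℝ → M) : Prop :=
  ContMDiffOn 𝓘(ℝ, ℝ) (𝓡 d) 1 γ (Icc 0 1)

/-- The velocity of `γ : [0,1] → M` (one-sided at the end points) lies in `E` at every time. -/
def IsTangentPath (E : ∀ x : M, Submodule ℝ (TangentSpace (𝓡 d) x)) (γ : ℝ → M) : Prop :=
  ∀ t ∈ Icc (0 : ℝ) 1, mfderivWithin 𝓘(ℝ, ℝ) (𝓡 d) γ (Icc 0 1) t (1 : ℝ) ∈ E (γ t)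

/-- Lyapunov stability of `f` in the direction `E`: for every `ε > 0` there is `δ > 0` such that
every `C¹` path tangent to `E` of length `< δ` has all its forward images of length `< ε`. -/
def IsLyapunovStable (f : M → M) (E : ∀ x : M, Submodule ℝ (TangentSpace (𝓡 d) x)) : Prop :=
  ∀ ε : ℝ, 0 < ε → ∃ δ : ℝ, 0 < δ ∧ ∀ γ : ℝ → M, IsC1Path d γ → IsTangentPath E γ →
    pathELength (𝓡 d) γ 0 1 < ENNReal.ofReal δ →
    ∀ n : ℕ, pathELength (𝓡 d) (f^[n] ∘ γ) 0 1 < ENNReal.ofReal ε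

end Riemannian

section Laminations

variable (d M) in
/-- A lamination chart (with `C¹` plaques) on an open subset of `M`: an open embedding
`φ : ℝᵏ × T → M`, where the transversal `T` is an arbitrary subspace of `M`, such that every
`φ (·, t)` is a `C¹` immersion whose derivative depends continuously on both variables.
(Using `ℝᵏ` in place of an open ball is immaterial.) -/
structure LaminationChart [TopologicalSpace M] [ChartedSpace (EuclideanSpace ℝ (Fin d)) M]
    [IsManifold (𝓡 d) ∞ M] where
  /-- dimension of the plaques -/
  dim : ℕ
  /-- the transversal -/
  T : Set M
  /-- the parametrization -/
  φ : EuclideanSpace ℝ (Fin dim) × T → M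
  isOpenEmbedding : IsOpenEmbedding φ
  contMDiff_slice : ∀ t : T, ContMDiff (𝓡 dim) (𝓡 d) 1 (fun b => φ (b, t))
  injective_mfderiv : ∀ (b : EuclideanSpace ℝ (Fin dim)) (t : T),
    Function.Injective (mfderiv (𝓡 dim) (𝓡 d) (fun b' => φ (b', t)) b)
  continuous_mfderiv :
    Continuous (fun p : (EuclideanSpace ℝ (Fin dim) × T) × EuclideanSpace ℝ (Fin dim) =>
      (⟨φ p.1, mfderiv (𝓡 dim) (𝓡 d) (fun b' => φ (b', p.1.2)) p.1.1 p.2⟩ :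
        TangentBundle (𝓡 d) M))

variable [TopologicalSpace M] [ChartedSpace (EuclideanSpace ℝ (Fin d)) M] [IsManifold (𝓡 d) ∞ M]

/-- The plaque `φ (ℝᵏ × {t})` of a lamination chart. -/
def LaminationChart.plaque (c : LaminationChart d M) (t : c.T) : Set M :=
  range fun b => c.φ (b, t)

variable (d M) in
/-- A lamination of the whole of `M` with `C¹` leaves: an atlas of lamination charts whose domains
cover `M` and which are compatible, i.e. a plaque of one chart meets a plaque of another chart in a
relatively open subset of the (parametrized) plaque. -/
structure Lamination where
  atlas : Set (LaminationChart d M)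
  covers : ∀ x : M, ∃ c ∈ atlas, x ∈ range c.φ
  compatible : ∀ c ∈ atlas, ∀ c' ∈ atlas, ∀ (t : c.T) (t' : c'.T),
    IsOpen {b : EuclideanSpace ℝ (Fin c.dim) | c.φ (b, t) ∈ c'.plaque t'}

/-- Two points lie on a common plaque of some chart of the atlas. -/
def Lamination.SamePlaque (W : Lamination d M) (x y : M) : Prop :=
  ∃ c ∈ W.atlas, ∃ t : c.T, x ∈ c.plaque t ∧ y ∈ c.plaque t

/-- The leaf through `x`: the points that can be reached from `x` by a finite chain of plaques. -/
def Lamination.leaf (W : Lamination d M) (x : M) : Set M :=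
  {y | Relation.ReflTransGen W.SamePlaque x y}

/-- The lamination is tangent to `E`: the tangent space of the leaf through each point `x`
is `E x`. -/
def Lamination.IsTangentTo (W : Lamination d M)
    (E : ∀ x : M, Submodule ℝ (TangentSpace (𝓡 d) x)) : Prop :=
  ∀ c ∈ W.atlas, ∀ (b : EuclideanSpace ℝ (Fin c.dim)) (t : c.T),
    LinearMap.range (mfderiv (𝓡 c.dim) (𝓡 d) (fun b' => c.φ (b', t)) b).toLinearMap
      = E (c.φ (b, t))

/-- The lamination is invariant: `f` maps the leaf through `x` onto the leaf through `f x`. -/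
def Lamination.IsInvariant (W : Lamination d M) (f : M → M) : Prop :=
  ∀ x : M, f '' W.leaf x = W.leaf (f x)

/-- The ball of radius `ε` about `x` in its leaf: the points that can be joined to `x`
by a `C¹` path of length `< ε` inside the leaf. -/
def Lamination.leafBall [RiemannianBundle (fun x : M => TangentSpace (𝓡 d) x)]
    (W : Lamination d M) (x : M) (ε : ℝ) : Set M :=
  {y | ∃ γ : ℝ → M, IsC1Path d γ ∧ γ 0 = x ∧ γ 1 = y ∧ (∀ t ∈ Icc (0 : ℝ) 1, γ t ∈ W.leaf x) ∧
    pathELength (𝓡 d) γ 0 1 < ENNReal.ofReal ε}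

/-- An `ε`-pseudo-orbit respecting the plaques: `f (x n)` is in the leaf ball of radius `ε`
about `x (n + 1)`, for every `n ∈ ℤ`. -/
def Lamination.IsPseudoOrbit [RiemannianBundle (fun x : M => TangentSpace (𝓡 d) x)]
    (W : Lamination d M) (f : M → M) (ε : ℝ) (x : ℤ → M) : Prop :=
  ∀ n : ℤ, f (x n) ∈ W.leafBall (x (n + 1)) ε

end Laminations

/-- Plaque expansivity of `f` at `W`: however small the size `η` of the plaques, there is `ε > 0`
such that two `ε`-pseudo-orbits respecting the plaques which stay at distance `< ε` from each
other for all times start on a common plaque of size `η`. -/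
def Lamination.IsPlaqueExpansive [EMetricSpace M] [ChartedSpace (EuclideanSpace ℝ (Fin d)) M]
    [IsManifold (𝓡 d) ∞ M] [RiemannianBundle (fun x : M => TangentSpace (𝓡 d) x)]
    (W : Lamination d M) (f : M → M) : Prop :=
  ∀ η : ℝ, 0 < η → ∃ ε : ℝ, 0 < ε ∧ ∀ x y : ℤ → M,
    W.IsPseudoOrbit f ε x → W.IsPseudoOrbit f ε y →
    (∀ n : ℤ, edist (x n) (y n) < ENNReal.ofReal ε) →
    x 0 ∈ W.leafBall (y 0) η

end PlaqueExp

end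

noncomputable section

open Filter
open scoped Uniformity

set_option linter.unusedSectionVars false

namespace PlaqueExp

/-! ### Peano's theorem through delayed equations. -/

section Peano

variable {F : Type*} [NormedAddCommGroup F] [NormedSpace ℝ F]

/-! The bundle `Ecs` is only continuous, so curves tangent to it exist by Peano's theorem but
nothing in the theory of differential equations makes them unique. Uniqueness comes from the
dynamics, through two facts pulling in opposite directions.

On the one hand, Lyapunov stability forces `‖Dfⁿ v‖ ≤ C₀ ‖v‖` on `Ecs` for all `n ≥ 0`
(`IsLyapunovStable.exists_norm_mfderiv_iterate_le`): a path that oscillates in a tiny region has a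
prescribed small length but sees only the derivative at one point, so a strongly stretched vector
would contradict stability. Hence the end points of a short path tangent to `Ecs` have forward
orbits that stay close forever (`StaysClose`).

On the other hand, embed `M` in a Euclidean space and say that `(p, q)` is in the cone when the
increment from `p` to `q` has a larger component along `Eu` than along `Ecs`. Expansion on `Eu`,
together with the bound on `Ecs`, makes the cone invariant under some iterate of `f` for nearby
pairs, and this iterate doubles the `Eu` component, called the height (`exists_coneField`). Heights
are bounded, so two points in the cone whose forward orbits stay close are equal
(`ConeField.exists_eq_of_staysClose`). Pairs of nearby points with the same value under a submersion
whose kernel at the centre is `Eu` are in the cone.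

Fix a chart and a linear projection along `Eu` at its centre. Two paths tangent to `Ecs` from the
same point whose ends have the same projection must therefore end at the same point. Lifting
segments thus gives a well defined holonomy `hol`, transitive and continuous
(`LocalBox.exists_isHolonomyRadius`), with derivative the field of subspaces `Ecs`; its images are
the plaques of the lamination. The same principle shows that a point whose forward orbit stays close
enough to that of a point of a plaque lies on that plaque
(`LaminationChart.IsTangentTo.exists_mem_plaque`). Compatibility of the charts follows, and so does
the description of the leaves of any lamination tangent to `Ecs` as the classes of points joined by
chains of paths tangent to `Ecs` (`Lamination.IsTangentTo.leaf_eq`). That description does not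
mention the lamination, whence uniqueness, and it is preserved by `f` and its inverse, whence
invariance.

For plaque expansivity, slide each `y n` along a short path tangent to `Ecs` to a point `z n` in the
cone of `x n`. The jumps of both pseudo-orbits produce errors that never grow, while the height
doubles, so `x 0 = z 0` (`ConeField.exists_eq_of_pseudoOrbits`) and the slide joins `y 0` to `x 0`.
-/

theorem norm_sub_le_of_hasDerivAt {ζ Y : ℝ → F} {C : ℝ} (h : ∀ t, HasDerivAt ζ (Y t) t)
    (hC : ∀ t, ‖Y t‖ ≤ C) (s t : ℝ) : ‖ζ t - ζ s‖ ≤ C * |t - s| := by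
  have := convex_univ.norm_image_sub_le_of_norm_hasDerivWithin_le (f := ζ) (f' := Y) (C := C)
    (fun x _ => (h x).hasDerivWithinAt) (fun x _ => hC x) (mem_univ s) (mem_univ t)
  simpa [Real.norm_eq_abs] using this

/-- A pointwise limit of approximate solutions of ordinary differential equations is a solution
of the limit equation. The inner times `u i t` allow for delays. -/
theorem hasDerivAt_of_tendsto_solutions {ι P : Type*} [TopologicalSpace P] {l : Filter ι} [NeBot l]
    {X : P → F → F} (hX : Continuous (Function.uncurry X)) {p : ι → P} {p₀ : P}
    (hp : Tendsto p l (𝓝 p₀)) {C : ℝ} (hC : ∀ i x, ‖X (p i) x‖ ≤ C) {u : ι → ℝ → ℝ} {u₀ : ℝ → ℝ}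
    (hu : ∀ t, Tendsto (fun q : ι × ℝ => u q.1 q.2) (l ×ˢ 𝓝 t) (𝓝 (u₀ t)))
    {ζ : ι → ℝ → F} (h : ∀ i t, HasDerivAt (ζ i) (X (p i) (ζ i (u i t))) t)
    {ζ₀ : ℝ → F} (hlim : ∀ t, Tendsto (fun i => ζ i t) l (𝓝 (ζ₀ t))) (t : ℝ) :
    HasDerivAt ζ₀ (X p₀ (ζ₀ (u₀ t))) t := by
  have key : Tendsto (fun q : ι × ℝ => X (p q.1) (ζ q.1 (u q.1 q.2))) (l ×ˢ 𝓝 t)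
      (𝓝 (X p₀ (ζ₀ (u₀ t)))) := by
    have h1 : Tendsto (fun q : ι × ℝ => ζ q.1 (u₀ t)) (l ×ˢ 𝓝 t) (𝓝 (ζ₀ (u₀ t))) :=
      (hlim (u₀ t)).comp tendsto_fst
    -- The common Lipschitz constant `C` replaces Arzelà–Ascoli: pointwise limits suffice, and the
    -- inner time may move along with the index.
    have h2 : Tendsto (fun q : ι × ℝ => ζ q.1 (u q.1 q.2) - ζ q.1 (u₀ t)) (l ×ˢ 𝓝 t) (𝓝 0) := by
      refine squeeze_zero_norm (a := fun q : ι × ℝ => C * |u q.1 q.2 - u₀ t|)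
        (fun q => norm_sub_le_of_hasDerivAt (h q.1) (fun t => hC q.1 _) _ _) ?_
      have := ((hu t).sub_const (u₀ t)).abs.const_mul C
      simpa using this
    have h3 : Tendsto (fun q : ι × ℝ => ζ q.1 (u q.1 q.2)) (l ×ˢ 𝓝 t) (𝓝 (ζ₀ (u₀ t))) := by
      simpa using h2.add h1
    exact (hX.tendsto (p₀, ζ₀ (u₀ t))).comp ((hp.comp tendsto_fst).prodMk_nhds h3)
  refine hasDerivAt_of_tendstoUniformlyOnFilter (l := l) (f := ζ)
    (f' := fun i t => X (p i) (ζ i (u i t))) (g' := fun _ => X p₀ (ζ₀ (u₀ t))) (x := t) ?_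
    (Eventually.of_forall fun q => h q.1 q.2) (Eventually.of_forall hlim)
  rw [Metric.tendstoUniformlyOnFilter_iff]
  intro ε hε
  filter_upwards [key.eventually (Metric.ball_mem_nhds _ hε)] with q hq
  rw [dist_comm]; exact hq

/-- Truncation of a time to the unit interval. -/
def clip (t : ℝ) : ℝ := max 0 (min 1 t)

theorem continuous_clip : Continuous clip := by unfold clip; fun_prop

theorem clip_mem (t : ℝ) : clip t ∈ Icc (0 : ℝ) 1 := by
  simp [clip]

theorem clip_of_mem {t : ℝ} (ht : t ∈ Icc (0 : ℝ) 1) : clip t = t := by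
  simp [clip, ht.1, ht.2]

/-- Iterated solution of the delayed equation `ζ'(t) = X (ζ (t - h))`, `ζ 0 = z`. -/
def delayIter (X : F → F) (h : ℝ) (z : F) : ℕ → ℝ → F
  | 0 => fun _ => z
  | n + 1 => fun t => z + ∫ s in (0 : ℝ)..t, X (delayIter X h z n (max 0 (clip s - h)))

theorem continuous_delayIter {X : F → F} (hX : Continuous X) (h : ℝ) (z : F) (n : ℕ) :
    Continuous (delayIter X h z n) := by
  induction n with
  | zero => exact continuous_const
  | succ n ih =>
    refine continuous_const.add (intervalIntegral.continuous_primitive (fun a b => ?_) 0)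
    apply Continuous.intervalIntegrable
    have := continuous_clip
    fun_prop

theorem hasDerivAt_delayIter [CompleteSpace F] {X : F → F} (hX : Continuous X) (h : ℝ) (z : F) (n : ℕ) (t : ℝ) :
    HasDerivAt (delayIter X h z (n + 1)) (X (delayIter X h z n (max 0 (clip t - h)))) t := by
  have hc : Continuous fun s => X (delayIter X h z n (max 0 (clip s - h))) := by
    have := continuous_clip
    have := continuous_delayIter hX h z n
    fun_prop
  exact (intervalIntegral.integral_hasDerivAt_right (hc.intervalIntegrable _ _)
    (hc.stronglyMeasurableAtFilter _ _) hc.continuousAt).const_add z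

theorem delayIter_zero_right (X : F → F) (h : ℝ) (z : F) (n : ℕ) : delayIter X h z n 0 = z := by
  cases n <;> simp [delayIter]

/-- The value at time `t` only involves the previous iterate up to `t - h`, so each iteration
settles one more time interval of length `h`. -/
theorem delayIter_succ_eq {X : F → F} {h : ℝ} (hh : 0 ≤ h) (z : F) (n : ℕ) {t : ℝ}
    (ht0 : 0 ≤ t) (ht1 : t ≤ 1) (ht : t ≤ n * h) :
    delayIter X h z (n + 1) t = delayIter X h z n t := by
  induction n generalizing t with
  | zero =>
    have : t = 0 := by simp at ht; linarith
    subst this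
    simp [delayIter]
  | succ n ih =>
    show z + _ = z + _
    congr 1
    refine intervalIntegral.integral_congr fun s hs => ?_
    rw [uIcc_of_le ht0] at hs
    have hs1 : clip s = s := clip_of_mem ⟨hs.1, hs.2.trans ht1⟩
    show X _ = X _
    congr 1
    rw [hs1]
    push_cast at ht
    refine ih (le_max_left _ _) (max_le zero_le_one (by linarith [hs.2])) (max_le (by positivity) ?_)
    linarith [hs.2]

/-- **Peano's theorem** for a bounded continuous vector field. -/
theorem exists_hasDerivAt_of_continuous_of_bounded [ProperSpace F] {X : F → F} (hX : Continuous X)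
    {C : ℝ} (hC : ∀ x, ‖X x‖ ≤ C) (z : F) :
    ∃ ζ : ℝ → F, ζ 0 = z ∧ ∀ t, HasDerivAt ζ (X (ζ (clip t))) t := by
  set h : ℕ → ℝ := fun i => 1 / ((i : ℝ) + 1) with hh
  have hpos : ∀ i, 0 < h i := fun i => by positivity
  -- With delay `1 / (i + 1)`, the iterates from `i + 1` on agree on the unit interval, so the
  -- iterate `i + 2` solves the delayed equation itself.
  set ζ : ℕ → ℝ → F := fun i => delayIter X (h i) z (i + 2) with hζ
  have hder : ∀ i t, HasDerivAt (ζ i) (X (ζ i (max 0 (clip t - h i)))) t := by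
    intro i t
    have h1 := hasDerivAt_delayIter hX (h i) z (i + 1) t
    rwa [← delayIter_succ_eq (hpos i).le z (i + 1) (le_max_left _ _) (max_le zero_le_one _)
      (max_le (by have := hpos i; positivity) _)] at h1
    · linarith [(clip_mem t).2, hpos i]
    · have : ((i + 1 : ℕ) : ℝ) * h i = 1 := by
        simp only [hh]; push_cast; field_simp
      rw [this]; linarith [(clip_mem t).2, hpos i]
  have hz : ∀ i, ζ i 0 = z := fun i => delayIter_zero_right _ _ _ _
  -- An ultrafilter gives convergence at all times simultaneously, without extracting subsequences.
  have hlim : ∀ t, ∃ y, Tendsto (fun i => ζ i t) (hyperfilter ℕ : Filter ℕ) (𝓝 y) := by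
    intro t
    have hK : IsCompact (Metric.closedBall z (C * |t|)) := isCompact_closedBall _ _
    obtain ⟨y, -, hy⟩ := hK.ultrafilter_le_nhds ((hyperfilter ℕ).map fun i => ζ i t) (by
      rw [le_principal_iff]
      refine Ultrafilter.mem_map.2 (univ_mem' fun i => ?_)
      have := norm_sub_le_of_hasDerivAt (hder i) (fun t => hC _) 0 t
      simpa [hz, dist_eq_norm] using this)
    exact ⟨y, hy⟩
  choose ζ₀ hζ₀ using hlim
  refine ⟨ζ₀, tendsto_nhds_unique (hζ₀ 0) (by simp [hz]), fun t => ?_⟩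
  refine hasDerivAt_of_tendsto_solutions (P := Unit) (X := fun _ => X) (p := fun _ => ()) (p₀ := ())
    (C := C) (u := fun i t => max 0 (clip t - h i)) (u₀ := clip)
    (hX.comp continuous_snd) tendsto_const_nhds
    (fun _ => hC) (fun t => ?_) hder hζ₀ t
  have h0 : Tendsto h (hyperfilter ℕ : Filter ℕ) (𝓝 0) :=
    tendsto_one_div_add_atTop_nhds_zero_nat.mono_left (Nat.hyperfilter_le_atTop)
  have h1 : Tendsto (fun q : ℕ × ℝ => max 0 (clip q.2 - h q.1))
      ((hyperfilter ℕ : Filter ℕ) ×ˢ 𝓝 t) (𝓝 (max 0 (clip t - 0))) :=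
    tendsto_const_nhds.max (((continuous_clip.tendsto t).comp tendsto_snd).sub
      (h0.comp tendsto_fst))
  simpa [(clip_mem t).1] using h1

end Peano

/-! ### Immersions in a vector space and continuous projections along the splitting. -/

section VectorValued

variable {d : ℕ} {M : Type*} [TopologicalSpace M] [ChartedSpace (EuclideanSpace ℝ (Fin d)) M]
  [IsManifold (𝓡 d) ∞ M]
  {V V' : Type*} [NormedAddCommGroup V] [NormedSpace ℝ V] [NormedAddCommGroup V'] [NormedSpace ℝ V']

/-- The derivative of a vector valued map on `M`, as a map into the vector space. -/
def vderiv (g : M → V) (x : M) : TangentSpace (𝓡 d) x →L[ℝ] V := mfderiv (𝓡 d) 𝓘(ℝ, V) g x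

theorem hasStrictFDerivAt_comp_extChartAt_symm {g : M → V} {x : M}
    (hg : ContMDiffAt (𝓡 d) 𝓘(ℝ, V) 1 g x) :
    HasStrictFDerivAt (𝕜 := ℝ) (g ∘ (extChartAt (𝓡 d) x).symm)
      (vderiv g x : EuclideanSpace ℝ (Fin d) →L[ℝ] V) (extChartAt (𝓡 d) x x) := by
  have h1 := (contMDiffAt_iff.1 hg).2
  simp only [ModelWithCorners.range_eq_univ, contDiffWithinAt_univ] at h1
  have h2 : HasStrictFDerivAt (g ∘ (extChartAt (𝓡 d) x).symm) _ _ :=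
    ContDiffAt.hasStrictFDerivAt h1 one_ne_zero
  convert h2 using 1
  have h3 := hg.mdifferentiableAt one_ne_zero
  simp only [vderiv, mfderiv, h3, ModelWithCorners.range_eq_univ, fderivWithin_univ]
  rfl

/-- First order comparison of the increments of two maps, one of which is an immersion. -/
theorem eventually_norm_sub_sub_le {e : M → V} {h : M → V'} {x : M}
    (he : ContMDiffAt (𝓡 d) 𝓘(ℝ, V) 1 e x) (hinj : Function.Injective (vderiv (d := d) e x))
    (hh : ContMDiffAt (𝓡 d) 𝓘(ℝ, V') 1 h x) {B : V →L[ℝ] V'}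
    (hB : ∀ v : TangentSpace (𝓡 d) x, B (vderiv e x v) = vderiv h x v) {κ : ℝ} (hκ : 0 < κ) :
    ∀ᶠ p : M × M in 𝓝 (x, x),
      ‖h p.2 - h p.1 - B (e p.2 - e p.1)‖ ≤ κ * ‖e p.2 - e p.1‖ := by
  set χ := extChartAt (𝓡 d) x
  let D : EuclideanSpace ℝ (Fin d) →L[ℝ] V := vderiv e x
  have hD : Function.Injective D := hinj
  have h1 : HasStrictFDerivAt (e ∘ χ.symm) D (χ x) := hasStrictFDerivAt_comp_extChartAt_symm he
  let D' : EuclideanSpace ℝ (Fin d) →L[ℝ] V' := vderiv h x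
  have h2 : HasStrictFDerivAt (h ∘ χ.symm) D' (χ x) := hasStrictFDerivAt_comp_extChartAt_symm hh
  have h3 : HasStrictFDerivAt (𝕜 := ℝ) (fun z => h (χ.symm z) - B (e (χ.symm z)))
      (0 : EuclideanSpace ℝ (Fin d) →L[ℝ] V') (χ x) := by
    have hz : D' - B.comp D = 0 := ContinuousLinearMap.ext fun v => sub_eq_zero.2 (hB v).symm
    rw [← hz]
    exact h2.sub (B.hasStrictFDerivAt.comp _ h1)
  obtain ⟨c, hc, hanti⟩ := LinearMap.exists_antilipschitzWith
    D.toLinearMap (LinearMap.ker_eq_bot.2 hD)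
  have hanti' : ∀ v : EuclideanSpace ℝ (Fin d),
      ‖v‖ ≤ c * ‖D v‖ := fun v => by
    simpa [dist_eq_norm] using hanti.le_mul_dist v 0
  -- Error `1 / (2c)` is half of what the lower bound `‖v‖ ≤ c ‖D v‖` tolerates; it is absorbed to
  -- give `‖w‖ ≤ 2c ‖e p.2 - e p.1‖`, which turns chart increments into increments of `e`.
  have e1 := (hasStrictFDerivAt_iff_isLittleO.1 h1).def (c := 1 / (2 * c)) (by positivity)
  have e2 := (hasStrictFDerivAt_iff_isLittleO.1 h3).def (c := κ / (2 * c)) (by positivity)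
  have hχ : Tendsto (fun p : M × M => (χ p.2, χ p.1)) (𝓝 (x, x)) (𝓝 (χ x, χ x)) :=
    ((continuousAt_extChartAt x).tendsto.comp (continuous_snd.tendsto (x, x))).prodMk_nhds
      ((continuousAt_extChartAt x).tendsto.comp (continuous_fst.tendsto (x, x)))
  have hs1 : ∀ᶠ p : M × M in 𝓝 (x, x), p.1 ∈ χ.source :=
    continuous_fst.tendsto (x, x) (extChartAt_source_mem_nhds x)
  have hs2 : ∀ᶠ p : M × M in 𝓝 (x, x), p.2 ∈ χ.source :=
    continuous_snd.tendsto (x, x) (extChartAt_source_mem_nhds x)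
  filter_upwards [hχ.eventually e1, hχ.eventually e2, hs1, hs2] with p hp1 hp2 hp3 hp4
  simp only [Function.comp, χ.left_inv hp3, χ.left_inv hp4, _root_.zero_apply,
    sub_zero] at hp1 hp2
  have hc' : (0 : ℝ) < c := hc
  set w := χ p.2 - χ p.1
  have hw : ‖w‖ ≤ 2 * c * ‖e p.2 - e p.1‖ := by
    have a1 := hanti' w
    have a2 : ‖D w‖ ≤ ‖e p.2 - e p.1‖ + ‖e p.2 - e p.1 - D w‖ := by
      simpa using norm_sub_le (e p.2 - e p.1) (e p.2 - e p.1 - D w)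
    have a3 : ‖D w‖
        ≤ ‖e p.2 - e p.1‖ + 1 / (2 * c) * ‖w‖ := by linarith
    have a4 : (c : ℝ) * ‖D w‖
      ≤ c * ‖e p.2 - e p.1‖ + 1 / 2 * ‖w‖ := by
      calc _ ≤ c * (‖e p.2 - e p.1‖ + 1 / (2 * c) * ‖w‖) := by gcongr
        _ = _ := by field_simp
    linarith
  calc ‖h p.2 - h p.1 - B (e p.2 - e p.1)‖
      = ‖h p.2 - B (e p.2) - (h p.1 - B (e p.1))‖ := by rw [map_sub]; congr 1; abel
    _ ≤ κ / (2 * c) * ‖w‖ := hp2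
    _ ≤ κ / (2 * c) * (2 * c * ‖e p.2 - e p.1‖) := by gcongr
    _ = κ * ‖e p.2 - e p.1‖ := by field_simp

theorem continuous_vderiv {g : M → V} (hg : ContMDiff (𝓡 d) 𝓘(ℝ, V) 1 g) :
    Continuous fun p : TangentBundle (𝓡 d) M => vderiv g p.1 p.2 := by
  have h1 := hg.continuous_tangentMap le_rfl
  have h2 : Continuous fun p : TangentBundle 𝓘(ℝ, V) V => (p.2 : V) :=
    (contMDiff_snd_tangentBundle_modelSpace V 𝓘(ℝ, V) (n := 0)).continuous
  exact h2.comp h1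

end VectorValued

section LeftInverse

variable {X W V : Type*} [TopologicalSpace X] [NormedAddCommGroup W] [NormedSpace ℝ W]
  [NormedAddCommGroup V] [NormedSpace ℝ V]

/-- A continuous family of linear maps which is injective at a point has a continuous family of
left inverses near that point. -/
theorem exists_continuousOn_leftInverse [FiniteDimensional ℝ W] [FiniteDimensional ℝ V]
    {J : X → W →L[ℝ] V} {U : Set X} {x₀ : X} (hU : U ∈ 𝓝 x₀) (hJ : ContinuousOn J U)
    (hinj : Function.Injective (J x₀)) :
    ∃ U' ∈ 𝓝 x₀, U' ⊆ U ∧ ∃ G : X → V →L[ℝ] W, ContinuousOn G U' ∧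
      ∀ x ∈ U', ∀ w, G x (J x w) = w := by
  have : CompleteSpace W := FiniteDimensional.complete ℝ W
  obtain ⟨K, hK⟩ := LinearMap.exists_leftInverse_of_injective (J x₀).toLinearMap
    (LinearMap.ker_eq_bot.2 hinj)
  let K' : V →L[ℝ] W := K.toContinuousLinearMap
  have hK' : K'.comp (J x₀) = 1 := ContinuousLinearMap.ext fun v => LinearMap.congr_fun hK v
  have hKJ : ContinuousOn (fun x => K'.comp (J x)) U := continuousOn_const.clm_comp hJ
  have hN : ∀ᶠ x in 𝓝 x₀, IsUnit (K'.comp (J x)) := by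
    have : ContinuousAt (fun x => K'.comp (J x)) x₀ := hKJ.continuousAt hU
    refine this.eventually (Units.isOpen.mem_nhds ?_)
    show IsUnit (K'.comp (J x₀))
    rw [hK']; exact isUnit_one
  -- The left inverse is `(K' J)⁻¹ K'`, continuous wherever `K' J` is a unit.
  refine ⟨_, inter_mem hU hN, inter_subset_left,
    fun x => (Ring.inverse (K'.comp (J x))).comp K', ?_, ?_⟩
  · refine ContinuousOn.clm_comp ?_ continuousOn_const
    intro x hx
    have h1 := NormedRing.inverse_continuousAt (hx.2 : IsUnit (K'.comp (J x))).unit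
    exact ContinuousAt.comp_continuousWithinAt (f := fun x => K'.comp (J x)) h1
      ((hKJ x hx.1).mono fun y hy => hy.1)
  · rintro x ⟨-, hx⟩ w
    exact DFunLike.congr_fun (Ring.inverse_mul_cancel _ hx) w

end LeftInverse

section Splitting

variable {d : ℕ} {M : Type*} [TopologicalSpace M] [ChartedSpace (EuclideanSpace ℝ (Fin d)) M]
  [IsManifold (𝓡 d) ∞ M]
  {V : Type*} [NormedAddCommGroup V] [NormedSpace ℝ V]

/-- A continuous subbundle, pushed to a vector space by an immersion, is locally the range of a
continuous family of injective linear maps. -/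
theorem IsContinuousSubbundle.exists_frame {E : ∀ x : M, Submodule ℝ (TangentSpace (𝓡 d) x)}
    (hE : IsContinuousSubbundle E) {g : M → V} {U₀ : Set M} (hU₀ : IsOpen U₀) {x₀ : M}
    (hx₀ : x₀ ∈ U₀)
    (hg : ContinuousOn (fun p : TangentBundle (𝓡 d) M => vderiv g p.1 p.2)
      (π (EuclideanSpace ℝ (Fin d)) (TangentSpace (𝓡 d) : M → Type _) ⁻¹' U₀))
    (hinj : ∀ x ∈ U₀, Function.Injective (vderiv (d := d) g x)) :
    ∃ U ⊆ U₀, IsOpen U ∧ x₀ ∈ U ∧ ∃ (k : ℕ) (A : M → EuclideanSpace ℝ (Fin k) →L[ℝ] V),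
      ContinuousOn A U ∧ ∀ x ∈ U, Function.Injective (A x) ∧
        ∀ w : V, w ∈ range (A x) ↔ ∃ v ∈ E x, vderiv g x v = w := by
  obtain ⟨U, hU, hxU, k, s, hs, hspan⟩ := hE x₀
  let A : M → EuclideanSpace ℝ (Fin k) →L[ℝ] V := fun x =>
    ∑ i, ContinuousLinearMap.smulRightL ℝ _ _ (EuclideanSpace.proj i) (vderiv g x (s i x))
  have hA : ∀ x c, A x c = vderiv g x (∑ i, c i • s i x) := by
    intro x c
    simp [A, map_sum]
  refine ⟨U ∩ U₀, inter_subset_right, hU.inter hU₀, ⟨hxU, hx₀⟩, k, A, ?_, fun x hx => ⟨?_, ?_⟩⟩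
  · refine continuousOn_finsetSum _ fun i _ => ?_
    refine (ContinuousLinearMap.continuous _).comp_continuousOn ?_
    exact hg.comp ((hs i).mono inter_subset_left) fun x hx => hx.2
  · rw [injective_iff_map_eq_zero]
    intro c hc
    rw [hA] at hc
    have h0 : ∑ i, c i • s i x = 0 := hinj x hx.2 (by rw [hc, map_zero])
    have := Fintype.linearIndependent_iff.1 (hspan x hx.1).1 (fun i => c i) h0
    ext i
    exact this i
  · intro w
    constructor
    · rintro ⟨c, rfl⟩
      refine ⟨_, ?_, (hA x c).symm⟩
      rw [← (hspan x hx.1).2]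
      exact Submodule.sum_mem _ fun i _ => Submodule.smul_mem _ _
        (Submodule.subset_span (mem_range_self i))
    · rintro ⟨v, hv, rfl⟩
      rw [← (hspan x hx.1).2, Submodule.mem_span_range_iff_exists_fun] at hv
      obtain ⟨c, rfl⟩ := hv
      exact ⟨WithLp.toLp 2 c, by rw [hA]⟩

/-- Continuous projections, defined on the ambient vector space, along a continuous splitting of
the tangent bundle of an immersed manifold. -/
theorem exists_continuous_projection [FiniteDimensional ℝ V] [NormalSpace M] [ParacompactSpace M]
    {E E' : ∀ x : M, Submodule ℝ (TangentSpace (𝓡 d) x)}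
    (hE : IsContinuousSubbundle E) (hE' : IsContinuousSubbundle E')
    (hc : ∀ x, Disjoint (E x) (E' x)) {e : M → V} (he : ContMDiff (𝓡 d) 𝓘(ℝ, V) 1 e)
    (hinj : ∀ x, Function.Injective (vderiv (d := d) e x)) :
    ∃ P : M → V →L[ℝ] V, Continuous P ∧ ∀ x, (∀ w, ∃ v ∈ E x, vderiv e x v = P x w) ∧
      (∀ v ∈ E x, P x (vderiv e x v) = vderiv e x v) ∧ ∀ v ∈ E' x, P x (vderiv e x v) = 0 := by
  -- The admissible operators at `x` form a convex set, so it is enough to find continuous local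
  -- choices and glue them by a partition of unity.
  let t : M → Set (V →L[ℝ] V) := fun x => {P | (∀ w, ∃ v ∈ E x, vderiv e x v = P w) ∧
      (∀ v ∈ E x, P (vderiv e x v) = vderiv e x v) ∧ ∀ v ∈ E' x, P (vderiv e x v) = 0}
  have ht : ∀ x, Convex ℝ (t x) := by
    rintro x P ⟨h1, h2, h3⟩ P' ⟨h1', h2', h3'⟩ a b - - hab
    refine ⟨fun w => ?_, fun v hv => ?_, fun v hv => ?_⟩
    · obtain ⟨v, hv, hv'⟩ := h1 w
      obtain ⟨v', hv1, hv1'⟩ := h1' w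
      exact ⟨a • v + b • v', add_mem (Submodule.smul_mem _ _ hv) (Submodule.smul_mem _ _ hv1),
        by simp [hv', hv1']⟩
    · simp [h2 v hv, h2' v hv, ← add_smul, hab]
    · simp [h3 v hv, h3' v hv]
  have H : ∀ x : M, ∃ U ∈ 𝓝 x, ∃ g : M → V →L[ℝ] V, ContinuousOn g U ∧ ∀ y ∈ U, g y ∈ t y := by
    intro x₀
    obtain ⟨U, -, hU, hxU, k, A, hA, hA'⟩ := hE.exists_frame (g := e) isOpen_univ (mem_univ x₀)
      (continuous_vderiv he).continuousOn (fun x _ => hinj x)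
    obtain ⟨U', -, hU', hxU', k', A', hB, hB'⟩ := hE'.exists_frame (g := e) isOpen_univ
      (mem_univ x₀) (continuous_vderiv he).continuousOn (fun x _ => hinj x)
    let J : M → (EuclideanSpace ℝ (Fin k) × EuclideanSpace ℝ (Fin k')) →L[ℝ] V :=
      fun x => (A x).comp (ContinuousLinearMap.fst ℝ _ _) +
        (A' x).comp (ContinuousLinearMap.snd ℝ _ _)
    have hJ : ContinuousOn J (U ∩ U') :=
      ((hA.mono inter_subset_left).clm_comp continuousOn_const).add
        ((hB.mono inter_subset_right).clm_comp continuousOn_const)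
    have hJinj : Function.Injective (J x₀) := by
      rw [injective_iff_map_eq_zero]
      rintro ⟨a, b⟩ hab
      obtain ⟨v, hv, hva⟩ := ((hA' x₀ hxU).2 _).1 (mem_range_self a)
      obtain ⟨v', hv', hvb⟩ := ((hB' x₀ hxU').2 _).1 (mem_range_self b)
      have hab' : A x₀ a + A' x₀ b = 0 := hab
      have h0 : v + v' = 0 := hinj x₀ (by rw [map_add, hva, hvb, hab', map_zero])
      have hv0 : v = 0 := (Submodule.disjoint_def.1 (hc x₀)) v hv (by
        rw [eq_neg_of_add_eq_zero_left h0]; exact neg_mem hv')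
      have hv0' : v' = 0 := by simpa [hv0] using h0
      have ha : a = 0 := (hA' x₀ hxU).1 (by rw [← hva, hv0, map_zero, map_zero])
      have hb : b = 0 := (hB' x₀ hxU').1 (by rw [← hvb, hv0', map_zero, map_zero])
      rw [ha, hb]; rfl
    obtain ⟨N, hN, hNU, G, hG, hGJ⟩ := exists_continuousOn_leftInverse
      ((hU.inter hU').mem_nhds ⟨hxU, hxU'⟩) hJ hJinj
    -- Decompose along the two frames by the left inverse `G`, then keep the part in the first one.
    refine ⟨N, hN, fun x => ((A x).comp (ContinuousLinearMap.fst ℝ _ _)).comp (G x), ?_, ?_⟩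
    · exact ((hA.mono fun x hx => (hNU hx).1).clm_comp continuousOn_const).clm_comp hG
    · intro x hx
      obtain ⟨hxU, hxU'⟩ := hNU hx
      refine ⟨fun w => ((hA' x hxU).2 _).1 (mem_range_self _), fun v hv => ?_, fun v hv => ?_⟩
      · obtain ⟨c, hc⟩ := ((hA' x hxU).2 _).2 ⟨v, hv, rfl⟩
        have h1 : vderiv e x v = J x (c, 0) := by simp [J, hc]
        show A x (G x (vderiv e x v)).1 = _
        rw [h1, hGJ x hx, ← h1, hc]
      · obtain ⟨c, hc⟩ := ((hB' x hxU').2 _).2 ⟨v, hv, rfl⟩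
        have h1 : vderiv e x v = J x (0, c) := by simp [J, hc]
        show A x (G x (vderiv e x v)).1 = _
        rw [h1, hGJ x hx, map_zero]
  obtain ⟨P, hP⟩ := exists_continuous_forall_mem_convex_of_local ht H
  exact ⟨P, P.continuous, hP⟩

end Splitting

/-! ### Comparison of the Riemannian norm with the norm of the ambient space. -/

section Comparison

variable {d : ℕ} {M : Type*} [TopologicalSpace M] [ChartedSpace (EuclideanSpace ℝ (Fin d)) M]
  [IsManifold (𝓡 d) ∞ M]

/-- Two continuous homogeneous functions on the tangent spaces are locally comparable. -/
theorem eventually_forall_le_mul {N N' : ∀ x : M, TangentSpace (𝓡 d) x → ℝ}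
    (hN : Continuous fun p : TangentBundle (𝓡 d) M => N p.1 p.2)
    (hN' : Continuous fun p : TangentBundle (𝓡 d) M => N' p.1 p.2)
    (hom : ∀ x (c : ℝ) v, N x (c • v) = |c| * N x v)
    (hom' : ∀ x (c : ℝ) v, N' x (c • v) = |c| * N' x v)
    (pos : ∀ x v, v ≠ 0 → 0 < N' x v) (x₀ : M) :
    ∃ C : ℝ, 0 < C ∧ ∀ᶠ x in 𝓝 x₀, ∀ v, N x v ≤ C * N' x v := by
  let t := trivializationAt (EuclideanSpace ℝ (Fin d)) (TangentSpace (𝓡 d) : M → Type _) x₀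
  have hx₀ : x₀ ∈ t.baseSet := mem_baseSet_trivializationAt _ _ _
  have hΨ := t.continuousOn_symm
  have hopen : IsOpen (t.baseSet ×ˢ (univ : Set (EuclideanSpace ℝ (Fin d)))) :=
    t.open_baseSet.prod isOpen_univ
  have cN : ContinuousOn (fun z : M × EuclideanSpace ℝ (Fin d) => N z.1 (t.symm z.1 z.2))
    (t.baseSet ×ˢ univ) := hN.comp_continuousOn hΨ
  have cN' : ContinuousOn (fun z : M × EuclideanSpace ℝ (Fin d) => N' z.1 (t.symm z.1 z.2))
    (t.baseSet ×ˢ univ) := hN'.comp_continuousOn hΨ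
  have hsymm : ∀ x ∈ t.baseSet, ∀ v : TangentSpace (𝓡 d) x,
      t.symm x (t.continuousLinearMapAt ℝ x v) = v := fun x hx v => by
    rw [← t.symmL_apply (R := ℝ) hx]; exact t.symmL_continuousLinearMapAt hx v
  have hsymm' : ∀ x ∈ t.baseSet, ∀ u, t.continuousLinearMapAt ℝ x (t.symm x u) = u :=
    fun x hx u => by rw [← t.symmL_apply (R := ℝ) hx]; exact t.continuousLinearMapAt_symmL hx u
  have hS : IsCompact (Metric.sphere (0 : EuclideanSpace ℝ (Fin d)) 1) := isCompact_sphere _ _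
  have hpos : ∀ x ∈ t.baseSet, ∀ u ∈ Metric.sphere (0 : EuclideanSpace ℝ (Fin d)) 1,
      0 < N' x (t.symm x u) := by
    intro x hx u hu
    refine pos _ _ fun h0 => ?_
    have h1 := hsymm' x hx u
    rw [h0, map_zero] at h1
    rw [← h1] at hu
    simp at hu
  have hincl : ContinuousOn (fun u : EuclideanSpace ℝ (Fin d) => (x₀, u)) (Metric.sphere 0 1) := by
    fun_prop
  have hmap : MapsTo (fun u : EuclideanSpace ℝ (Fin d) => (x₀, u)) (Metric.sphere 0 1)
    (t.baseSet ×ˢ univ) := fun u _ => ⟨hx₀, mem_univ _⟩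
  obtain ⟨C₀, hC₀⟩ : ∃ C₀, ∀ u ∈ Metric.sphere (0 : EuclideanSpace ℝ (Fin d)) 1,
      N x₀ (t.symm x₀ u) / N' x₀ (t.symm x₀ u) ≤ C₀ := by
    have := hS.bddAbove_image (f := fun u => N x₀ (t.symm x₀ u) / N' x₀ (t.symm x₀ u))
      ((cN.comp hincl hmap).div (cN'.comp hincl hmap) fun u hu => (hpos x₀ hx₀ u hu).ne')
    obtain ⟨C₀, h⟩ := this
    exact ⟨C₀, fun u hu => h (mem_image_of_mem _ hu)⟩
  -- The `+ 1` makes the inequality strict on the unit sphere over `x₀`, so that compactness of the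
  -- sphere spreads it to nearby fibres.
  set C := max C₀ 0 + 1
  have hCpos : 0 < C := by positivity
  refine ⟨C, hCpos, ?_⟩
  have hev : ∀ᶠ x in 𝓝 x₀, ∀ u ∈ Metric.sphere (0 : EuclideanSpace ℝ (Fin d)) 1,
      N x (t.symm x u) < C * N' x (t.symm x u) := by
    refine hS.eventually_forall_of_forall_eventually fun u hu => ?_
    have hm : t.baseSet ×ˢ (univ : Set (EuclideanSpace ℝ (Fin d))) ∈ 𝓝 (x₀, u) :=
      hopen.mem_nhds ⟨hx₀, mem_univ _⟩
    have h1 := cN.continuousAt hm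
    have h2 := (cN'.continuousAt hm).const_mul C
    refine h1.eventually_lt h2 ?_
    have h3 := hC₀ u hu
    rw [div_le_iff₀ (hpos x₀ hx₀ u hu)] at h3
    refine h3.trans_lt ?_
    exact mul_lt_mul_of_pos_right (by simp only [C]; linarith [le_max_left C₀ 0]) (hpos x₀ hx₀ u hu)
  filter_upwards [hev, t.open_baseSet.mem_nhds hx₀] with x hx hxb v
  by_cases hv : t.continuousLinearMapAt ℝ x v = 0
  · have : v = (0 : ℝ) • v := by
      rw [zero_smul, ← hsymm x hxb v, hv, ← t.symmL_apply (R := ℝ) hxb, map_zero]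
    rw [this, hom, hom']; simp
  · set u := t.continuousLinearMapAt ℝ x v
    have hn : 0 < ‖u‖ := norm_pos_iff.2 hv
    have h1 := hx (‖u‖⁻¹ • u) (by simp [norm_smul, hn.ne'])
    have h2 : (‖u‖⁻¹ : ℝ) • v = t.symm x (‖u‖⁻¹ • u) := by
      have := hsymm x hxb ((‖u‖⁻¹ : ℝ) • v)
      rw [map_smul] at this
      exact this.symm
    rw [← h2, hom, hom', abs_of_pos (by positivity)] at h1
    have h3 : ‖u‖⁻¹ * N x v < ‖u‖⁻¹ * (C * N' x v) := by linarith
    exact (lt_of_mul_lt_mul_left h3 (by positivity)).le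

/-- Two continuous homogeneous functions on the tangent spaces of a compact manifold are
comparable. -/
theorem exists_forall_le_mul [CompactSpace M] {N N' : ∀ x : M, TangentSpace (𝓡 d) x → ℝ}
    (hN : Continuous fun p : TangentBundle (𝓡 d) M => N p.1 p.2)
    (hN' : Continuous fun p : TangentBundle (𝓡 d) M => N' p.1 p.2)
    (hom : ∀ x (c : ℝ) v, N x (c • v) = |c| * N x v)
    (hom' : ∀ x (c : ℝ) v, N' x (c • v) = |c| * N' x v)
    (pos : ∀ x v, v ≠ 0 → 0 < N' x v) :
    ∃ C : ℝ, 0 < C ∧ ∀ x v, N x v ≤ C * N' x v := by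
  have nonneg : ∀ x v, 0 ≤ N' x v := fun x v => by
    by_cases hv : v = 0
    · have : v = (0 : ℝ) • v := by rw [zero_smul, hv]
      rw [this, hom']; simp
    · exact (pos x v hv).le
  have := isCompact_univ.induction_on (p := fun s : Set M => ∃ C : ℝ, 0 < C ∧ ∀ x ∈ s, ∀ v,
    N x v ≤ C * N' x v) ⟨1, one_pos, by simp⟩
    (fun s t hst ⟨C, hC, h⟩ => ⟨C, hC, fun x hx => h x (hst hx)⟩)
    (fun s t ⟨C, hC, h⟩ ⟨C', hC', h'⟩ => ⟨max C C', lt_max_of_lt_left hC, ?_⟩)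
    (fun x _ => ?_)
  · obtain ⟨C, hC, h⟩ := this
    exact ⟨C, hC, fun x => h x (mem_univ x)⟩
  · rintro x (hx | hx) v
    · exact (h x hx v).trans (mul_le_mul_of_nonneg_right (le_max_left _ _) (nonneg _ _))
    · exact (h' x hx v).trans (mul_le_mul_of_nonneg_right (le_max_right _ _) (nonneg _ _))
  · obtain ⟨C, hC, h⟩ := eventually_forall_le_mul hN hN' hom hom' pos x
    exact ⟨_, mem_nhdsWithin_of_mem_nhds h, C, hC, fun y hy => hy⟩

variable [RiemannianBundle (fun x : M => TangentSpace (𝓡 d) x)]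
  [IsContinuousRiemannianBundle (EuclideanSpace ℝ (Fin d)) (fun x : M => TangentSpace (𝓡 d) x)]

theorem continuous_norm_tangentBundle :
    Continuous fun p : TangentBundle (𝓡 d) M => ‖p.2‖ := by
  have h : Continuous fun p : TangentBundle (𝓡 d) M => inner ℝ p.2 p.2 :=
    Continuous.inner_bundle (F := EuclideanSpace ℝ (Fin d))
      (E := fun x : M => TangentSpace (𝓡 d) x)
      (b := fun p : TangentBundle (𝓡 d) M => p.1) (v := fun p => p.2) (w := fun p => p.2)
      continuous_id continuous_id
  simpa only [norm_eq_sqrt_real_inner] using h.sqrt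

/-- The Riemannian norm is equivalent to the norm induced by an immersion in a vector space. -/
theorem exists_norm_vderiv_equiv [CompactSpace M] {V : Type*} [NormedAddCommGroup V]
    [NormedSpace ℝ V] {e : M → V} (he : ContMDiff (𝓡 d) 𝓘(ℝ, V) 1 e)
    (hinj : ∀ x, Function.Injective (vderiv (d := d) e x)) :
    ∃ C : ℝ, 0 < C ∧ ∀ (x : M) (v : TangentSpace (𝓡 d) x),
      ‖vderiv e x v‖ ≤ C * ‖v‖ ∧ ‖v‖ ≤ C * ‖vderiv e x v‖ := by
  obtain ⟨C, hC, h⟩ := exists_forall_le_mul (N := fun x v => ‖vderiv e x v‖)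
    (N' := fun x (v : TangentSpace (𝓡 d) x) => ‖v‖)
    (continuous_vderiv he).norm continuous_norm_tangentBundle
    (fun x c v => by simp [norm_smul]) (fun x c v => by simp [norm_smul])
    (fun x v hv => norm_pos_iff.2 hv)
  obtain ⟨C', hC', h'⟩ := exists_forall_le_mul (N := fun x (v : TangentSpace (𝓡 d) x) => ‖v‖)
    (N' := fun x v => ‖vderiv e x v‖)
    continuous_norm_tangentBundle (continuous_vderiv he).norm
    (fun x c v => by simp [norm_smul]) (fun x c v => by simp [norm_smul])
    (fun x v hv => norm_pos_iff.2 fun h0 => hv (hinj x (by rw [h0, map_zero])))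
  refine ⟨max C C', lt_max_of_lt_left hC, fun x v => ⟨?_, ?_⟩⟩
  · exact (h x v).trans (mul_le_mul_of_nonneg_right (le_max_left _ _) (norm_nonneg _))
  · exact (h' x v).trans (mul_le_mul_of_nonneg_right (le_max_right _ _) (norm_nonneg _))

end Comparison

/-! ### The invariant cone field. -/

section Cone

variable {d : ℕ} {M : Type*} [TopologicalSpace M] [ChartedSpace (EuclideanSpace ℝ (Fin d)) M]
  [IsManifold (𝓡 d) ∞ M]
  {V : Type*} [NormedAddCommGroup V] [NormedSpace ℝ V]

theorem vderiv_comp {e : M → V} (he : ContMDiff (𝓡 d) 𝓘(ℝ, V) 1 e) {F : M → M}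
    (hF : ContMDiff (𝓡 d) (𝓡 d) 1 F) (x : M) (v : TangentSpace (𝓡 d) x) :
    vderiv (e ∘ F) x v = vderiv e (F x) (mfderiv (𝓡 d) (𝓡 d) F x v) := by
  unfold vderiv
  rw [mfderiv_comp x (he.mdifferentiable one_ne_zero _) (hF.mdifferentiable one_ne_zero _)]
  rfl

/-- The increment of `e` from `p` to `q` is in the cone around the second summand of the splitting
given by the projections `P` and `Q`. -/
def InCone (e : M → V) (P Q : M → V →L[ℝ] V) (p q : M) : Prop :=
  ‖P p (e q - e p)‖ ≤ ‖Q p (e q - e p)‖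

/-- Continuous projections onto the images in `V` of the two summands of a splitting. -/
structure IsSplittingProj (e : M → V) (E E' : ∀ x : M, Submodule ℝ (TangentSpace (𝓡 d) x))
    (P : M → V →L[ℝ] V) : Prop where
  continuous : Continuous P
  exists_eq : ∀ x w, ∃ v ∈ E x, vderiv e x v = P x w
  apply_mem : ∀ x, ∀ v ∈ E x, P x (vderiv e x v) = vderiv e x v
  apply_compl : ∀ x, ∀ v ∈ E' x, P x (vderiv e x v) = 0

theorem norm_apply_sub_le {W W' : Type*} [NormedAddCommGroup W] [NormedSpace ℝ W]
    [NormedAddCommGroup W'] [NormedSpace ℝ W'] {A A₀ : W →L[ℝ] W'} {κ : ℝ} (h : ‖A - A₀‖ ≤ κ)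
    (w : W) : ‖A w - A₀ w‖ ≤ κ * ‖w‖ :=
  ((A - A₀).le_opNorm w).trans (mul_le_mul_of_nonneg_right h (norm_nonneg _))

/-- The operators `P x` and `Q x` are complementary only on the image of the tangent space. This is
enough, since increments of `e` between nearby points are almost tangent. -/
theorem projection_add_apply {e : M → V} {Ecs Eu : ∀ x : M, Submodule ℝ (TangentSpace (𝓡 d) x)} (hsplit : ∀ x, IsCompl (Ecs x) (Eu x))
    {P Q : M → V →L[ℝ] V} (hP : IsSplittingProj e Ecs Eu P) (hQ : IsSplittingProj e Eu Ecs Q)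
    (x : M) (v : TangentSpace (𝓡 d) x) : (P x + Q x) (vderiv e x v) = vderiv e x v := by
  have hv : v ∈ Ecs x ⊔ Eu x := by rw [(hsplit x).sup_eq_top]; trivial
  obtain ⟨a, ha, b, hb, rfl⟩ := Submodule.mem_sup.1 hv
  simp [hP.apply_mem x a ha, hP.apply_compl x b hb, hQ.apply_mem x b hb, hQ.apply_compl x a ha]

/-- Three successive replacements, `A` by `A₁`, `w'` by `B w` and `w` by `S w`, each cost at most `κ
N² ‖w‖`. -/
theorem norm_apply_sub_apply_le {B S A A₁ : V →L[ℝ] V} {w w' c : V} {κ N : ℝ} (hκ : 0 ≤ κ)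
    (hN : 1 ≤ N) (hBN : ‖B‖ ≤ N) (h1 : ‖w' - B w‖ ≤ κ * ‖w‖) (h2 : ‖w - S w‖ ≤ κ * ‖w‖)
    (hw' : ‖w'‖ ≤ N * ‖w‖) (hA : ‖A - A₁‖ ≤ κ) (hA₁ : ‖A₁‖ ≤ N) (hc : A₁ (B (S w)) = c) :
    ‖A w' - c‖ ≤ 3 * (κ * N ^ 2) * ‖w‖ := by
  subst hc
  have s1 : ‖A w' - A₁ w'‖ ≤ κ * (N * ‖w‖) :=
    (norm_apply_sub_le hA w').trans (by gcongr)
  have s2 : ‖A₁ w' - A₁ (B w)‖ ≤ N * (κ * ‖w‖) := by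
    rw [← map_sub]
    exact (A₁.le_opNorm _).trans (by gcongr)
  have s3 : ‖A₁ (B w) - A₁ (B (S w))‖ ≤ N * (N * (κ * ‖w‖)) := by
    rw [← map_sub, ← map_sub]
    exact (A₁.le_opNorm _).trans (mul_le_mul hA₁ ((B.le_opNorm _).trans (by gcongr))
      (norm_nonneg _) (by linarith))
  have s4 : ‖A w' - A₁ (B (S w))‖ ≤ ‖A w' - A₁ w'‖ + ‖A₁ w' - A₁ (B w)‖
      + ‖A₁ (B w) - A₁ (B (S w))‖ := by
    refine le_trans (le_of_eq ?_) (norm_add₃_le)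
    congr 1; abel
  have s5 : κ * N * ‖w‖ * 1 ≤ κ * N * ‖w‖ * N := by gcongr
  calc _ ≤ κ * (N * ‖w‖) + N * (κ * ‖w‖) + N * (N * (κ * ‖w‖)) := by linarith
    _ ≤ _ := by linarith

/-- The linear algebra behind the invariance of the cone field. -/
theorem cone_estimate {B P₀ Q₀ P₁ Q₁ Pp Qp Pf Qf : V →L[ℝ] V} {w w' : V} {κ N K : ℝ}
    (hN : 1 ≤ N) (hBN : ‖B‖ + 1 ≤ N) (hPN : ‖P₁‖ ≤ N) (hQN : ‖Q₁‖ ≤ N) (hκ : 0 ≤ κ) (hK : 0 ≤ K)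
    (hκ1 : κ ≤ 1 / 100) (hκN : κ * N ^ 2 ≤ 1 / 100) (hκK : κ * K ≤ 1 / 100)
    (h1 : ‖w' - B w‖ ≤ κ * ‖w‖) (h2 : ‖w - (P₀ + Q₀) w‖ ≤ κ * ‖w‖)
    (h3 : ‖Pp - P₀‖ ≤ κ) (h4 : ‖Qp - Q₀‖ ≤ κ) (h5 : ‖Pf - P₁‖ ≤ κ) (h6 : ‖Qf - Q₁‖ ≤ κ)
    (P₁a : P₁ (B (P₀ w)) = B (P₀ w)) (P₁b : P₁ (B (Q₀ w)) = 0)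
    (Q₁a : Q₁ (B (P₀ w)) = 0) (Q₁b : Q₁ (B (Q₀ w)) = B (Q₀ w))
    (na : ‖B (P₀ w)‖ ≤ K * ‖P₀ w‖) (nb : (K + 3) * ‖Q₀ w‖ ≤ ‖B (Q₀ w)‖)
    (hcone : ‖Pp w‖ ≤ ‖Qp w‖) :
    ‖w‖ ≤ 4 * ‖Qp w‖ ∧ ‖Pf w'‖ ≤ ‖Qf w'‖ ∧ 2 * ‖Qp w‖ ≤ ‖Qf w'‖ := by
  have hn0 : 0 ≤ ‖w‖ := norm_nonneg _
  have hb0 : 0 ≤ ‖Q₀ w‖ := norm_nonneg _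
  have hw : ‖w‖ ≤ ‖P₀ w‖ + ‖Q₀ w‖ + κ * ‖w‖ := by
    have s1 : ‖w‖ ≤ ‖(P₀ + Q₀) w‖ + ‖w - (P₀ + Q₀) w‖ := by
      simpa using norm_add_le ((P₀ + Q₀) w) (w - (P₀ + Q₀) w)
    have s2 : ‖(P₀ + Q₀) w‖ ≤ ‖P₀ w‖ + ‖Q₀ w‖ := norm_add_le _ _
    linarith
  have hκn : κ * ‖w‖ ≤ 1 / 100 * ‖w‖ := by gcongr
  have hw' : ‖w'‖ ≤ N * ‖w‖ := by
    have s1 : ‖w'‖ ≤ ‖B w‖ + ‖w' - B w‖ := by simpa using norm_add_le (B w) (w' - B w)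
    have s2 : ‖B w‖ ≤ ‖B‖ * ‖w‖ := B.le_opNorm w
    have s3 : (‖B‖ + 1) * ‖w‖ ≤ N * ‖w‖ := by gcongr
    linarith
  have key : ∀ {A A₁ : V →L[ℝ] V} {c : V}, ‖A - A₁‖ ≤ κ → ‖A₁‖ ≤ N →
      A₁ (B ((P₀ + Q₀) w)) = c → ‖A w' - c‖ ≤ 3 / 100 * ‖w‖ := fun hA hA₁ hc =>
    (norm_apply_sub_apply_le hκ hN (by linarith) h1 h2 hw' hA hA₁ hc).trans
      (mul_le_mul_of_nonneg_right (by linarith) hn0)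
  have kQ : ‖Qf w' - B (Q₀ w)‖ ≤ 3 / 100 * ‖w‖ :=
    key h6 hQN (by rw [_root_.add_apply, map_add, map_add, Q₁a, Q₁b, zero_add])
  have kP : ‖Pf w' - B (P₀ w)‖ ≤ 3 / 100 * ‖w‖ :=
    key h5 hPN (by rw [_root_.add_apply, map_add, map_add, P₁a, P₁b, add_zero])
  have pP : ‖Pp w - P₀ w‖ ≤ κ * ‖w‖ := norm_apply_sub_le h3 w
  have pQ : ‖Qp w - Q₀ w‖ ≤ κ * ‖w‖ := norm_apply_sub_le h4 w
  have tri : ∀ u v : V, ‖u‖ ≤ ‖v‖ + ‖u - v‖ := fun u v => by simpa using norm_add_le v (u - v)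
  have tP := tri (P₀ w) (Pp w)
  have tQ := tri (Q₀ w) (Qp w)
  have tQ' := tri (Qp w) (Q₀ w)
  have uQ := tri (B (Q₀ w)) (Qf w')
  have uP := tri (Pf w') (B (P₀ w))
  rw [norm_sub_rev] at tP tQ uQ
  have hKκn : K * (κ * ‖w‖) ≤ 1 / 100 * ‖w‖ := by
    have : K * (κ * ‖w‖) = κ * K * ‖w‖ := by ring
    rw [this]; gcongr
  -- In the cone the `Eu` component controls the whole increment. All errors are then a small
  -- fraction of `‖Q₀ w‖`, and the gap between `K` and `K + 3` pays both for the invariance of the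
  -- cone and for the factor `2`.
  have hn3 : ‖w‖ ≤ 3 * ‖Q₀ w‖ := by linarith
  have hKa : K * ‖P₀ w‖ ≤ K * (‖Q₀ w‖ + 2 * (κ * ‖w‖)) := by
    gcongr; linarith
  have hKb : 0 ≤ K * ‖Q₀ w‖ := by positivity
  refine ⟨by linarith, by linarith, by linarith⟩

/-- Near the diagonal, the increments of `e` and of `e ∘ F` are related by the derivative of `F` up
to a small relative error, so the cone condition obeys the linear estimate `cone_estimate`. -/
theorem eventually_inCone_step [FiniteDimensional ℝ V] {e : M → V}
    (he : ContMDiff (𝓡 d) 𝓘(ℝ, V) 1 e) (hinj : ∀ x, Function.Injective (vderiv (d := d) e x))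
    {Ecs Eu : ∀ x : M, Submodule ℝ (TangentSpace (𝓡 d) x)} (hsplit : ∀ x, IsCompl (Ecs x) (Eu x))
    {P Q : M → V →L[ℝ] V} (hP : IsSplittingProj e Ecs Eu P) (hQ : IsSplittingProj e Eu Ecs Q)
    {F : M → M} (hF : ContMDiff (𝓡 d) (𝓡 d) 1 F)
    (hFcs : ∀ x, ∀ v ∈ Ecs x, mfderiv (𝓡 d) (𝓡 d) F x v ∈ Ecs (F x))
    (hFu : ∀ x, ∀ v ∈ Eu x, mfderiv (𝓡 d) (𝓡 d) F x v ∈ Eu (F x)) {K : ℝ} (hK : 0 ≤ K)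
    (hcs : ∀ x, ∀ v ∈ Ecs x,
      ‖vderiv e (F x) (mfderiv (𝓡 d) (𝓡 d) F x v)‖ ≤ K * ‖vderiv e x v‖)
    (hu : ∀ x, ∀ v ∈ Eu x,
      (K + 3) * ‖vderiv e x v‖ ≤ ‖vderiv e (F x) (mfderiv (𝓡 d) (𝓡 d) F x v)‖) (x₀ : M) :
    ∀ᶠ p : M × M in 𝓝 (x₀, x₀), InCone e P Q p.1 p.2 →
      ‖e p.2 - e p.1‖ ≤ 4 * ‖Q p.1 (e p.2 - e p.1)‖ ∧ InCone e P Q (F p.1) (F p.2) ∧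
      2 * ‖Q p.1 (e p.2 - e p.1)‖ ≤ ‖Q (F p.1) (e (F p.2) - e (F p.1))‖ := by
  obtain ⟨L, hL⟩ := LinearMap.exists_leftInverse_of_injective (vderiv (d := d) e x₀).toLinearMap
    (LinearMap.ker_eq_bot.2 (hinj x₀))
  -- `B` is the derivative of `F` transported to the ambient space: a left inverse of the derivative
  -- of `e`, followed by the derivative of `e ∘ F`.
  let B : V →L[ℝ] V := (vderiv (d := d) (e ∘ F) x₀).comp
    (L.toContinuousLinearMap : V →L[ℝ] TangentSpace (𝓡 d) x₀)
  have hB : ∀ v : TangentSpace (𝓡 d) x₀, B (vderiv e x₀ v) = vderiv (e ∘ F) x₀ v := fun v => by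
    have : L (vderiv e x₀ v) = v := LinearMap.congr_fun hL v
    show vderiv (e ∘ F) x₀ (L (vderiv e x₀ v)) = _
    rw [this]
  have hB' : ∀ v : TangentSpace (𝓡 d) x₀,
      B (vderiv e x₀ v) = vderiv e (F x₀) (mfderiv (𝓡 d) (𝓡 d) F x₀ v) := fun v => by
    rw [hB, vderiv_comp he hF]
  set P₀ := P x₀
  set Q₀ := Q x₀
  set P₁ := P (F x₀)
  set Q₁ := Q (F x₀)
  set N : ℝ := 1 + ‖B‖ + ‖P₁‖ + ‖Q₁‖
  have nB := norm_nonneg B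
  have nP := norm_nonneg P₁
  have nQ := norm_nonneg Q₁
  have hN1 : 1 ≤ N := by simp only [N]; linarith
  set κ : ℝ := 1 / (100 * (N ^ 2 + K))
  have hden : 0 < N ^ 2 + K := by positivity
  have hκ : 0 < κ := by positivity
  have hκN : κ * N ^ 2 ≤ 1 / 100 := by
    simp only [κ]; rw [div_mul_eq_mul_div, one_mul, div_le_div_iff₀ (by positivity) (by norm_num)]
    nlinarith
  have hκK : κ * K ≤ 1 / 100 := by
    simp only [κ]; rw [div_mul_eq_mul_div, one_mul, div_le_div_iff₀ (by positivity) (by norm_num)]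
    nlinarith
  have hκ1 : κ ≤ 1 / 100 := by
    have : κ * 1 ≤ κ * N ^ 2 := by gcongr; exact one_le_pow₀ hN1
    linarith
  have e1 := eventually_norm_sub_sub_le (he x₀) (hinj x₀) ((he.comp hF) x₀) hB hκ
  have e2 := eventually_norm_sub_sub_le (he x₀) (hinj x₀) (he x₀) (B := P₀ + Q₀)
    (projection_add_apply hsplit hP hQ x₀) hκ
  have near : ∀ {A : M → V →L[ℝ] V} {g : M → M}, Continuous A → Continuous g →
      ∀ᶠ p : M × M in 𝓝 (x₀, x₀), ‖A (g p.1) - A (g x₀)‖ ≤ κ := by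
    intro A g hA hg
    have h1 : Continuous fun p : M × M => ‖A (g p.1) - A (g x₀)‖ := by fun_prop
    have h2 := h1.tendsto (x₀, x₀)
    simp only [sub_self, norm_zero] at h2
    exact h2.eventually (ge_mem_nhds hκ)
  filter_upwards [e1, e2, near hP.continuous continuous_id, near hQ.continuous continuous_id,
    near hP.continuous hF.continuous, near hQ.continuous hF.continuous] with p h1 h2 h3 h4 h5 h6 hcone
  unfold InCone at hcone ⊢
  simp only [Function.comp, id] at h1 h2 h3 h4 h5 h6
  set w := e p.2 - e p.1
  set w' := e (F p.2) - e (F p.1)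
  obtain ⟨va, hva, hva'⟩ := hP.exists_eq x₀ w
  obtain ⟨vb, hvb, hvb'⟩ := hQ.exists_eq x₀ w
  have Ba : B (P₀ w) = vderiv e (F x₀) (mfderiv (𝓡 d) (𝓡 d) F x₀ va) := by rw [← hva', hB']
  have Bb : B (Q₀ w) = vderiv e (F x₀) (mfderiv (𝓡 d) (𝓡 d) F x₀ vb) := by rw [← hvb', hB']
  have P₁a : P₁ (B (P₀ w)) = B (P₀ w) := by rw [Ba]; exact hP.apply_mem _ _ (hFcs _ _ hva)
  have P₁b : P₁ (B (Q₀ w)) = 0 := by rw [Bb]; exact hP.apply_compl _ _ (hFu _ _ hvb)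
  have Q₁a : Q₁ (B (P₀ w)) = 0 := by rw [Ba]; exact hQ.apply_compl _ _ (hFcs _ _ hva)
  have Q₁b : Q₁ (B (Q₀ w)) = B (Q₀ w) := by rw [Bb]; exact hQ.apply_mem _ _ (hFu _ _ hvb)
  have na : ‖B (P₀ w)‖ ≤ K * ‖P₀ w‖ := by rw [Ba, ← hva']; exact hcs _ _ hva
  have nb : (K + 3) * ‖Q₀ w‖ ≤ ‖B (Q₀ w)‖ := by rw [Bb, ← hvb']; exact hu _ _ hvb
  exact cone_estimate hN1 (by simp only [N]; linarith) (by simp only [N]; linarith)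
    (by simp only [N]; linarith) hκ.le hK hκ1 hκN hκK h1 h2 h3 h4 h5 h6 P₁a P₁b Q₁a Q₁b na nb hcone

end Cone

section Uniform

variable {d : ℕ} {M : Type*} [UniformSpace M] [CompactSpace M]

/-- On a compact space the entourages are exactly the neighbourhoods of the diagonal, so statements
local near each diagonal point become uniform. -/
theorem eventually_uniformity_of_nhds_diagonal {p : M × M → Prop}
    (h : ∀ x, ∀ᶠ q in 𝓝 (x, x), p q) : ∀ᶠ q in 𝓤 M, p q := by
  rw [← nhdsSet_diagonal_eq_uniformity, eventually_nhdsSet_iff_forall]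
  rintro ⟨x, y⟩ (rfl : x = y)
  exact h x

end Uniform

/-! ### Derivatives of iterates, and existence of the cone field. -/

section Iterate

variable {d : ℕ} {M : Type*} [TopologicalSpace M] [ChartedSpace (EuclideanSpace ℝ (Fin d)) M]
  [IsManifold (𝓡 d) ∞ M]

theorem contMDiff_iterate {f : M → M} (hf : ContMDiff (𝓡 d) (𝓡 d) 1 f) (n : ℕ) :
    ContMDiff (𝓡 d) (𝓡 d) 1 f^[n] := by
  induction n with
  | zero => exact contMDiff_id
  | succ n ih => exact ih.comp hf

theorem mfderiv_iterate_succ {f : M → M} (hf : ContMDiff (𝓡 d) (𝓡 d) 1 f) (n : ℕ) (x : M)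
    (v : TangentSpace (𝓡 d) x) : mfderiv (𝓡 d) (𝓡 d) f^[n + 1] x v
      = mfderiv (𝓡 d) (𝓡 d) f^[n] (f x) (mfderiv (𝓡 d) (𝓡 d) f x v) := by
  rw [Function.iterate_succ, mfderiv_comp x
    ((contMDiff_iterate hf n).mdifferentiable one_ne_zero _) (hf.mdifferentiable one_ne_zero _)]
  rfl

theorem IsInvariantSubbundle.mfderiv_mem {f : M → M}
    {E : ∀ x : M, Submodule ℝ (TangentSpace (𝓡 d) x)} (hE : IsInvariantSubbundle f E) {x : M}
    {v : TangentSpace (𝓡 d) x} (hv : v ∈ E x) : mfderiv (𝓡 d) (𝓡 d) f x v ∈ E (f x) := by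
  rw [← hE x]; exact Submodule.mem_map_of_mem hv

theorem IsInvariantSubbundle.mfderiv_iterate_mem {f : M → M}
    (hf : ContMDiff (𝓡 d) (𝓡 d) 1 f)
    {E : ∀ x : M, Submodule ℝ (TangentSpace (𝓡 d) x)} (hE : IsInvariantSubbundle f E) (n : ℕ)
    {x : M} {v : TangentSpace (𝓡 d) x} (hv : v ∈ E x) :
    mfderiv (𝓡 d) (𝓡 d) f^[n] x v ∈ E (f^[n] x) := by
  induction n generalizing x v with
  | zero =>
    have : mfderiv (𝓡 d) (𝓡 d) f^[0] x = ContinuousLinearMap.id ℝ _ := mfderiv_id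
    rw [this]; exact hv
  | succ n ih => rw [mfderiv_iterate_succ hf]; exact ih (hE.mfderiv_mem hv)

end Iterate

section ConeField

variable {d : ℕ} {M : Type*} [UniformSpace M] [ChartedSpace (EuclideanSpace ℝ (Fin d)) M]
  [IsManifold (𝓡 d) ∞ M]

/-- An invariant cone relation between nearby points, expanded by an iterate `f^[m]`: pairs which
agree in a submersion with kernel `Eu` are in the cone, and the height of the pairs in the cone
doubles under `f^[m]`. -/
structure ConeField (f : M → M) (Eu : ∀ x : M, Submodule ℝ (TangentSpace (𝓡 d) x)) where
  m : ℕ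
  Cone : M → M → Prop
  height : M → M → ℝ
  step : ∀ᶠ p in 𝓤 M, Cone p.1 p.2 → Cone (f^[m] p.1) (f^[m] p.2) ∧
    2 * height p.1 p.2 ≤ height (f^[m] p.1) (f^[m] p.2)
  bound : ℝ
  height_le : ∀ p q, height p q ≤ bound
  small : ∃ D ∈ 𝓤 M, ∀ U ∈ 𝓤 M, ∃ η > 0, ∀ p ∈ D, Cone p.1 p.2 → height p.1 p.2 < η → p ∈ U
  eq_of_height : ∀ᶠ p in 𝓤 M, Cone p.1 p.2 → height p.1 p.2 ≤ 0 → p.1 = p.2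
  cone_of_eq : ∀ (k : ℕ) (g : M → EuclideanSpace ℝ (Fin k)) (x : M),
    ContMDiffAt (𝓡 d) 𝓘(ℝ, EuclideanSpace ℝ (Fin k)) 1 g x →
    (∀ v, vderiv g x v = 0 ↔ v ∈ Eu x) → Function.Surjective (vderiv (d := d) g x) →
    ∀ᶠ p : M × M in 𝓝 (x, x), g p.1 = g p.2 → Cone p.1 p.2

/-- Since `P x` kills the image of `Eu x`, its composition with the derivative of `e` factors
through that of `g`. Equal values of `g` thus make the `Ecs` component of the increment small
relative to the increment; as `P + Q` nearly fixes the increment, the `Eu` component is then most of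
it. -/
theorem eventually_inCone_of_eq {V : Type*} [NormedAddCommGroup V] [NormedSpace ℝ V]
    {W : Type*} [NormedAddCommGroup W] [NormedSpace ℝ W]
    [FiniteDimensional ℝ V] [FiniteDimensional ℝ W] {e : M → V}
    (he : ContMDiff (𝓡 d) 𝓘(ℝ, V) 1 e) (hinj : ∀ x, Function.Injective (vderiv (d := d) e x))
    {Ecs Eu : ∀ x : M, Submodule ℝ (TangentSpace (𝓡 d) x)} (hsplit : ∀ x, IsCompl (Ecs x) (Eu x))
    {P Q : M → V →L[ℝ] V} (hP : IsSplittingProj e Ecs Eu P) (hQ : IsSplittingProj e Eu Ecs Q)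
    {g : M → W} {x : M} (hg : ContMDiffAt (𝓡 d) 𝓘(ℝ, W) 1 g x)
    (hker : ∀ v, vderiv g x v = 0 ↔ v ∈ Eu x) (hsurj : Function.Surjective (vderiv (d := d) g x)) :
    ∀ᶠ p : M × M in 𝓝 (x, x), g p.1 = g p.2 → InCone e P Q p.1 p.2 := by
  obtain ⟨R, hR⟩ := LinearMap.exists_rightInverse_of_surjective (vderiv (d := d) g x).toLinearMap
    (LinearMap.range_eq_top.2 hsurj)
  have hR' : ∀ w, vderiv g x (R w) = w := fun w => LinearMap.congr_fun hR w
  let S : W →L[ℝ] V := ((P x).toLinearMap.comp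
    ((vderiv (d := d) e x).toLinearMap.comp R)).toContinuousLinearMap
  have hS : ∀ v : TangentSpace (𝓡 d) x, P x (vderiv e x v) = vderiv (S ∘ g) x v := by
    intro v
    have h1 : vderiv (S ∘ g) x v = S (vderiv g x v) := by
      unfold vderiv
      rw [mfderiv_comp x S.differentiableAt.mdifferentiableAt (hg.mdifferentiableAt one_ne_zero)]
      rw [S.mfderiv_eq]; rfl
    have h2 : v - R (vderiv g x v) ∈ Eu x := (hker _).1 (by rw [map_sub, hR', sub_self])
    have h3 := hP.apply_compl x _ h2
    rw [map_sub, map_sub, sub_eq_zero] at h3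
    rw [h1, h3]; rfl
  have hSg : ContMDiffAt (𝓡 d) 𝓘(ℝ, V) 1 (S ∘ g) x := S.contMDiff.contMDiffAt.comp x hg
  have e1 := eventually_norm_sub_sub_le (he x) (hinj x) hSg hS (κ := 1 / 10) (by norm_num)
  have e2 := eventually_norm_sub_sub_le (he x) (hinj x) (he x) (B := P x + Q x)
    (projection_add_apply hsplit hP hQ x) (κ := 1 / 10) (by norm_num)
  have near : ∀ {A : M → V →L[ℝ] V}, Continuous A →
      ∀ᶠ p : M × M in 𝓝 (x, x), ‖A p.1 - A x‖ ≤ 1 / 10 := by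
    intro A hA
    have h1 : Continuous fun p : M × M => ‖A p.1 - A x‖ := by fun_prop
    have h2 := h1.tendsto (x, x)
    simp only [sub_self, norm_zero] at h2
    exact h2.eventually (ge_mem_nhds (by norm_num))
  filter_upwards [e1, e2, near hP.continuous, near hQ.continuous] with p h1 h2 h3 h4 heq
  unfold InCone
  have a1 := norm_apply_sub_le h3 (e p.2 - e p.1)
  have a2 := norm_apply_sub_le h4 (e p.2 - e p.1)
  simp only [Function.comp, heq, sub_self, zero_sub, norm_neg] at h1
  generalize e p.2 - e p.1 = w at *
  have tri : ∀ u v : V, ‖u‖ ≤ ‖v‖ + ‖u - v‖ := fun u v => by simpa using norm_add_le v (u - v)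
  have b1 := tri (P p.1 w) (P x w)
  have b2 := tri (Q x w) (Q p.1 w)
  rw [norm_sub_rev] at b2
  have b3 := tri w ((P x + Q x) w)
  have b4 : ‖(P x + Q x) w‖ ≤ ‖P x w‖ + ‖Q x w‖ := norm_add_le _ _
  have := norm_nonneg w
  linarith

end ConeField

section Existence

theorem isUniformInducing_of_isInducing {X Y : Type*} [UniformSpace X] [CompactSpace X]
    [UniformSpace Y] {e : X → Y} (he : IsInducing e) : IsUniformInducing e :=
  isUniformInducing_iff_uniformSpace.2 (unique_uniformity_of_compact
    (UniformSpace.toTopologicalSpace_comap.trans he.eq_induced.symm) rfl)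

variable {d : ℕ} {M : Type*} [EMetricSpace M] [CompactSpace M]
  [ChartedSpace (EuclideanSpace ℝ (Fin d)) M] [IsManifold (𝓡 d) ∞ M]
  [RiemannianBundle (fun x : M => TangentSpace (𝓡 d) x)]
  [IsContinuousRiemannianBundle (EuclideanSpace ℝ (Fin d)) (fun x : M => TangentSpace (𝓡 d) x)]

/-- Passing between the Riemannian norm and the ambient one costs a factor `C` before and after the
map, so the growth `r` must beat `C * C`. -/
theorem le_norm_vderiv_of_le {C A c r a a' n n' : ℝ} (hC : 0 < C) (hA : 0 ≤ A) (hc : 0 < c)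
    (h1 : a ≤ C * n) (h2 : n' ≤ C * a') (h3 : c * r * n ≤ n')
    (hr : A * (C * C) / c ≤ r) (hn : 0 ≤ n := by positivity) : A * a ≤ a' := by
  rw [div_le_iff₀ hc] at hr
  have h4 : C * (A * a) ≤ C * a' := by
    calc C * (A * a) ≤ C * (A * (C * n)) := by gcongr
      _ = A * (C * C) * n := by ring
      _ ≤ r * c * n := by gcongr
      _ ≤ C * a' := by linarith
  exact le_of_mul_le_mul_left h4 hC

/-- The height is the norm of the `Eu` component of the increment. Compactness bounds it, and in the
cone it controls the whole increment up to the factor `4`, hence the distance, because `e` is a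
uniform embedding. -/
theorem nonempty_coneField_of_step {V : Type*} [NormedAddCommGroup V] [NormedSpace ℝ V]
    [FiniteDimensional ℝ V] {e : M → V} (he : ContMDiff (𝓡 d) 𝓘(ℝ, V) 1 e) (hind' : IsInducing e)
    (heinj : Function.Injective e) (hinj' : ∀ x, Function.Injective (vderiv (d := d) e x))
    {f : M → M} {Ecs Eu : ∀ x : M, Submodule ℝ (TangentSpace (𝓡 d) x)}
    (hsplit : ∀ x : M, IsCompl (Ecs x) (Eu x)) {P Q : M → V →L[ℝ] V}
    (hP : IsSplittingProj e Ecs Eu P) (hQ : IsSplittingProj e Eu Ecs Q) {m : ℕ}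
    (step' : ∀ᶠ p in 𝓤 M, InCone e P Q p.1 p.2 →
      ‖e p.2 - e p.1‖ ≤ 4 * ‖Q p.1 (e p.2 - e p.1)‖ ∧ InCone e P Q (f^[m] p.1) (f^[m] p.2) ∧
      2 * ‖Q p.1 (e p.2 - e p.1)‖ ≤ ‖Q (f^[m] p.1) (e (f^[m] p.2) - e (f^[m] p.1))‖) :
    Nonempty (ConeField f Eu) := by
  obtain ⟨H, hH⟩ : ∃ H, ∀ p q : M, ‖Q p (e q - e p)‖ ≤ H := by
    have hc : Continuous fun r : M × M => ‖Q r.1 (e r.2 - e r.1)‖ := by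
      have := hQ.continuous
      have := he.continuous
      fun_prop
    obtain ⟨H, h⟩ := isCompact_univ.bddAbove_image hc.continuousOn
    exact ⟨H, fun p q => h (mem_image_of_mem _ (mem_univ (p, q)))⟩
  refine ⟨⟨m, InCone e P Q, fun p q => ‖Q p (e q - e p)‖, ?_, H, hH, ?_, ?_, ?_⟩⟩
  · filter_upwards [step'] with p hp hcone
    exact (hp hcone).2
  · refine ⟨_, step', fun U hU => ?_⟩
    have hind : IsUniformInducing e := isUniformInducing_of_isInducing hind'
    rw [← hind.comap_uniformity, mem_comap] at hU
    obtain ⟨U', hU', hsub⟩ := hU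
    obtain ⟨ε, hε, hU'⟩ := Metric.mem_uniformity_dist.1 hU'
    refine ⟨ε / 4, by positivity, fun p hp hcone hlt => ?_⟩
    refine hsub (hU' (a := e p.1) (b := e p.2) ?_)
    rw [dist_comm, dist_eq_norm]
    linarith [(hp hcone).1]
  · filter_upwards [step'] with p hp hcone hle
    refine heinj ?_
    have h1 := (hp hcone).1
    have h2 : ‖e p.2 - e p.1‖ ≤ 0 := by linarith
    exact (sub_eq_zero.1 (norm_le_zero_iff.1 h2)).symm
  · intro k g x hg hker hsurj
    exact eventually_inCone_of_eq he hinj' hsplit hP hQ hg hker hsurj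

theorem exists_coneField {f : M → M} (hf : ContMDiff (𝓡 d) (𝓡 d) 1 f)
    {Ecs Eu : ∀ x : M, Submodule ℝ (TangentSpace (𝓡 d) x)}
    (hEcs : IsContinuousSubbundle Ecs) (hEu : IsContinuousSubbundle Eu)
    (hsplit : ∀ x : M, IsCompl (Ecs x) (Eu x))
    (hEcs_inv : IsInvariantSubbundle f Ecs) (hEu_inv : IsInvariantSubbundle f Eu)
    (hexp : IsExpandingOn f Eu) {C₀ : ℝ} (hC₀ : 0 ≤ C₀)
    (hbound : ∀ (n : ℕ) (x : M), ∀ v ∈ Ecs x, ‖mfderiv (𝓡 d) (𝓡 d) f^[n] x v‖ ≤ C₀ * ‖v‖) :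
    Nonempty (ConeField f Eu) := by
  obtain ⟨N, e, hes, heE, hinj⟩ := exists_embedding_euclidean_of_compact (I := 𝓡 d) (M := M)
  have he : ContMDiff (𝓡 d) 𝓘(ℝ, EuclideanSpace ℝ (Fin N)) 1 e := hes.of_le (by simp)
  have hinj' : ∀ x, Function.Injective (vderiv (d := d) e x) := hinj
  obtain ⟨P, hP1, hP2⟩ := exists_continuous_projection hEcs hEu (fun x => (hsplit x).disjoint)
    he hinj'
  obtain ⟨Q, hQ1, hQ2⟩ := exists_continuous_projection hEu hEcs
    (fun x => (hsplit x).symm.disjoint) he hinj'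
  have hP : IsSplittingProj e Ecs Eu P :=
    ⟨hP1, fun x => (hP2 x).1, fun x => (hP2 x).2.1, fun x => (hP2 x).2.2⟩
  have hQ : IsSplittingProj e Eu Ecs Q :=
    ⟨hQ1, fun x => (hQ2 x).1, fun x => (hQ2 x).2.1, fun x => (hQ2 x).2.2⟩
  obtain ⟨C, hC, hCe⟩ := exists_norm_vderiv_equiv he hinj'
  obtain ⟨c, hc, μ, hμ, hexp⟩ := hexp
  -- The bound on `Ecs` is the same for all iterates, so one large iterate makes the expansion on
  -- `Eu` exceed it by the margin `3` required by `cone_estimate`.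
  obtain ⟨m, hm⟩ : ∃ m : ℕ, (C * C * C₀ + 3) * (C * C) / c < μ ^ m :=
    ((tendsto_pow_atTop_atTop_of_one_lt hμ).eventually_gt_atTop _).exists
  have hm' : (C * C * C₀ + 3) * (C * C) / c ≤ μ ^ (m + 1) :=
    hm.le.trans (pow_le_pow_right₀ hμ.le (Nat.le_succ m))
  let F := f^[m + 1]
  have hFcs : ∀ x, ∀ v ∈ Ecs x, ‖vderiv e (F x) (mfderiv (𝓡 d) (𝓡 d) F x v)‖
      ≤ C * C * C₀ * ‖vderiv e x v‖ := fun x v hv => by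
    calc _ ≤ C * ‖mfderiv (𝓡 d) (𝓡 d) F x v‖ := (hCe _ _).1
      _ ≤ C * (C₀ * (C * ‖vderiv e x v‖)) := by
        gcongr
        exact (hbound (m + 1) x v hv).trans (by gcongr; exact (hCe _ _).2)
      _ = _ := by ring
  have hFu : ∀ x, ∀ v ∈ Eu x, (C * C * C₀ + 3) * ‖vderiv e x v‖
      ≤ ‖vderiv e (F x) (mfderiv (𝓡 d) (𝓡 d) F x v)‖ := fun x v hv =>
    le_norm_vderiv_of_le hC (by positivity) hc (hCe x v).1
      ((hCe _ (mfderiv (𝓡 d) (𝓡 d) F x v)).2) (hexp (m + 1) x v hv) hm'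
  have step := eventually_inCone_step (F := F) he hinj' hsplit hP hQ
    (contMDiff_iterate hf (m + 1))
    (fun x v hv => hEcs_inv.mfderiv_iterate_mem hf (m + 1) hv)
    (fun x v hv => hEu_inv.mfderiv_iterate_mem hf (m + 1) hv) (by positivity) hFcs hFu
  exact nonempty_coneField_of_step he heE.isInducing heE.injective hinj' hsplit hP hQ
    (eventually_uniformity_of_nhds_diagonal step)

end Existence

/-! ### Boxes: the bundle `Ecs` read in a chart as a bounded field of linear sections. -/

section Chart

variable {d : ℕ} {M : Type*} [TopologicalSpace M] [ChartedSpace (EuclideanSpace ℝ (Fin d)) M]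
  [IsManifold (𝓡 d) ∞ M]

/-- The derivative of the inverse of the preferred chart at `x₀`. -/
def chartInv (x₀ : M) (z : EuclideanSpace ℝ (Fin d)) :
    EuclideanSpace ℝ (Fin d) →L[ℝ] TangentSpace (𝓡 d) ((extChartAt (𝓡 d) x₀).symm z) :=
  mfderiv 𝓘(ℝ, EuclideanSpace ℝ (Fin d)) (𝓡 d) (extChartAt (𝓡 d) x₀).symm z

theorem isOpen_chart_target (x₀ : M) : IsOpen (extChartAt (𝓡 d) x₀).target :=
  isOpen_extChartAt_target x₀

theorem hasMFDerivAt_chart_symm {x₀ : M} {z : EuclideanSpace ℝ (Fin d)}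
    (hz : z ∈ (extChartAt (𝓡 d) x₀).target) :
    HasMFDerivAt 𝓘(ℝ, EuclideanSpace ℝ (Fin d)) (𝓡 d) (extChartAt (𝓡 d) x₀).symm z
      (chartInv x₀ z) := by
  have h := (contMDiffOn_extChartAt_symm (I := 𝓡 d) (n := 1) x₀).contMDiffAt
    ((isOpen_chart_target x₀).mem_nhds hz)
  exact (h.mdifferentiableAt one_ne_zero).hasMFDerivAt

theorem vderiv_chart_chartInv {x₀ : M} {z : EuclideanSpace ℝ (Fin d)}
    (hz : z ∈ (extChartAt (𝓡 d) x₀).target) (w : EuclideanSpace ℝ (Fin d)) :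
    vderiv (extChartAt (𝓡 d) x₀) ((extChartAt (𝓡 d) x₀).symm z) (chartInv x₀ z w) = w := by
  have h := mfderiv_extChartAt_comp_mfderivWithin_extChartAt_symm (I := 𝓡 d) hz
  rw [ModelWithCorners.range_eq_univ, mfderivWithin_univ] at h
  exact DFunLike.congr_fun h w

theorem chartInv_vderiv_chart {x₀ : M} {z : EuclideanSpace ℝ (Fin d)}
    (hz : z ∈ (extChartAt (𝓡 d) x₀).target)
    (v : TangentSpace (𝓡 d) ((extChartAt (𝓡 d) x₀).symm z)) :
    chartInv x₀ z (vderiv (extChartAt (𝓡 d) x₀) ((extChartAt (𝓡 d) x₀).symm z) v) = v := by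
  have h := mfderivWithin_extChartAt_symm_comp_mfderiv_extChartAt (I := 𝓡 d) hz
  rw [ModelWithCorners.range_eq_univ, mfderivWithin_univ] at h
  exact DFunLike.congr_fun h v

theorem injective_vderiv_chart {x₀ x : M} (hx : x ∈ (extChartAt (𝓡 d) x₀).source) :
    Function.Injective (vderiv (d := d) (extChartAt (𝓡 d) x₀) x) := by
  have h := chartInv_vderiv_chart ((extChartAt (𝓡 d) x₀).map_source hx)
  rw [(extChartAt (𝓡 d) x₀).left_inv hx] at h
  exact Function.LeftInverse.injective h

theorem surjective_vderiv_chart {x₀ x : M} (hx : x ∈ (extChartAt (𝓡 d) x₀).source) :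
    Function.Surjective (vderiv (d := d) (extChartAt (𝓡 d) x₀) x) := by
  have h := vderiv_chart_chartInv ((extChartAt (𝓡 d) x₀).map_source hx)
  rw [(extChartAt (𝓡 d) x₀).left_inv hx] at h
  exact fun w => ⟨_, h w⟩

theorem continuousOn_vderiv_chart (x₀ : M) :
    ContinuousOn (fun p : TangentBundle (𝓡 d) M => vderiv (extChartAt (𝓡 d) x₀) p.1 p.2)
      (π (EuclideanSpace ℝ (Fin d)) (TangentSpace (𝓡 d) : M → Type _) ⁻¹'
        (extChartAt (𝓡 d) x₀).source) := by
  have hopen : IsOpen (extChartAt (𝓡 d) x₀).source := isOpen_extChartAt_source x₀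
  have hc : ContMDiffOn (𝓡 d) 𝓘(ℝ, EuclideanSpace ℝ (Fin d)) 1 (extChartAt (𝓡 d) x₀)
      (extChartAt (𝓡 d) x₀).source := by
    rw [extChartAt_source]; exact contMDiffOn_extChartAt
  have h1 := hc.continuousOn_tangentMapWithin le_rfl hopen.uniqueMDiffOn
  have h2 : Continuous fun p : TangentBundle 𝓘(ℝ, EuclideanSpace ℝ (Fin d))
      (EuclideanSpace ℝ (Fin d)) => (p.2 : EuclideanSpace ℝ (Fin d)) :=
    (contMDiff_snd_tangentBundle_modelSpace _ 𝓘(ℝ, EuclideanSpace ℝ (Fin d)) (n := 0)).continuous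
  refine (h2.comp_continuousOn h1).congr fun p hp => ?_
  simp only [Function.comp, tangentMapWithin, mfderivWithin_of_isOpen hopen hp]
  rfl

theorem continuousOn_chartInv (x₀ : M) :
    ContinuousOn (fun p : EuclideanSpace ℝ (Fin d) × EuclideanSpace ℝ (Fin d) =>
      (⟨(extChartAt (𝓡 d) x₀).symm p.1, chartInv x₀ p.1 p.2⟩ : TangentBundle (𝓡 d) M))
      ((extChartAt (𝓡 d) x₀).target ×ˢ univ) := by
  have hopen := isOpen_chart_target (d := d) x₀
  have h1 := (contMDiffOn_extChartAt_symm (I := 𝓡 d) (n := 1) x₀).continuousOn_tangentMapWithin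
    le_rfl hopen.uniqueMDiffOn
  have h2 : Continuous fun p : EuclideanSpace ℝ (Fin d) × EuclideanSpace ℝ (Fin d) =>
      (⟨p.1, p.2⟩ : TangentBundle 𝓘(ℝ, EuclideanSpace ℝ (Fin d)) (EuclideanSpace ℝ (Fin d))) := by
    exact (tangentBundleModelSpaceHomeomorph 𝓘(ℝ, EuclideanSpace ℝ (Fin d))).symm.continuous
  refine (h1.comp h2.continuousOn (fun p hp => hp.1)).congr fun p hp => ?_
  show _ = tangentMapWithin _ _ _ _ _
  simp only [tangentMapWithin, mfderivWithin_of_isOpen hopen hp.1]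
  rfl

/-- The curve in the manifold given by a curve in the chart. -/
theorem hasMFDerivAt_chart_symm_comp {x₀ : M} {η : ℝ → EuclideanSpace ℝ (Fin d)}
    {w : EuclideanSpace ℝ (Fin d)} {t : ℝ} (hη : HasDerivAt η w t)
    (ht : η t ∈ (extChartAt (𝓡 d) x₀).target) :
    HasMFDerivAt 𝓘(ℝ, ℝ) (𝓡 d) ((extChartAt (𝓡 d) x₀).symm ∘ η) t
      ((chartInv x₀ (η t)).comp (ContinuousLinearMap.toSpanSingleton ℝ w)) :=
  (hasMFDerivAt_chart_symm ht).comp t hη.hasFDerivAt.hasMFDerivAt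

theorem uniqueMDiffWithinAt_unitInterval {t : ℝ} (ht : t ∈ Icc (0 : ℝ) 1) :
    UniqueMDiffWithinAt 𝓘(ℝ, ℝ) (Icc (0 : ℝ) 1) t :=
  (uniqueDiffOn_Icc zero_lt_one t ht).uniqueMDiffWithinAt

theorem mfderivWithin_chart_symm_comp {x₀ : M} {η : ℝ → EuclideanSpace ℝ (Fin d)}
    {w : EuclideanSpace ℝ (Fin d)} {t : ℝ} (hη : HasDerivAt η w t)
    (ht : η t ∈ (extChartAt (𝓡 d) x₀).target) (ht' : t ∈ Icc (0 : ℝ) 1) :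
    mfderivWithin 𝓘(ℝ, ℝ) (𝓡 d) ((extChartAt (𝓡 d) x₀).symm ∘ η) (Icc 0 1) t (1 : ℝ)
      = chartInv x₀ (η t) w := by
  rw [((hasMFDerivAt_chart_symm_comp hη ht).hasMFDerivWithinAt).mfderivWithin
    (uniqueMDiffWithinAt_unitInterval ht')]
  show chartInv x₀ (η t) ((1 : ℝ) • w) = _
  rw [one_smul]

theorem isC1Path_chart_symm_comp {x₀ : M} {η η' : ℝ → EuclideanSpace ℝ (Fin d)}
    (hη : ∀ t, HasDerivAt η (η' t) t) (hη' : Continuous η')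
    (ht : ∀ t ∈ Icc (0 : ℝ) 1, η t ∈ (extChartAt (𝓡 d) x₀).target) :
    IsC1Path d ((extChartAt (𝓡 d) x₀).symm ∘ η) := by
  have h1 : ContDiff ℝ 1 η := by
    rw [contDiff_one_iff_deriv]
    refine ⟨fun t => (hη t).differentiableAt, ?_⟩
    rwa [funext fun t => (hη t).deriv]
  exact (contMDiffOn_extChartAt_symm x₀).comp h1.contMDiff.contMDiffOn ht

end Chart

section Retraction

variable {F : Type*} [NormedAddCommGroup F] [NormedSpace ℝ F]

/-- Radial retraction onto a closed ball. -/
def ballRetract (c : F) (ρ : ℝ) (z : F) : F := c + (ρ / max ρ ‖z - c‖) • (z - c)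

theorem continuous_ballRetract (c : F) {ρ : ℝ} (hρ : 0 < ρ) : Continuous (ballRetract c ρ) := by
  unfold ballRetract
  refine continuous_const.add (Continuous.smul (Continuous.div continuous_const (by fun_prop)
    fun z => (lt_max_of_lt_left hρ).ne') (by fun_prop))

theorem ballRetract_mem (c : F) {ρ : ℝ} (hρ : 0 < ρ) (z : F) :
    ballRetract c ρ z ∈ Metric.closedBall c ρ := by
  have h : 0 < max ρ ‖z - c‖ := lt_max_of_lt_left hρ
  rw [Metric.mem_closedBall, dist_eq_norm, ballRetract, add_sub_cancel_left, norm_smul,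
    Real.norm_of_nonneg (by positivity), div_mul_eq_mul_div, div_le_iff₀ h]
  gcongr
  exact le_max_right _ _

theorem ballRetract_of_mem {c : F} {ρ : ℝ} (hρ : 0 < ρ) {z : F}
    (hz : z ∈ Metric.closedBall c ρ) : ballRetract c ρ z = z := by
  rw [Metric.mem_closedBall, dist_eq_norm] at hz
  rw [ballRetract, max_eq_left hz, div_self hρ.ne', one_smul, add_sub_cancel]

end Retraction

section LocalBox

variable {d : ℕ} {M : Type*} [TopologicalSpace M] [ChartedSpace (EuclideanSpace ℝ (Fin d)) M]
  [IsManifold (𝓡 d) ∞ M] [RiemannianBundle (fun x : M => TangentSpace (𝓡 d) x)]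

/-- A closed ball in the preferred chart at `x₀`, with a linear projection `proj` along `Eu x₀` and
the continuous field `lift` of linear sections of `proj` whose range is `Ecs` read in the chart. -/
structure LocalBox (Ecs Eu : ∀ x : M, Submodule ℝ (TangentSpace (𝓡 d) x)) (x₀ : M) where
  k : ℕ
  proj : EuclideanSpace ℝ (Fin d) →L[ℝ] EuclideanSpace ℝ (Fin k)
  ρ : ℝ
  ρ_pos : 0 < ρ
  ball_subset : Metric.closedBall (extChartAt (𝓡 d) x₀ x₀) ρ ⊆ (extChartAt (𝓡 d) x₀).target
  lift : EuclideanSpace ℝ (Fin d) → EuclideanSpace ℝ (Fin k) →L[ℝ] EuclideanSpace ℝ (Fin d)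
  continuous_lift : Continuous lift
  C : ℝ
  C_pos : 0 < C
  lift_le : ∀ z u, ‖lift z u‖ ≤ C * ‖u‖
  proj_lift : ∀ z u, proj (lift z u) = u
  mem_iff : ∀ z ∈ Metric.closedBall (extChartAt (𝓡 d) x₀ x₀) ρ, ∀ w,
    chartInv x₀ z w ∈ Ecs ((extChartAt (𝓡 d) x₀).symm z) ↔ lift z (proj w) = w
  proj_eq_zero : ∀ v : TangentSpace (𝓡 d) x₀,
    proj (vderiv (extChartAt (𝓡 d) x₀) x₀ v) = 0 ↔ v ∈ Eu x₀
  norm_chartInv_le : ∀ z ∈ Metric.closedBall (extChartAt (𝓡 d) x₀ x₀) ρ, ∀ w,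
    ‖chartInv x₀ z w‖ ≤ C * ‖w‖

theorem eventually_norm_chartInv_le
    [IsContinuousRiemannianBundle (EuclideanSpace ℝ (Fin d)) (fun x : M => TangentSpace (𝓡 d) x)]
    (x₀ : M) : ∃ C : ℝ, 0 < C ∧ ∀ᶠ z in 𝓝 (extChartAt (𝓡 d) x₀ x₀), ∀ w,
      ‖chartInv x₀ z w‖ ≤ C * ‖w‖ := by
  obtain ⟨C, hC, h⟩ := eventually_norm_symmL_trivializationAt_lt (EuclideanSpace ℝ (Fin d))
    (fun x : M => TangentSpace (𝓡 d) x) x₀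
  refine ⟨C, hC, ?_⟩
  have hs : Tendsto (extChartAt (𝓡 d) x₀).symm (𝓝 (extChartAt (𝓡 d) x₀ x₀)) (𝓝 x₀) := by
    have := (continuousAt_extChartAt_symm (I := 𝓡 d) x₀).tendsto
    rwa [extChartAt_to_inv] at this
  filter_upwards [hs.eventually h, (isOpen_chart_target x₀).mem_nhds (mem_extChartAt_target x₀)]
    with z hz hzt w
  have hsrc : (extChartAt (𝓡 d) x₀).symm z ∈ (chartAt (EuclideanSpace ℝ (Fin d)) x₀).source := by
    rw [← extChartAt_source (𝓡 d)]; exact (extChartAt (𝓡 d) x₀).map_target hzt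
  have h1 := TangentBundle.symmL_trivializationAt (I := 𝓡 d) hsrc
  rw [(extChartAt (𝓡 d) x₀).right_inv hzt, ModelWithCorners.range_eq_univ, mfderivWithin_univ] at h1
  have h2 : chartInv x₀ z w = (trivializationAt (EuclideanSpace ℝ (Fin d))
    (TangentSpace (𝓡 d) : M → Type _) x₀).symmL ℝ ((extChartAt (𝓡 d) x₀).symm z) w :=
    (DFunLike.congr_fun h1 w).symm
  rw [h2]
  exact (ContinuousLinearMap.le_opNorm _ _).trans (by gcongr)

/-- In the chart, `Ecs` is the range of a continuous frame `A`, and `p` is the projection along `Eu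
x₀` with values in the coordinates of `A x₀`. Near `x₀` the map `p A` remains invertible, and `A (p
A)⁻¹` is the section of `p` with range `Ecs`. -/
theorem exists_localBox
    [IsContinuousRiemannianBundle (EuclideanSpace ℝ (Fin d)) (fun x : M => TangentSpace (𝓡 d) x)]
    {Ecs Eu : ∀ x : M, Submodule ℝ (TangentSpace (𝓡 d) x)} (hEcs : IsContinuousSubbundle Ecs)
    (hsplit : ∀ x : M, IsCompl (Ecs x) (Eu x)) (x₀ : M) :
    Nonempty (LocalBox Ecs Eu x₀) := by
  let χ := extChartAt (𝓡 d) x₀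
  have hx₀ : x₀ ∈ χ.source := mem_extChartAt_source x₀
  obtain ⟨U, hUs, hU, hxU, k, A, hA, hA'⟩ := hEcs.exists_frame (g := χ)
    (isOpen_extChartAt_source x₀) hx₀ (continuousOn_vderiv_chart x₀)
    (fun x hx => injective_vderiv_chart hx)
  let D : TangentSpace (𝓡 d) x₀ ≃ₗ[ℝ] EuclideanSpace ℝ (Fin d) := LinearEquiv.ofBijective
    (vderiv (d := d) χ x₀).toLinearMap ⟨injective_vderiv_chart hx₀, surjective_vderiv_chart hx₀⟩
  have hrange : LinearMap.range (A x₀).toLinearMap = (Ecs x₀).map D.toLinearMap := by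
    ext w
    exact ((hA' x₀ hxU).2 w)
  have hcompl : IsCompl (LinearMap.range (A x₀).toLinearMap) ((Eu x₀).map D.toLinearMap) := by
    rw [hrange]
    exact (hsplit x₀).map (Submodule.orderIsoMapComap D)
  let p : EuclideanSpace ℝ (Fin d) →L[ℝ] EuclideanSpace ℝ (Fin k) :=
    (LinearMap.linearProjOfIsCompl _ (A x₀).toLinearMap (hA' x₀ hxU).1 hcompl).toContinuousLinearMap
  have hpA : ∀ u, p (A x₀ u) = u := fun u =>
    LinearMap.linearProjOfIsCompl_apply_left _ (A x₀).toLinearMap (hA' x₀ hxU).1 hcompl u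
  have hpker : ∀ w, p w = 0 ↔ w ∈ (Eu x₀).map D.toLinearMap := fun w => by
    rw [← LinearMap.ker_linearProjOfIsCompl _ (A x₀).toLinearMap (hA' x₀ hxU).1 hcompl]
    exact Iff.rfl
  obtain ⟨N, hN, hNU, G, hG, hGJ⟩ := exists_continuousOn_leftInverse
    (J := fun x => p.comp (A x)) (hU.mem_nhds hxU) (continuousOn_const.clm_comp hA)
    (fun u v huv => by rw [← hpA u, ← hpA v]; exact huv)
  -- A left inverse of a square matrix is also a right inverse.
  have hJG : ∀ x ∈ N, ∀ u, p (A x (G x u)) = u := by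
    intro x hx u
    have hinj : Function.Injective (p.comp (A x)).toLinearMap :=
      Function.LeftInverse.injective (g := G x) (hGJ x hx)
    obtain ⟨v, rfl⟩ := LinearMap.injective_iff_surjective.1 hinj u
    exact congrArg (fun y => p (A x y)) (hGJ x hx v)
  obtain ⟨Cn, hCn, hev⟩ := eventually_norm_chartInv_le (d := d) x₀
  have hs : Tendsto χ.symm (𝓝 (χ x₀)) (𝓝 x₀) := by
    have := (continuousAt_extChartAt_symm (I := 𝓡 d) x₀).tendsto
    rwa [extChartAt_to_inv] at this
  obtain ⟨ρ, hρ, hball⟩ := Metric.nhds_basis_closedBall.mem_iff.1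
    (inter_mem (inter_mem ((isOpen_chart_target x₀).mem_nhds (mem_extChartAt_target x₀))
      (hs hN)) hev)
  have hcont : ContinuousOn (fun z => (A (χ.symm z)).comp (G (χ.symm z)))
      (Metric.closedBall (χ x₀) ρ) := by
    have hsc : ContinuousOn χ.symm (Metric.closedBall (χ x₀) ρ) :=
      (continuousOn_extChartAt_symm x₀).mono fun z hz => (hball hz).1.1
    exact ((hA.mono hNU).comp hsc fun z hz => (hball hz).1.2).clm_comp
      (hG.comp hsc fun z hz => (hball hz).1.2)
  obtain ⟨C, hC⟩ := (isCompact_closedBall (χ x₀) ρ).bddAbove_image hcont.norm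
  have hC' : ∀ z ∈ Metric.closedBall (χ x₀) ρ, ‖(A (χ.symm z)).comp (G (χ.symm z))‖ ≤ C :=
    fun z hz => hC (mem_image_of_mem _ hz)
  -- Composing with the radial retraction extends the field to the whole space with the same bound,
  -- so that Peano's theorem applies without leaving a domain.
  refine ⟨⟨k, p, ρ, hρ, fun z hz => (hball hz).1.1,
    fun z => (A (χ.symm (ballRetract (χ x₀) ρ z))).comp (G (χ.symm (ballRetract (χ x₀) ρ z))),
    ?_, max C Cn, lt_max_of_lt_right hCn, ?_, ?_, ?_, ?_, ?_⟩⟩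
  · exact hcont.comp_continuous (continuous_ballRetract _ hρ) (ballRetract_mem _ hρ)
  · intro z u
    refine (ContinuousLinearMap.le_opNorm _ _).trans ?_
    gcongr
    exact (hC' _ (ballRetract_mem _ hρ z)).trans (le_max_left _ _)
  · intro z u
    exact hJG _ (hball (ballRetract_mem _ hρ z)).1.2 u
  · intro z hz w
    have hr : ballRetract (χ x₀) ρ z = z := ballRetract_of_mem hρ hz
    show _ ↔ A (χ.symm (ballRetract (χ x₀) ρ z)) (G (χ.symm (ballRetract (χ x₀) ρ z)) (p w)) = w
    rw [hr]
    have hzt := (hball hz).1.1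
    have hzN : χ.symm z ∈ N := (hball hz).1.2
    constructor
    · intro hw
      obtain ⟨u, hu⟩ := ((hA' _ (hNU hzN)).2 w).2 ⟨_, hw, vderiv_chart_chartInv hzt w⟩
      rw [← hu]
      exact congrArg (A (χ.symm z)) (hGJ _ hzN u)
    · intro hw
      obtain ⟨v, hv, hv'⟩ := ((hA' _ (hNU hzN)).2 w).1 ⟨_, hw⟩
      rw [← hv', chartInv_vderiv_chart hzt]
      exact hv
  · intro v
    rw [hpker]
    constructor
    · rintro ⟨v', hv', h⟩
      rwa [← D.injective h]
    · intro hv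
      exact ⟨v, hv, rfl⟩
  · intro z hz w
    exact ((hball hz).2 w).trans (by gcongr; exact le_max_right _ _)

end LocalBox

/-! ### Paths tangent to a bundle, and lifts of segments in a box. -/

section Paths

variable {d : ℕ} {M : Type*} [TopologicalSpace M] [ChartedSpace (EuclideanSpace ℝ (Fin d)) M]
  [IsManifold (𝓡 d) ∞ M]

theorem mfderivWithin_comp_path {g : M → M} (hg : ContMDiff (𝓡 d) (𝓡 d) 1 g) {γ : ℝ → M}
    (hγ : IsC1Path d γ) {t : ℝ} (ht : t ∈ Icc (0 : ℝ) 1) :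
    mfderivWithin 𝓘(ℝ, ℝ) (𝓡 d) (g ∘ γ) (Icc 0 1) t (1 : ℝ)
      = mfderiv (𝓡 d) (𝓡 d) g (γ t) (mfderivWithin 𝓘(ℝ, ℝ) (𝓡 d) γ (Icc 0 1) t (1 : ℝ)) := by
  rw [mfderiv_comp_mfderivWithin t (hg.mdifferentiable one_ne_zero _)
    (hγ.mdifferentiableOn one_ne_zero t ht) (uniqueMDiffWithinAt_unitInterval ht)]
  rfl

theorem IsC1Path.comp {g : M → M} (hg : ContMDiff (𝓡 d) (𝓡 d) 1 g) {γ : ℝ → M}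
    (hγ : IsC1Path d γ) : IsC1Path d (g ∘ γ) := hg.comp_contMDiffOn hγ

theorem IsTangentPath.comp {E : ∀ x : M, Submodule ℝ (TangentSpace (𝓡 d) x)} {g : M → M}
    (hg : ContMDiff (𝓡 d) (𝓡 d) 1 g) {γ : ℝ → M} (hγ : IsC1Path d γ)
    (hE : ∀ x, ∀ v ∈ E x, mfderiv (𝓡 d) (𝓡 d) g x v ∈ E (g x)) (hγ' : IsTangentPath E γ) :
    IsTangentPath E (g ∘ γ) := by
  intro t ht
  rw [mfderivWithin_comp_path hg hγ ht]
  exact hE _ _ (hγ' t ht)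

theorem chartInv_vderiv_eq {x₀ x : M} (hx : x ∈ (extChartAt (𝓡 d) x₀).source)
    (v : TangentSpace (𝓡 d) x) :
    (⟨(extChartAt (𝓡 d) x₀).symm (extChartAt (𝓡 d) x₀ x),
      chartInv x₀ (extChartAt (𝓡 d) x₀ x) (vderiv (extChartAt (𝓡 d) x₀) x v)⟩ :
      TangentBundle (𝓡 d) M) = ⟨x, v⟩ := by
  have key : ∀ z ∈ (extChartAt (𝓡 d) x₀).target, ∀ y, y = (extChartAt (𝓡 d) x₀).symm z →
      ∀ v : TangentSpace (𝓡 d) y, (⟨(extChartAt (𝓡 d) x₀).symm z,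
        chartInv x₀ z (vderiv (extChartAt (𝓡 d) x₀) y v)⟩ : TangentBundle (𝓡 d) M) = ⟨y, v⟩ := by
    rintro z hz y rfl v
    rw [chartInv_vderiv_chart hz]
  exact key _ ((extChartAt (𝓡 d) x₀).map_source hx) x ((extChartAt (𝓡 d) x₀).left_inv hx).symm v

variable [RiemannianBundle (fun x : M => TangentSpace (𝓡 d) x)]

theorem pathELength_le_of_enorm_le {γ : ℝ → M} {c : ℝ}
    (h : ∀ t ∈ Icc (0 : ℝ) 1, ‖mfderivWithin 𝓘(ℝ, ℝ) (𝓡 d) γ (Icc 0 1) t (1 : ℝ)‖ ≤ c) :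
    pathELength (𝓡 d) γ 0 1 ≤ ENNReal.ofReal c := by
  rw [pathELength_eq_lintegral_mfderivWithin_Icc]
  calc _ ≤ ∫⁻ _ in Icc (0 : ℝ) 1, ENNReal.ofReal c := by
        refine MeasureTheory.setLIntegral_mono measurable_const fun t ht => ?_
        rw [← ofReal_norm]
        exact ENNReal.ofReal_le_ofReal (h t ht)
    _ = _ := by simp

end Paths

section Lift

variable {d : ℕ} {M : Type*} [TopologicalSpace M] [ChartedSpace (EuclideanSpace ℝ (Fin d)) M]
  [IsManifold (𝓡 d) ∞ M] [RiemannianBundle (fun x : M => TangentSpace (𝓡 d) x)]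
  {Ecs Eu : ∀ x : M, Submodule ℝ (TangentSpace (𝓡 d) x)} {x₀ : M}

namespace LocalBox

variable (B : LocalBox Ecs Eu x₀)

/-- The closed ball of the box. -/
def ball : Set (EuclideanSpace ℝ (Fin d)) := Metric.closedBall (extChartAt (𝓡 d) x₀ x₀) B.ρ

/-- A curve in the chart which lifts the segment of direction `v`, starting from `z`. -/
structure IsLift (z : EuclideanSpace ℝ (Fin d)) (v : EuclideanSpace ℝ (Fin B.k))
    (ζ : ℝ → EuclideanSpace ℝ (Fin d)) : Prop where
  zero : ζ 0 = z
  hasDerivAt : ∀ t, HasDerivAt ζ (B.lift (ζ (clip t)) v) t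

variable {B}

theorem exists_isLift (z : EuclideanSpace ℝ (Fin d)) (v : EuclideanSpace ℝ (Fin B.k)) :
    ∃ ζ, B.IsLift z v ζ := by
  obtain ⟨ζ, h1, h2⟩ := exists_hasDerivAt_of_continuous_of_bounded
    (X := fun z => B.lift z v) (by have := B.continuous_lift; fun_prop)
    (fun z => B.lift_le z v) z
  exact ⟨ζ, h1, h2⟩

variable {z : EuclideanSpace ℝ (Fin d)} {v : EuclideanSpace ℝ (Fin B.k)}
  {ζ : ℝ → EuclideanSpace ℝ (Fin d)}

theorem IsLift.continuous (h : B.IsLift z v ζ) : Continuous ζ :=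
  continuous_iff_continuousAt.2 fun t => (h.hasDerivAt t).continuousAt

theorem IsLift.norm_sub_le (h : B.IsLift z v ζ) (t : ℝ) : ‖ζ t - z‖ ≤ B.C * ‖v‖ * |t| := by
  have := norm_sub_le_of_hasDerivAt h.hasDerivAt (fun t => B.lift_le _ v) 0 t
  rwa [h.zero, sub_zero] at this

/-- As `lift` is a section of `proj`, the projected curve has constant velocity `v`. -/
theorem IsLift.proj_eq (h : B.IsLift z v ζ) (t : ℝ) : B.proj (ζ t) = B.proj z + t • v := by
  have h1 : ∀ t, HasDerivAt (fun t => B.proj (ζ t) - t • v) 0 t := by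
    intro t
    have h2 := B.proj.hasFDerivAt.comp_hasDerivAt t (h.hasDerivAt t)
    have h3 := h2.sub ((hasDerivAt_id t).smul_const v)
    rw [B.proj_lift, one_smul, sub_self] at h3
    exact h3
  have h2 := is_const_of_deriv_eq_zero (fun t => (h1 t).differentiableAt) (fun t => (h1 t).deriv) t 0
  simp only [zero_smul, sub_zero, h.zero] at h2
  rw [← h2, sub_add_cancel]

theorem isTangentPath {η η' : ℝ → EuclideanSpace ℝ (Fin d)}
    (hη : ∀ t, HasDerivAt η (η' t) t) (hb : ∀ t ∈ Icc (0 : ℝ) 1, η t ∈ B.ball)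
    (hl : ∀ t ∈ Icc (0 : ℝ) 1, B.lift (η t) (B.proj (η' t)) = η' t) :
    IsTangentPath Ecs ((extChartAt (𝓡 d) x₀).symm ∘ η) := by
  intro t ht
  rw [mfderivWithin_chart_symm_comp (hη t) (B.ball_subset (hb t ht)) ht]
  exact (B.mem_iff _ (hb t ht) _).2 (hl t ht)

theorem isC1Path {η η' : ℝ → EuclideanSpace ℝ (Fin d)}
    (hη : ∀ t, HasDerivAt η (η' t) t) (hη' : Continuous η')
    (hb : ∀ t ∈ Icc (0 : ℝ) 1, η t ∈ B.ball) :
    IsC1Path d ((extChartAt (𝓡 d) x₀).symm ∘ η) :=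
  isC1Path_chart_symm_comp hη hη' fun t ht => B.ball_subset (hb t ht)

theorem pathELength_le {η η' : ℝ → EuclideanSpace ℝ (Fin d)} {c : ℝ}
    (hη : ∀ t, HasDerivAt η (η' t) t) (hb : ∀ t ∈ Icc (0 : ℝ) 1, η t ∈ B.ball)
    (hc : ∀ t ∈ Icc (0 : ℝ) 1, ‖η' t‖ ≤ c) :
    pathELength (𝓡 d) ((extChartAt (𝓡 d) x₀).symm ∘ η) 0 1 ≤ ENNReal.ofReal (B.C * c) := by
  refine pathELength_le_of_enorm_le fun t ht => ?_
  rw [mfderivWithin_chart_symm_comp (hη t) (B.ball_subset (hb t ht)) ht]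
  exact (B.norm_chartInv_le _ (hb t ht) _).trans
    (mul_le_mul_of_nonneg_left (hc t ht) B.C_pos.le)

theorem IsLift.mem_ball (h : B.IsLift z v ζ)
    (hz : ‖z - extChartAt (𝓡 d) x₀ x₀‖ + B.C * ‖v‖ ≤ B.ρ) {t : ℝ} (ht : t ∈ Icc (0 : ℝ) 1) :
    ζ t ∈ B.ball := by
  rw [ball, Metric.mem_closedBall, dist_eq_norm]
  have h1 := h.norm_sub_le t
  have h2 : B.C * ‖v‖ * |t| ≤ B.C * ‖v‖ * 1 := by
    have := B.C_pos
    gcongr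
    rw [abs_of_nonneg ht.1]; exact ht.2
  have h3 : ‖ζ t - extChartAt (𝓡 d) x₀ x₀‖ ≤ ‖ζ t - z‖ + ‖z - extChartAt (𝓡 d) x₀ x₀‖ := by
    simpa using norm_add_le (ζ t - z) (z - extChartAt (𝓡 d) x₀ x₀)
  linarith

end LocalBox

end Lift

/-! ### From Lyapunov stability to a uniform bound on the derivatives along `Ecs`. -/

section Bound

variable {d : ℕ} {M : Type*} [TopologicalSpace M] [ChartedSpace (EuclideanSpace ℝ (Fin d)) M]
  [IsManifold (𝓡 d) ∞ M] [RiemannianBundle (fun x : M => TangentSpace (𝓡 d) x)]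
  [IsContinuousRiemannianBundle (EuclideanSpace ℝ (Fin d)) (fun x : M => TangentSpace (𝓡 d) x)]

/-- A function oscillating `K` times between `0` and `τ` on the unit interval. -/
def wiggle (τ : ℝ) (K : ℕ) (t : ℝ) : ℝ := τ * ((1 - Real.cos (2 * Real.pi * K * t)) / 2)

theorem hasDerivAt_wiggle (τ : ℝ) (K : ℕ) (t : ℝ) :
    HasDerivAt (wiggle τ K) (τ * Real.pi * K * Real.sin (2 * Real.pi * K * t)) t := by
  have h1 : HasDerivAt (fun t : ℝ => 2 * Real.pi * K * t) (2 * Real.pi * K) t := by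
    simpa using (hasDerivAt_id t).const_mul (2 * Real.pi * K)
  have h2 : HasDerivAt (wiggle τ K)
      (τ * (-(-Real.sin (2 * Real.pi * K * t) * (2 * Real.pi * K)) / 2)) t :=
    (((h1.cos).const_sub 1).div_const 2).const_mul τ
  convert h2 using 1
  ring

theorem wiggle_mem {τ : ℝ} (hτ : 0 ≤ τ) (K : ℕ) (t : ℝ) : wiggle τ K t ∈ Icc 0 τ := by
  have h1 := Real.neg_one_le_cos (2 * Real.pi * K * t)
  have h2 := Real.cos_le_one (2 * Real.pi * K * t)
  constructor
  · exact mul_nonneg hτ (by linarith)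
  · exact mul_le_of_le_one_right hτ (by linarith)

theorem lintegral_sin_sq_unit {K : ℕ} (hK : 0 < K) {c : ℝ} (hc : 0 ≤ c) :
    ∫⁻ t in Icc (0 : ℝ) 1, ENNReal.ofReal (c * Real.sin (2 * Real.pi * K * t) ^ 2)
      = ENNReal.ofReal (c / 2) := by
  have hcont : Continuous fun t : ℝ => c * Real.sin (2 * Real.pi * K * t) ^ 2 := by fun_prop
  rw [← MeasureTheory.ofReal_integral_eq_lintegral_ofReal
    (hcont.continuousOn.integrableOn_Icc) (Eventually.of_forall fun t => by positivity)]
  congr 1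
  rw [MeasureTheory.integral_Icc_eq_integral_Ioc,
    ← intervalIntegral.integral_of_le zero_le_one, intervalIntegral.integral_const_mul]
  have hK' : (2 * Real.pi * K : ℝ) ≠ 0 := by
    have := Real.pi_pos; positivity
  have h := intervalIntegral.integral_comp_mul_left (a := 0) (b := 1)
    (fun x => Real.sin x ^ 2) hK'
  rw [h, integral_sin_sq]
  have hs : Real.sin (2 * Real.pi * K * 1) = 0 := by
    rw [show 2 * Real.pi * K * 1 = ((2 * K : ℕ) : ℝ) * Real.pi by push_cast; ring]
    exact Real.sin_nat_mul_pi _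
  rw [hs]
  simp
  field_simp

/-- Lyapunov stability along `Ecs` forces uniform bounds on the derivatives of the iterates along
`Ecs`: otherwise a path oscillating in a tiny region would be stretched too much. -/
theorem IsLyapunovStable.exists_norm_mfderiv_iterate_le {f : M → M}
    (hf : ContMDiff (𝓡 d) (𝓡 d) 1 f) {Ecs Eu : ∀ x : M, Submodule ℝ (TangentSpace (𝓡 d) x)}
    (hEcs : IsContinuousSubbundle Ecs) (hsplit : ∀ x : M, IsCompl (Ecs x) (Eu x))
    (hlyap : IsLyapunovStable f Ecs) :
    ∃ C₀ : ℝ, 0 < C₀ ∧ ∀ (n : ℕ) (x : M), ∀ v ∈ Ecs x,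
      ‖mfderiv (𝓡 d) (𝓡 d) f^[n] x v‖ ≤ C₀ * ‖v‖ := by
  obtain ⟨δ, hδ, hlyap⟩ := hlyap 1 one_pos
  refine ⟨8 / δ, by positivity, fun n x w hw => ?_⟩
  by_cases hw0 : w = 0
  · simp [hw0]
  have hw0' : 0 < ‖w‖ := norm_pos_iff.2 hw0
  refine le_of_forall_lt fun A hA => ?_
  rcases lt_or_ge A 0 with hA0 | hA0
  · exact hA0.trans_le (by positivity)
  obtain ⟨B⟩ := exists_localBox hEcs hsplit x
  set χ := extChartAt (𝓡 d) x
  have hx : x ∈ χ.source := mem_extChartAt_source x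
  have hz₀ : χ x ∈ B.ball := Metric.mem_closedBall_self B.ρ_pos.le
  set u := B.proj (vderiv χ x w)
  have hTw := chartInv_vderiv_eq hx w
  have hlift : B.lift (χ x) u = vderiv χ x w := by
    refine (B.mem_iff _ hz₀ _).1 ?_
    have : ∀ p : TangentBundle (𝓡 d) M, p = ⟨x, w⟩ → p.2 ∈ Ecs p.1 := by
      rintro p rfl; exact hw
    exact this _ hTw
  obtain ⟨ζ, hζ⟩ := B.exists_isLift (χ x) u
  -- the velocity of the lifted curve
  let p : ℝ → TangentBundle (𝓡 d) M := fun s => ⟨χ.symm (ζ s), chartInv x (ζ s) (B.lift (ζ s) u)⟩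
  have hp0 : p 0 = ⟨x, w⟩ := by
    show (⟨χ.symm (ζ 0), chartInv x (ζ 0) (B.lift (ζ 0) u)⟩ : TangentBundle (𝓡 d) M) = _
    rw [hζ.zero, hlift]; exact hTw
  have hpc : ContinuousAt p 0 := by
    have h1 : Continuous fun s => (ζ s, B.lift (ζ s) u) := by
      have := hζ.continuous
      have := B.continuous_lift
      fun_prop
    refine ContinuousAt.comp (f := fun s => (ζ s, B.lift (ζ s) u))
      ((continuousOn_chartInv x).continuousAt ?_) h1.continuousAt
    refine prod_mem_nhds ((isOpen_chart_target x).mem_nhds ?_) univ_mem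
    rw [hζ.zero]; exact mem_extChartAt_target x
  have c1 : ContinuousAt (fun s => ‖(p s).2‖) 0 :=
    (continuous_norm_tangentBundle (d := d) (M := M)).continuousAt.comp hpc
  have c2 : ContinuousAt (fun s => ‖mfderiv (𝓡 d) (𝓡 d) f^[n] (p s).1 (p s).2‖) 0 :=
    ((continuous_norm_tangentBundle (d := d) (M := M)).comp
      ((contMDiff_iterate hf n).continuous_tangentMap le_rfl)).continuousAt.comp hpc
  have q1 : ‖(p 0).2‖ < 2 * ‖w‖ := by rw [hp0]; linarith
  have q2 : A < ‖mfderiv (𝓡 d) (𝓡 d) f^[n] (p 0).1 (p 0).2‖ := by rw [hp0]; exact hA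
  have c3 : ∀ᶠ s in 𝓝 (0 : ℝ), ζ s ∈ B.ball := by
    refine hζ.continuous.continuousAt.eventually ?_
    rw [hζ.zero]
    exact Metric.closedBall_mem_nhds _ B.ρ_pos
  obtain ⟨τ₀, hτ₀, hτ⟩ := Metric.eventually_nhds_iff.1
    ((c1.eventually_lt continuousAt_const q1).and
      ((continuousAt_const.eventually_lt c2 q2).and c3))
  -- The oscillating path has speed at most `L * (2 * ‖w‖) = δ / 2`, hence length below `δ`. Its
  -- image has length at least `L * A / 2`, which must be below `1`: this gives `A < 8 / δ * ‖w‖`.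
  set L := δ / (4 * ‖w‖)
  have hL : 0 < L := by positivity
  -- Many oscillations make the amplitude `τ = L / (π K)` tiny at constant length, keeping the path
  -- where `Dfⁿ` of its direction still has norm above `A`.
  obtain ⟨K, hK0, hK⟩ : ∃ K : ℕ, 0 < K ∧ L / (Real.pi * K) < min τ₀ 1 := by
    obtain ⟨K, hK⟩ := exists_nat_gt (L / (Real.pi * min τ₀ 1))
    have hm : 0 < min τ₀ 1 := lt_min hτ₀ one_pos
    have hπ := Real.pi_pos
    have hK0 : (0 : ℝ) < K := lt_of_le_of_lt (by positivity) hK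
    refine ⟨K, by exact_mod_cast hK0, ?_⟩
    rw [div_lt_iff₀ (by positivity)] at hK ⊢
    linarith
  set τ := L / (Real.pi * K)
  have hπ := Real.pi_pos
  have hKpos : (0 : ℝ) < K := by exact_mod_cast hK0
  have hτpos : 0 < τ := by positivity
  have hτL : τ * Real.pi * K = L := by simp only [τ]; field_simp
  have hwig : ∀ t, wiggle τ K t ∈ Icc (0 : ℝ) 1 ∧ dist (wiggle τ K t) 0 < τ₀ := by
    intro t
    have h1 := wiggle_mem hτpos.le K t
    have h2 := hK.trans_le (min_le_left _ _)
    have h3 := hK.trans_le (min_le_right _ _)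
    refine ⟨⟨h1.1, h1.2.trans h3.le⟩, ?_⟩
    rw [Real.dist_eq, sub_zero, abs_of_nonneg h1.1]
    exact h1.2.trans_lt h2
  let η : ℝ → EuclideanSpace ℝ (Fin d) := fun t => ζ (wiggle τ K t)
  let η' : ℝ → EuclideanSpace ℝ (Fin d) := fun t =>
    (L * Real.sin (2 * Real.pi * K * t)) • B.lift (ζ (wiggle τ K t)) u
  have hη : ∀ t, HasDerivAt η (η' t) t := by
    intro t
    have h1 := (hζ.hasDerivAt (wiggle τ K t)).scomp t (hasDerivAt_wiggle τ K t)
    rw [clip_of_mem (hwig t).1, hτL] at h1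
    exact h1
  have hη'c : Continuous η' := by
    have h1 := hζ.continuous
    have h2 := B.continuous_lift
    have h3 : Continuous (wiggle τ K) := by unfold wiggle; fun_prop
    fun_prop
  have hb : ∀ t ∈ Icc (0 : ℝ) 1, η t ∈ B.ball := fun t _ => (hτ (hwig t).2).2.2
  have hvel : ∀ t ∈ Icc (0 : ℝ) 1, mfderivWithin 𝓘(ℝ, ℝ) (𝓡 d) (χ.symm ∘ η) (Icc 0 1) t (1 : ℝ)
      = (L * Real.sin (2 * Real.pi * K * t)) • (p (wiggle τ K t)).2 := by
    intro t ht
    rw [mfderivWithin_chart_symm_comp (hη t) (B.ball_subset (hb t ht)) ht, map_smul]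
  have hC1 : IsC1Path d (χ.symm ∘ η) := B.isC1Path hη hη'c hb
  have hlen := hlyap (χ.symm ∘ η) hC1 (B.isTangentPath hη hb fun t _ => by
      simp only [η', map_smul, B.proj_lift, η]) ?_ n
  · rw [pathELength_eq_lintegral_mfderivWithin_Icc] at hlen
    have hle : ENNReal.ofReal (L * A / 2) < ENNReal.ofReal 1 := by
      refine lt_of_le_of_lt ?_ hlen
      rw [← lintegral_sin_sq_unit hK0 (by positivity)]
      refine MeasureTheory.setLIntegral_mono' measurableSet_Icc fun t ht => ?_
      have key := congrArg norm
        (mfderivWithin_comp_path (contMDiff_iterate hf n) hC1 ht)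
      rw [hvel t ht, map_smul, norm_smul] at key
      refine (ENNReal.ofReal_le_ofReal ?_).trans (ofReal_norm _).le
      refine le_trans ?_ key.ge
      rw [norm_mul, Real.norm_of_nonneg hL.le, Real.norm_eq_abs]
      have h1 := (hτ (hwig t).2).2.1.le
      -- Replacing `|sin|` by `sin²` loses a constant only and makes the integral explicit.
      have h2 : Real.sin (2 * Real.pi * K * t) ^ 2 ≤ |Real.sin (2 * Real.pi * K * t)| := by
        rw [← sq_abs, sq]
        exact mul_le_of_le_one_left (abs_nonneg _) (Real.abs_sin_le_one _)
      calc L * A * Real.sin (2 * Real.pi * K * t) ^ 2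
          ≤ L * A * |Real.sin (2 * Real.pi * K * t)| := by gcongr
        _ = L * |Real.sin (2 * Real.pi * K * t)| * A := by ring
        _ ≤ _ := by gcongr; exact h1
    rw [ENNReal.ofReal_lt_ofReal_iff one_pos] at hle
    have : L * A < 2 := by linarith
    simp only [L] at this
    rw [div_mul_eq_mul_div, div_lt_iff₀ (by positivity)] at this
    rw [div_mul_eq_mul_div, lt_div_iff₀ hδ]
    linarith
  · refine lt_of_le_of_lt (pathELength_le_of_enorm_le (c := L * (2 * ‖w‖)) fun t ht => ?_) ?_
    · rw [hvel t ht, norm_smul, norm_mul, Real.norm_of_nonneg hL.le]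
      have h1 : ‖Real.sin (2 * Real.pi * K * t)‖ ≤ 1 := Real.abs_sin_le_one _
      have h2 := (hτ (hwig t).2).1.le
      calc _ ≤ L * 1 * (2 * ‖w‖) := by gcongr
        _ = _ := by ring
    · rw [ENNReal.ofReal_lt_ofReal_iff hδ]
      have : L * (2 * ‖w‖) = δ / 2 := by simp only [L]; field_simp; norm_num
      linarith

end Bound

/-! ### Pairs whose forward orbits stay close: rigidity in the cone, stability along `Ecs`. -/

section StaysClose

variable {M : Type*} [EMetricSpace M] {f : M → M} {r s : ℝ≥0∞} {p q w : M}

/-- The forward orbits of `p` and `q` stay at distance at most `r`. -/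
def StaysClose (f : M → M) (r : ℝ≥0∞) (p q : M) : Prop := ∀ n, edist (f^[n] p) (f^[n] q) ≤ r

theorem StaysClose.edist_le (h : StaysClose f r p q) : edist p q ≤ r := h 0

theorem StaysClose.symm (h : StaysClose f r p q) : StaysClose f r q p :=
  fun n => edist_comm (f^[n] p) (f^[n] q) ▸ h n

theorem StaysClose.trans (h : StaysClose f r p q) (h' : StaysClose f s q w) :
    StaysClose f (r + s) p w :=
  fun n => (edist_triangle _ _ _).trans (add_le_add (h n) (h' n))

theorem StaysClose.mono (h : StaysClose f r p q) (hrs : r ≤ s) : StaysClose f s p q :=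
  fun n => (h n).trans hrs

theorem StaysClose.iterate (h : StaysClose f r p q) (m : ℕ) :
    StaysClose f r (f^[m] p) (f^[m] q) := fun n => by
  rw [← Function.iterate_add_apply, ← Function.iterate_add_apply]; exact h _

theorem StaysClose.refl (f : M → M) (p : M) : StaysClose f r p p := fun n => by simp

end StaysClose

section Uniqueness

variable {d : ℕ} {M : Type*} [EMetricSpace M] [ChartedSpace (EuclideanSpace ℝ (Fin d)) M]
  [IsManifold (𝓡 d) ∞ M] {f : M → M} {Eu : ∀ x : M, Submodule ℝ (TangentSpace (𝓡 d) x)}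

theorem exists_forall_edist_le_of_uniformity {P : M × M → Prop} (h : ∀ᶠ p in 𝓤 M, P p) :
    ∃ r : ℝ, 0 < r ∧ ∀ p q : M, edist p q ≤ ENNReal.ofReal r → P (p, q) := by
  obtain ⟨ε, hε, h⟩ := mem_uniformity_edist.1 h
  obtain ⟨r, hr0, hr⟩ := ENNReal.lt_iff_exists_nnreal_btwn.1 hε
  refine ⟨r, by exact_mod_cast hr0, fun p q hpq => @h p q (hpq.trans_lt ?_)⟩
  simpa using hr

/-- Closeness is required only before time `j`; this finite horizon is what the induction for
pseudo-orbits needs. -/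
theorem ConeField.iterate (K : ConeField f Eu) {r : ℝ≥0∞}
    (hr : ∀ p q : M, edist p q ≤ r → K.Cone p q → K.Cone (f^[K.m] p) (f^[K.m] q) ∧
      2 * K.height p q ≤ K.height (f^[K.m] p) (f^[K.m] q)) {p q : M} (hpq : K.Cone p q) {j : ℕ}
    (hj : ∀ i < j, edist ((f^[K.m])^[i] p) ((f^[K.m])^[i] q) ≤ r) :
    K.Cone ((f^[K.m])^[j] p) ((f^[K.m])^[j] q) ∧
      2 ^ j * K.height p q ≤ K.height ((f^[K.m])^[j] p) ((f^[K.m])^[j] q) := by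
  induction j with
  | zero => simpa using hpq
  | succ j ih =>
    obtain ⟨h1, h2⟩ := ih fun i hi => hj i (hi.trans j.lt_succ_self)
    obtain ⟨h3, h4⟩ := hr _ _ (hj j j.lt_succ_self) h1
    rw [Function.iterate_succ_apply', Function.iterate_succ_apply']
    refine ⟨h3, le_trans ?_ h4⟩
    rw [pow_succ]
    linarith

/-- Two points in a cone whose forward orbits under the power `f^[K.m]` stay close are equal. -/
theorem ConeField.eq_of_forall_edist_le (K : ConeField f Eu) {r : ℝ≥0∞}
    (hr : ∀ p q : M, edist p q ≤ r → K.Cone p q → K.Cone (f^[K.m] p) (f^[K.m] q) ∧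
      2 * K.height p q ≤ K.height (f^[K.m] p) (f^[K.m] q))
    (hr' : ∀ p q : M, edist p q ≤ r → K.Cone p q → K.height p q ≤ 0 → p = q) {p q : M}
    (hpq : K.Cone p q) (h : ∀ j, edist ((f^[K.m])^[j] p) ((f^[K.m])^[j] q) ≤ r) : p = q := by
  refine hr' p q (h 0) hpq ?_
  by_contra! hpos
  obtain ⟨j, hj⟩ := pow_unbounded_of_one_lt (K.bound / K.height p q) one_lt_two
  rw [div_lt_iff₀ hpos] at hj
  exact absurd ((K.iterate hr hpq fun i _ => h i).2.trans (K.height_le _ _)) (not_le.2 hj)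

/-- Two points in a cone whose forward orbits stay close are equal. -/
theorem ConeField.exists_eq_of_staysClose (K : ConeField f Eu) :
    ∃ r : ℝ, 0 < r ∧ ∀ p q : M, K.Cone p q → StaysClose f (ENNReal.ofReal r) p q → p = q := by
  obtain ⟨r, hr, h⟩ := exists_forall_edist_le_of_uniformity (K.step.and K.eq_of_height)
  refine ⟨r, hr, fun p q hpq hs => K.eq_of_forall_edist_le (fun p q h' => (h p q h').1)
    (fun p q h' => (h p q h').2) hpq fun j => ?_⟩
  rw [← Function.iterate_mul]; exact hs _

end Uniqueness

section Paths

variable {d : ℕ} {M : Type*} [TopologicalSpace M] [ChartedSpace (EuclideanSpace ℝ (Fin d)) M]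
  [IsManifold (𝓡 d) ∞ M] {E : ∀ x : M, Submodule ℝ (TangentSpace (𝓡 d) x)} {γ : ℝ → M}

/-- The points `p` and `q` are the end points of a `C¹` path tangent to `E`. -/
def TangentJoined (E : ∀ x : M, Submodule ℝ (TangentSpace (𝓡 d) x)) (p q : M) : Prop :=
  ∃ γ : ℝ → M, IsC1Path d γ ∧ IsTangentPath E γ ∧ γ 0 = p ∧ γ 1 = q

theorem TangentJoined.map {g : M → M} (hg : ContMDiff (𝓡 d) (𝓡 d) 1 g)
    (hE : ∀ x, ∀ v ∈ E x, mfderiv (𝓡 d) (𝓡 d) g x v ∈ E (g x)) {p q : M}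
    (h : TangentJoined E p q) : TangentJoined E (g p) (g q) := by
  obtain ⟨γ, h1, h2, rfl, rfl⟩ := h
  exact ⟨g ∘ γ, h1.comp hg, h2.comp hg h1 hE, rfl, rfl⟩

end Paths

section PathBounds

variable {d : ℕ} {M : Type*} [EMetricSpace M] [ChartedSpace (EuclideanSpace ℝ (Fin d)) M]
  [IsManifold (𝓡 d) ∞ M] [RiemannianBundle (fun x : M => TangentSpace (𝓡 d) x)]
  {f : M → M} {E : ∀ x : M, Submodule ℝ (TangentSpace (𝓡 d) x)} {γ : ℝ → M}

theorem pathELength_eq_lintegral_subinterval {s t : ℝ} (hs : 0 ≤ s) (ht : t ≤ 1) :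
    pathELength (𝓡 d) γ s t
      = ∫⁻ u in Ioo s t, ‖mfderivWithin 𝓘(ℝ, ℝ) (𝓡 d) γ (Icc 0 1) u (1 : ℝ)‖ₑ := by
  rw [pathELength_eq_lintegral_mfderiv_Ioo]
  refine MeasureTheory.setLIntegral_congr_fun measurableSet_Ioo fun u hu => ?_
  rw [mfderivWithin_of_mem_nhds (Icc_mem_nhds (hs.trans_lt hu.1) (hu.2.trans_le ht))]
  rfl

/-- If `Dfⁿ` is bounded by `C` on `E`, then the end points of a path tangent to `E` stay at
distance at most `C` times its length. -/
theorem IsTangentPath.staysClose [IsRiemannianManifold (𝓡 d) M] (hf : ContMDiff (𝓡 d) (𝓡 d) 1 f)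
    {C : ℝ}
    (hC : ∀ (n : ℕ) (x : M), ∀ v ∈ E x, ‖mfderiv (𝓡 d) (𝓡 d) (f^[n]) x v‖ ≤ C * ‖v‖)
    (hγ : IsC1Path d γ) (hE : IsTangentPath E γ) {s t : ℝ} (hs : 0 ≤ s) (hst : s ≤ t)
    (ht : t ≤ 1) :
    StaysClose f (ENNReal.ofReal C * pathELength (𝓡 d) γ s t) (γ s) (γ t) := by
  intro n
  have hn := contMDiff_iterate hf n
  have hsub : Icc s t ⊆ Icc (0 : ℝ) 1 := Icc_subset_Icc hs ht
  rw [IsRiemannianManifold.out (I := 𝓡 d)]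
  refine (riemannianEDist_le_pathELength (γ := f^[n] ∘ γ) ((hγ.comp hn).mono hsub) rfl rfl
    hst).trans ?_
  rw [pathELength_eq_lintegral_subinterval hs ht, pathELength_eq_lintegral_subinterval hs ht,
    ← MeasureTheory.lintegral_const_mul' _ _ ENNReal.ofReal_ne_top]
  refine MeasureTheory.setLIntegral_mono' measurableSet_Ioo fun u hu => ?_
  have hu' := hsub ⟨hu.1.le, hu.2.le⟩
  have key := congrArg norm (mfderivWithin_comp_path hn hγ hu')
  have h2 := hC n _ _ (hE u hu')
  refine (ofReal_norm _).ge.trans ((ENNReal.ofReal_le_ofReal (key.le.trans h2)).trans ?_)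
  rw [ENNReal.ofReal_mul' (norm_nonneg _)]
  gcongr
  exact (ofReal_norm _).le

variable [IsContinuousRiemannianBundle (EuclideanSpace ℝ (Fin d))
  (fun x : M => TangentSpace (𝓡 d) x)]

theorem IsC1Path.exists_norm_mfderivWithin_le (hγ : IsC1Path d γ) : ∃ K : ℝ, 0 ≤ K ∧
    ∀ t ∈ Icc (0 : ℝ) 1, ‖mfderivWithin 𝓘(ℝ, ℝ) (𝓡 d) γ (Icc 0 1) t (1 : ℝ)‖ ≤ K := by
  have h1 := hγ.continuousOn_tangentMapWithin le_rfl
    (uniqueDiffOn_Icc zero_lt_one).uniqueMDiffOn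
  have h2 : Continuous fun t : ℝ => (⟨t, (1 : ℝ)⟩ : TangentBundle 𝓘(ℝ, ℝ) ℝ) :=
    (tangentBundleModelSpaceHomeomorph 𝓘(ℝ, ℝ)).symm.continuous.comp
      (Continuous.prodMk continuous_id continuous_const)
  have h3 : ContinuousOn
      (fun t => ‖mfderivWithin 𝓘(ℝ, ℝ) (𝓡 d) γ (Icc 0 1) t (1 : ℝ)‖) (Icc 0 1) :=
    (continuous_norm_tangentBundle (d := d) (M := M)).comp_continuousOn
      (h1.comp h2.continuousOn fun t ht => ht)
  obtain ⟨K, hK⟩ := isCompact_Icc.bddAbove_image h3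
  exact ⟨max K 0, le_max_right _ _, fun t ht => (hK (mem_image_of_mem _ ht)).trans (le_max_left _ _)⟩

/-- The path is Lipschitz for the forward distance `sup_n d(fⁿ p, fⁿ q)`, because its speed is
bounded and `Dfⁿ` is uniformly bounded on its velocities. In particular nearby points of the path
have forward orbits that stay close. -/
theorem IsTangentPath.exists_staysClose [IsRiemannianManifold (𝓡 d) M]
    (hf : ContMDiff (𝓡 d) (𝓡 d) 1 f) {C : ℝ}
    (hC : ∀ (n : ℕ) (x : M), ∀ v ∈ E x, ‖mfderiv (𝓡 d) (𝓡 d) (f^[n]) x v‖ ≤ C * ‖v‖)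
    (hγ : IsC1Path d γ) (hE : IsTangentPath E γ) : ∃ K : ℝ, 0 ≤ K ∧ ∀ s ∈ Icc (0 : ℝ) 1,
      ∀ t ∈ Icc (0 : ℝ) 1, StaysClose f (ENNReal.ofReal (K * |s - t|)) (γ s) (γ t) := by
  obtain ⟨K, hK0, hK⟩ := hγ.exists_norm_mfderivWithin_le
  have key : ∀ s t : ℝ, 0 ≤ s → s ≤ t → t ≤ 1 →
      StaysClose f (ENNReal.ofReal (max C 0 * K * |s - t|)) (γ s) (γ t) := by
    intro s t hs hst ht
    refine (hE.staysClose hf hC hγ hs hst ht).mono ?_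
    rw [mul_assoc, ENNReal.ofReal_mul (le_max_right _ _)]
    refine mul_le_mul' (ENNReal.ofReal_le_ofReal (le_max_left _ _)) ?_
    rw [pathELength_eq_lintegral_subinterval hs ht]
    calc _ ≤ ∫⁻ _ in Ioo s t, ENNReal.ofReal K := by
          refine MeasureTheory.setLIntegral_mono measurable_const fun u hu => ?_
          refine (ofReal_norm _).ge.trans (ENNReal.ofReal_le_ofReal (hK u ?_))
          exact ⟨hs.trans hu.1.le, hu.2.le.trans ht⟩
      _ = _ := by
          rw [MeasureTheory.setLIntegral_const, Real.volume_Ioo, ENNReal.ofReal_mul hK0,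
            abs_sub_comm, abs_of_nonneg (sub_nonneg.2 hst)]
  refine ⟨max C 0 * K, by positivity, fun s hs t ht => ?_⟩
  rcases le_total s t with h | h
  · exact key s t hs.1 h ht.2
  · rw [abs_sub_comm]; exact (key t s ht.1 h hs.2).symm

end PathBounds

/-! ### Holonomy in a box: well defined, transitive, continuous and differentiable. -/

section Holonomy

variable {d : ℕ} {M : Type*} [EMetricSpace M] [ChartedSpace (EuclideanSpace ℝ (Fin d)) M]
  [IsManifold (𝓡 d) ∞ M] [RiemannianBundle (fun x : M => TangentSpace (𝓡 d) x)]
  {f : M → M} {Ecs Eu : ∀ x : M, Submodule ℝ (TangentSpace (𝓡 d) x)} {x₀ : M}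

namespace LocalBox

theorem proj_surjective (B : LocalBox Ecs Eu x₀) : Function.Surjective B.proj :=
  fun u => ⟨B.lift (extChartAt (𝓡 d) x₀ x₀) u, B.proj_lift _ u⟩

theorem vderiv_proj_chart (B : LocalBox Ecs Eu x₀) {x : M}
    (hx : x ∈ (extChartAt (𝓡 d) x₀).source) (v : TangentSpace (𝓡 d) x) :
    vderiv (B.proj ∘ extChartAt (𝓡 d) x₀) x v = B.proj (vderiv (extChartAt (𝓡 d) x₀) x v) := by
  unfold vderiv
  rw [mfderiv_comp x B.proj.differentiableAt.mdifferentiableAt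
    (mdifferentiableAt_extChartAt (by rwa [extChartAt_source] at hx)), B.proj.mfderiv_eq]
  rfl

theorem contMDiffAt_proj_chart (B : LocalBox Ecs Eu x₀) {x : M}
    (hx : x ∈ (extChartAt (𝓡 d) x₀).source) :
    ContMDiffAt (𝓡 d) 𝓘(ℝ, EuclideanSpace ℝ (Fin B.k)) 1 (B.proj ∘ extChartAt (𝓡 d) x₀) x :=
  B.proj.contMDiff.contMDiffAt.comp x (contMDiffAt_extChartAt' (by rwa [extChartAt_source] at hx))

/-- Points near `x₀` with the same projection, whose forward orbits stay close, are equal. -/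
theorem exists_eq_of_proj_eq (B : LocalBox Ecs Eu x₀) (K : ConeField f Eu) :
    ∃ r : ℝ, 0 < r ∧ ∀ p q : M, edist p x₀ ≤ ENNReal.ofReal r → edist q x₀ ≤ ENNReal.ofReal r →
      B.proj (extChartAt (𝓡 d) x₀ p) = B.proj (extChartAt (𝓡 d) x₀ q) →
      StaysClose f (ENNReal.ofReal r) p q → p = q := by
  have hx₀ : x₀ ∈ (extChartAt (𝓡 d) x₀).source := mem_extChartAt_source x₀
  have h1 := K.cone_of_eq B.k (B.proj ∘ extChartAt (𝓡 d) x₀) x₀ (B.contMDiffAt_proj_chart hx₀)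
    (fun v => by rw [B.vderiv_proj_chart hx₀]; exact B.proj_eq_zero v) (fun u => by
      obtain ⟨w, rfl⟩ := B.proj_surjective u
      obtain ⟨v, rfl⟩ := surjective_vderiv_chart hx₀ w
      exact ⟨v, B.vderiv_proj_chart hx₀ v⟩)
  obtain ⟨r, hr, hK⟩ := K.exists_eq_of_staysClose
  rw [nhds_prod_eq] at h1
  obtain ⟨S, hS, S', hS', h⟩ := mem_prod_iff.1 h1
  obtain ⟨ε, hε, hε'⟩ := Metric.nhds_basis_closedEBall.mem_iff.1 (inter_mem hS hS')
  obtain ⟨r', hr'0, hr'⟩ := ENNReal.lt_iff_exists_nnreal_btwn.1 hε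
  have hr'1 : ENNReal.ofReal r' ≤ ε := by simpa using hr'.le
  refine ⟨min r r', lt_min hr (by exact_mod_cast hr'0), fun p q hp hq hpq hs => hK p q ?_ ?_⟩
  · have h2 : ∀ w : M, edist w x₀ ≤ ENNReal.ofReal (min r r') → w ∈ S ∩ S' := fun w hw =>
      hε' (hw.trans ((ENNReal.ofReal_le_ofReal (min_le_right _ _)).trans hr'1))
    exact @h (p, q) ⟨(h2 p hp).1, (h2 q hq).2⟩ hpq
  · exact hs.mono (ENNReal.ofReal_le_ofReal (min_le_left _ _))

variable {B : LocalBox Ecs Eu x₀} {z : EuclideanSpace ℝ (Fin d)} {v : EuclideanSpace ℝ (Fin B.k)}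
  {ζ : ℝ → EuclideanSpace ℝ (Fin d)}

theorem IsLift.continuous_velocity (h : B.IsLift z v ζ) :
    Continuous fun t => B.lift (ζ (clip t)) v := by
  have h1 := h.continuous
  have h2 := B.continuous_lift
  have h3 := continuous_clip
  fun_prop

theorem IsLift.isC1Path (h : B.IsLift z v ζ)
    (hz : ‖z - extChartAt (𝓡 d) x₀ x₀‖ + B.C * ‖v‖ ≤ B.ρ) :
    IsC1Path d ((extChartAt (𝓡 d) x₀).symm ∘ ζ) :=
  LocalBox.isC1Path h.hasDerivAt h.continuous_velocity fun _ ht => h.mem_ball hz ht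

theorem IsLift.isTangentPath (h : B.IsLift z v ζ)
    (hz : ‖z - extChartAt (𝓡 d) x₀ x₀‖ + B.C * ‖v‖ ≤ B.ρ) :
    IsTangentPath Ecs ((extChartAt (𝓡 d) x₀).symm ∘ ζ) :=
  LocalBox.isTangentPath h.hasDerivAt (fun _ ht => h.mem_ball hz ht) fun t ht => by
    rw [B.proj_lift, clip_of_mem ht]

theorem IsLift.pathELength_le (h : B.IsLift z v ζ)
    (hz : ‖z - extChartAt (𝓡 d) x₀ x₀‖ + B.C * ‖v‖ ≤ B.ρ) :
    pathELength (𝓡 d) ((extChartAt (𝓡 d) x₀).symm ∘ ζ) 0 1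
      ≤ ENNReal.ofReal (B.C * (B.C * ‖v‖)) :=
  LocalBox.pathELength_le h.hasDerivAt (fun _ ht => h.mem_ball hz ht) fun _ _ => B.lift_le _ v

theorem IsLift.staysClose [IsRiemannianManifold (𝓡 d) M] (hf : ContMDiff (𝓡 d) (𝓡 d) 1 f) {C : ℝ}
    (hC₀ : 0 ≤ C)
    (hC : ∀ (n : ℕ) (x : M), ∀ v ∈ Ecs x, ‖mfderiv (𝓡 d) (𝓡 d) (f^[n]) x v‖ ≤ C * ‖v‖)
    (h : B.IsLift z v ζ) (hz : ‖z - extChartAt (𝓡 d) x₀ x₀‖ + B.C * ‖v‖ ≤ B.ρ) :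
    StaysClose f (ENNReal.ofReal (C * (B.C * (B.C * ‖v‖)))) ((extChartAt (𝓡 d) x₀).symm z)
      ((extChartAt (𝓡 d) x₀).symm (ζ 1)) := by
  have h1 := (h.isTangentPath hz).staysClose hf hC (h.isC1Path hz) le_rfl zero_le_one le_rfl
  simp only [Function.comp, h.zero] at h1
  refine h1.mono ?_
  rw [ENNReal.ofReal_mul hC₀]
  gcongr
  exact h.pathELength_le hz

/-- The end point of a lift starting at `z` of the segment from `B.proj z` to `b`. -/
def hol (B : LocalBox Ecs Eu x₀) (z : EuclideanSpace ℝ (Fin d)) (b : EuclideanSpace ℝ (Fin B.k)) :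
    EuclideanSpace ℝ (Fin d) :=
  (exists_isLift (B := B) z (b - B.proj z)).choose 1

theorem hol_spec (B : LocalBox Ecs Eu x₀) (z : EuclideanSpace ℝ (Fin d))
    (b : EuclideanSpace ℝ (Fin B.k)) : ∃ ζ, B.IsLift z (b - B.proj z) ζ ∧ ζ 1 = B.hol z b :=
  ⟨_, (exists_isLift (B := B) z (b - B.proj z)).choose_spec, rfl⟩

@[simp] theorem proj_hol (B : LocalBox Ecs Eu x₀) (z : EuclideanSpace ℝ (Fin d))
    (b : EuclideanSpace ℝ (Fin B.k)) : B.proj (B.hol z b) = b := by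
  obtain ⟨ζ, h, h1⟩ := B.hol_spec z b
  rw [← h1, h.proj_eq, one_smul, add_sub_cancel]

theorem norm_hol_sub_le (B : LocalBox Ecs Eu x₀) (z : EuclideanSpace ℝ (Fin d))
    (b : EuclideanSpace ℝ (Fin B.k)) : ‖B.hol z b - z‖ ≤ B.C * ‖b - B.proj z‖ := by
  obtain ⟨ζ, h, h1⟩ := B.hol_spec z b
  simpa [h1] using h.norm_sub_le 1

@[simp] theorem hol_proj (B : LocalBox Ecs Eu x₀) (z : EuclideanSpace ℝ (Fin d)) :
    B.hol z (B.proj z) = z := by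
  simpa [sub_eq_zero] using B.norm_hol_sub_le z (B.proj z)

/-- First order expansion of the holonomy at its starting point. -/
theorem norm_hol_sub_sub_le (B : LocalBox Ecs Eu x₀) (z : EuclideanSpace ℝ (Fin d))
    (b : EuclideanSpace ℝ (Fin B.k)) {ε : ℝ}
    (hε : ∀ w, ‖w - z‖ ≤ B.C * ‖b - B.proj z‖ → ‖B.lift w - B.lift z‖ ≤ ε) :
    ‖B.hol z b - z - B.lift z (b - B.proj z)‖ ≤ ε * ‖b - B.proj z‖ := by
  obtain ⟨ζ, h, h1⟩ := B.hol_spec z b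
  have h2 : ∀ t, HasDerivAt (fun t => ζ t - t • B.lift z (b - B.proj z))
      (B.lift (ζ (clip t)) (b - B.proj z) - B.lift z (b - B.proj z)) t := fun t => by
    have := (h.hasDerivAt t).sub ((hasDerivAt_id t).smul_const (B.lift z (b - B.proj z)))
    rwa [one_smul] at this
  have h3 := norm_sub_le_of_hasDerivAt h2 (C := ε * ‖b - B.proj z‖) (fun t => ?_) 0 1
  · simpa [h.zero, h1, sub_right_comm] using h3
  · rw [← sub_apply]
    refine (ContinuousLinearMap.le_opNorm _ _).trans ?_
    gcongr
    refine hε _ ((h.norm_sub_le _).trans ?_)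
    have h4 := clip_mem t
    have := B.C_pos
    rw [abs_of_nonneg h4.1]
    exact mul_le_of_le_one_right (by positivity) h4.2

/-- A neighbourhood of the centre of a box on which the holonomy is well behaved. -/
structure IsHolonomyRadius (B : LocalBox Ecs Eu x₀) (δ : ℝ) : Prop where
  pos : 0 < δ
  mem_ball : ∀ z ∈ Metric.ball (extChartAt (𝓡 d) x₀ x₀) δ,
    ∀ b ∈ Metric.ball (B.proj (extChartAt (𝓡 d) x₀ x₀)) δ, B.hol z b ∈ B.ball
  hol_hol : ∀ z ∈ Metric.ball (extChartAt (𝓡 d) x₀ x₀) δ,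
    ∀ b ∈ Metric.ball (B.proj (extChartAt (𝓡 d) x₀ x₀)) δ,
    ∀ b' ∈ Metric.ball (B.proj (extChartAt (𝓡 d) x₀ x₀)) δ, B.hol (B.hol z b) b' = B.hol z b'
  continuousAt : ∀ z ∈ Metric.ball (extChartAt (𝓡 d) x₀ x₀) δ,
    ∀ b ∈ Metric.ball (B.proj (extChartAt (𝓡 d) x₀ x₀)) δ,
    ContinuousAt (fun p : EuclideanSpace ℝ (Fin d) × EuclideanSpace ℝ (Fin B.k) =>
      B.hol p.1 p.2) (z, b)

/-- By transitivity the holonomy to `b + h` can be restarted at `hol z b`, so its first order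
expansion at the starting point gives the derivative at every `b`. -/
theorem IsHolonomyRadius.hasFDerivAt {δ : ℝ} (hδ : B.IsHolonomyRadius δ)
    (hz : z ∈ Metric.ball (extChartAt (𝓡 d) x₀ x₀) δ) {b : EuclideanSpace ℝ (Fin B.k)}
    (hb : b ∈ Metric.ball (B.proj (extChartAt (𝓡 d) x₀ x₀)) δ) :
    HasFDerivAt (B.hol z) (B.lift (B.hol z b)) b := by
  rw [hasFDerivAt_iff_isLittleO_nhds_zero, Asymptotics.isLittleO_iff]
  intro ε hε
  obtain ⟨τ, hτ, hτ'⟩ := Metric.nhds_basis_closedBall.mem_iff.1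
    (B.continuous_lift.continuousAt (x := B.hol z b) (Metric.closedBall_mem_nhds _ hε))
  have h1 : ∀ᶠ h : EuclideanSpace ℝ (Fin B.k) in 𝓝 0,
      b + h ∈ Metric.ball (B.proj (extChartAt (𝓡 d) x₀ x₀)) δ :=
    (continuous_const.add continuous_id).continuousAt.eventually_mem
      (Metric.isOpen_ball.mem_nhds (by simpa using hb))
  have h2 : ∀ᶠ h : EuclideanSpace ℝ (Fin B.k) in 𝓝 0, B.C * ‖h‖ < τ :=
    (continuous_const.mul continuous_norm).continuousAt.eventually_lt continuousAt_const
      (by simpa using hτ)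
  filter_upwards [h1, h2] with h h1 h2
  have h3 := B.norm_hol_sub_sub_le (B.hol z b) (b + h) (ε := ε) fun w hw => by
    rw [proj_hol, add_sub_cancel_left] at hw
    rw [← dist_eq_norm]
    exact hτ' (by rw [Metric.mem_closedBall, dist_eq_norm]; linarith)
  rwa [proj_hol, add_sub_cancel_left, hδ.hol_hol z hz b hb _ h1] at h3

end LocalBox

end Holonomy

section Holonomy

variable {d : ℕ} {M : Type*} [EMetricSpace M] [ChartedSpace (EuclideanSpace ℝ (Fin d)) M]
  [IsManifold (𝓡 d) ∞ M] [RiemannianBundle (fun x : M => TangentSpace (𝓡 d) x)]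
  [IsRiemannianManifold (𝓡 d) M]
  {f : M → M} {Ecs Eu : ∀ x : M, Submodule ℝ (TangentSpace (𝓡 d) x)} {x₀ : M}

theorem StaysClose.of_tendsto {ι : Type*} {l : Filter ι} [NeBot l] (hf : Continuous f) {r : ℝ≥0∞}
    {p q : ι → M} {p₀ q₀ : M} (hp : Tendsto p l (𝓝 p₀)) (hq : Tendsto q l (𝓝 q₀))
    (h : ∀ᶠ i in l, StaysClose f r (p i) (q i)) : StaysClose f r p₀ q₀ := fun n =>
  le_of_tendsto ((((hf.iterate n).tendsto p₀).comp hp).edist (((hf.iterate n).tendsto q₀).comp hq))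
    (h.mono fun _ hi => hi n)

/-- Although `hol` selects one of possibly many lifts, its end point is forced: it has the
prescribed projection and its forward orbit stays close to that of the starting point, and at most
one nearby point has both properties. Transitivity is this uniqueness, and continuity follows
because both properties pass to limits. -/
theorem LocalBox.exists_isHolonomyRadius (B : LocalBox Ecs Eu x₀) (K : ConeField f Eu)
    (hf : ContMDiff (𝓡 d) (𝓡 d) 1 f) {C : ℝ} (hC₀ : 0 ≤ C)
    (hC : ∀ (n : ℕ) (x : M), ∀ v ∈ Ecs x, ‖mfderiv (𝓡 d) (𝓡 d) (f^[n]) x v‖ ≤ C * ‖v‖) :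
    ∃ δ, B.IsHolonomyRadius δ := by
  obtain ⟨r, hr, hK⟩ := B.exists_eq_of_proj_eq K
  set χ := extChartAt (𝓡 d) x₀
  have hcs : ∀ z ∈ B.ball, ContinuousAt χ.symm z := fun z hz =>
    (continuousOn_extChartAt_symm x₀).continuousAt
      ((isOpen_chart_target x₀).mem_nhds (B.ball_subset hz))
  have hz₀ : χ x₀ ∈ B.ball := Metric.mem_closedBall_self B.ρ_pos.le
  obtain ⟨ρ₁, hρ₁, hsub⟩ : ∃ ρ₁ > 0, Metric.closedBall (χ x₀) ρ₁ ⊆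
      B.ball ∩ {z | edist (χ.symm z) x₀ ≤ ENNReal.ofReal r} := by
    refine Metric.nhds_basis_closedBall.mem_iff.1 (inter_mem
      (Metric.closedBall_mem_nhds _ B.ρ_pos) ?_)
    have h1 := (hcs _ hz₀).tendsto
    rw [extChartAt_to_inv] at h1
    exact h1 (Metric.closedEBall_mem_nhds x₀ (ENNReal.ofReal_pos.2 hr))
  have huniq : ∀ z w : EuclideanSpace ℝ (Fin d), ‖z - χ x₀‖ ≤ ρ₁ → ‖w - χ x₀‖ ≤ ρ₁ →
      B.proj z = B.proj w → StaysClose f (ENNReal.ofReal r) (χ.symm z) (χ.symm w) → z = w := by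
    intro z w hz hw hzw hs
    rw [← dist_eq_norm] at hz hw
    have tz := B.ball_subset (hsub hz).1
    have tw := B.ball_subset (hsub hw).1
    refine χ.symm.injOn tz tw (hK _ _ (hsub hz).2 (hsub hw).2 ?_ hs)
    rw [χ.right_inv tz, χ.right_inv tw, hzw]
  set R := min ρ₁ B.ρ
  have hR : 0 < R := lt_min hρ₁ B.ρ_pos
  set a : ℝ := 1 + ‖B.proj‖
  have ha : 0 ≤ a := by positivity
  have hBC := B.C_pos
  set A : ℝ := C * (B.C * B.C)
  have hA : 0 ≤ A := by positivity
  -- holonomy keeps points close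
  have hstay : ∀ z b, ‖z - χ x₀‖ + B.C * ‖b - B.proj z‖ ≤ R →
      StaysClose f (ENNReal.ofReal (A * ‖b - B.proj z‖)) (χ.symm z) (χ.symm (B.hol z b)) := by
    intro z b h
    obtain ⟨ζ, h1, h2⟩ := B.hol_spec z b
    rw [← h2]
    have := h1.staysClose hf hC₀ hC (h.trans (min_le_right _ _))
    convert this using 2
    simp only [A]; ring
  -- The first bound keeps in the `R`-ball a lift from `z` to `b` followed by one from `b` to `b'`,
  -- with `‖b - proj z‖ ≤ a δ` and `‖b' - b‖ ≤ 2 δ`. The second keeps below `r` the total forward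
  -- distance of three lifts, `A * (2 δ + a δ + a δ)`.
  set δ := min (R / (1 + B.C * a + B.C * 2)) (r / (A * (2 * a + 2) + 1))
  have hδ : 0 < δ := by positivity
  have hδ1 : δ * (1 + B.C * a + B.C * 2) ≤ R := by
    rw [← le_div_iff₀ (by positivity)]; exact min_le_left _ _
  have hδ2 : A * (2 * a + 2) * δ ≤ r := by
    have h1 : δ * (A * (2 * a + 2) + 1) ≤ r := by
      rw [← le_div_iff₀ (by positivity)]; exact min_le_right _ _
    nlinarith
  have hdist : ∀ z ∈ Metric.ball (χ x₀) δ, ∀ b ∈ Metric.ball (B.proj (χ x₀)) δ,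
      ‖b - B.proj z‖ ≤ a * δ := by
    intro z hz b hb
    rw [Metric.mem_ball, dist_eq_norm] at hz hb
    have h1 : b - B.proj z = (b - B.proj (χ x₀)) - B.proj (z - χ x₀) := by
      rw [map_sub]; abel
    rw [h1]
    refine (norm_sub_le _ _).trans ?_
    have h2 := B.proj.le_opNorm (z - χ x₀)
    have h3 : ‖B.proj‖ * ‖z - χ x₀‖ ≤ ‖B.proj‖ * δ := by gcongr
    simp only [a]; linarith
  have hsmall : ∀ z ∈ Metric.ball (χ x₀) δ, ∀ b ∈ Metric.ball (B.proj (χ x₀)) δ,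
      ‖z - χ x₀‖ + B.C * ‖b - B.proj z‖ + B.C * (2 * δ) ≤ R := by
    intro z hz b hb
    have h1 := hdist z hz b hb
    rw [Metric.mem_ball, dist_eq_norm] at hz
    have h2 : B.C * ‖b - B.proj z‖ ≤ B.C * (a * δ) := by gcongr
    linarith
  have hnear : ∀ z b, ‖B.hol z b - χ x₀‖ ≤ ‖z - χ x₀‖ + B.C * ‖b - B.proj z‖ := by
    intro z b
    have h1 := B.norm_hol_sub_le z b
    have h2 : ‖B.hol z b - χ x₀‖ ≤ ‖B.hol z b - z‖ + ‖z - χ x₀‖ := by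
      simpa using norm_add_le (B.hol z b - z) (z - χ x₀)
    linarith
  have hpos : 0 ≤ B.C * (2 * δ) := by positivity
  have hmem : ∀ z ∈ Metric.ball (χ x₀) δ, ∀ b ∈ Metric.ball (B.proj (χ x₀)) δ,
      ‖B.hol z b - χ x₀‖ ≤ R := fun z hz b hb => by
    linarith [hnear z b, hsmall z hz b hb]
  have hstay' : ∀ z ∈ Metric.ball (χ x₀) δ, ∀ b ∈ Metric.ball (B.proj (χ x₀)) δ,
      StaysClose f (ENNReal.ofReal (A * (a * δ))) (χ.symm z) (χ.symm (B.hol z b)) := by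
    intro z hz b hb
    refine (hstay z b (by linarith [hsmall z hz b hb])).mono (ENNReal.ofReal_le_ofReal ?_)
    exact mul_le_mul_of_nonneg_left (hdist z hz b hb) hA
  have hRball : ∀ z, ‖z - χ x₀‖ ≤ R → z ∈ B.ball := fun z hz => by
    rw [LocalBox.ball, Metric.mem_closedBall, dist_eq_norm]; exact hz.trans (min_le_right _ _)
  refine ⟨δ, hδ, fun z hz b hb => hRball _ (hmem z hz b hb), ?_, ?_⟩
  · intro z hz b hb b' hb'
    have hbb : ‖b' - b‖ ≤ 2 * δ := by
      rw [← dist_eq_norm]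
      have := dist_triangle_right b' b (B.proj (χ x₀))
      linarith [Metric.mem_ball.1 hb, Metric.mem_ball.1 hb']
    have h1 : ‖B.hol z b - χ x₀‖ + B.C * ‖b' - B.proj (B.hol z b)‖ ≤ R := by
      rw [LocalBox.proj_hol]
      have : B.C * ‖b' - b‖ ≤ B.C * (2 * δ) := by gcongr
      linarith [hnear z b, hsmall z hz b hb]
    refine huniq _ _ ((hnear _ _).trans (h1.trans (min_le_left _ _)))
      ((hmem z hz b' hb').trans (min_le_left _ _)) (by simp) ?_
    have h2 := ((hstay _ _ h1).symm.trans (hstay' z hz b hb).symm).trans (hstay' z hz b' hb')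
    rw [LocalBox.proj_hol] at h2
    refine h2.mono ?_
    rw [← ENNReal.ofReal_add (by positivity) (by positivity),
      ← ENNReal.ofReal_add (by positivity) (by positivity)]
    refine ENNReal.ofReal_le_ofReal (le_trans ?_ hδ2)
    have : A * ‖b' - b‖ ≤ A * (2 * δ) := by gcongr
    linarith
  · intro z hz b hb
    rw [ContinuousAt, tendsto_iff_ultrafilter]
    intro g hg
    have hev : ∀ᶠ p in (g : Filter (EuclideanSpace ℝ (Fin d) × EuclideanSpace ℝ (Fin B.k))),
        p.1 ∈ Metric.ball (χ x₀) δ ∧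
        p.2 ∈ Metric.ball (B.proj (χ x₀)) δ :=
      hg ((Metric.isOpen_ball.prod Metric.isOpen_ball).mem_nhds ⟨hz, hb⟩)
    -- Any limit value `w` has projection `b` and a forward orbit close to that of `z`, so it can
    -- only be `hol z b`.
    obtain ⟨w, hw, hlim⟩ := (isCompact_closedBall (χ x₀) R).ultrafilter_le_nhds
      (g.map fun p => B.hol p.1 p.2) (by
        rw [le_principal_iff]
        exact hev.mono fun p hp => mem_closedBall_iff_norm.2 (hmem _ hp.1 _ hp.2))
    have hlim' : Tendsto (fun p : EuclideanSpace ℝ (Fin d) × EuclideanSpace ℝ (Fin B.k) =>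
        B.hol p.1 p.2) g (𝓝 w) := hlim
    rw [mem_closedBall_iff_norm] at hw
    have hg1 : Tendsto Prod.fst (g : Filter (_ × _)) (𝓝 z) := (continuous_fst.tendsto (z, b)).mono_left hg
    have hg2 : Tendsto Prod.snd (g : Filter (_ × _)) (𝓝 b) := (continuous_snd.tendsto (z, b)).mono_left hg
    have hpw : B.proj w = b := by
      have h1 := (B.proj.continuous.tendsto w).comp hlim'
      refine tendsto_nhds_unique (h1.congr fun p => ?_) hg2
      simp
    have hzR : ‖z - χ x₀‖ ≤ R := by
      have h1 : 0 ≤ B.C * ‖b - B.proj z‖ := by positivity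
      linarith [hsmall z hz b hb]
    have hs : StaysClose f (ENNReal.ofReal (A * (a * δ))) (χ.symm z) (χ.symm w) :=
      StaysClose.of_tendsto hf.continuous ((hcs z (hRball z hzR)).tendsto.comp hg1)
        ((hcs w (hRball w hw)).tendsto.comp hlim') (hev.mono fun p hp => hstay' _ hp.1 _ hp.2)
    have hwe : w = B.hol z b := by
      refine huniq _ _ (hw.trans (min_le_left _ _)) ((hmem z hz b hb).trans (min_le_left _ _))
        (by rw [hpw, LocalBox.proj_hol]) ?_
      refine (hs.symm.trans (hstay' z hz b hb)).mono ?_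
      rw [← ENNReal.ofReal_add (by positivity) (by positivity)]
      refine ENNReal.ofReal_le_ofReal (le_trans ?_ hδ2)
      have : 0 ≤ A * (2 * δ) := by positivity
      linarith
    rwa [hwe] at hlim'

end Holonomy

/-! ### Lamination charts built from the holonomy. -/

section ChartProperties

variable {d : ℕ} {M : Type*} [TopologicalSpace M] [ChartedSpace (EuclideanSpace ℝ (Fin d)) M]
  [IsManifold (𝓡 d) ∞ M]

/-- A lamination chart is tangent to `E`. -/
def LaminationChart.IsTangentTo (c : LaminationChart d M)
    (E : ∀ x : M, Submodule ℝ (TangentSpace (𝓡 d) x)) : Prop :=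
  ∀ (b : EuclideanSpace ℝ (Fin c.dim)) (t : c.T),
    LinearMap.range (mfderiv (𝓡 c.dim) (𝓡 d) (fun b' => c.φ (b', t)) b).toLinearMap
      = E (c.φ (b, t))

/-- The plaque coordinate of a lamination chart extends to a function of class `C¹`. -/
def LaminationChart.HasPlaqueCoordinate (c : LaminationChart d M) : Prop :=
  ∃ G : M → EuclideanSpace ℝ (Fin c.dim), ∀ b t,
    ContMDiffAt (𝓡 d) (𝓡 c.dim) 1 G (c.φ (b, t)) ∧ G (c.φ (b, t)) = b

end ChartProperties

section Charts

variable {d : ℕ} {M : Type*} [EMetricSpace M] [ChartedSpace (EuclideanSpace ℝ (Fin d)) M]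
  [IsManifold (𝓡 d) ∞ M] [RiemannianBundle (fun x : M => TangentSpace (𝓡 d) x)]
  {Ecs Eu : ∀ x : M, Submodule ℝ (TangentSpace (𝓡 d) x)} {x₀ : M}

namespace LocalBox

/-- A pair of radii `δ' ≤ δ` such that the holonomy maps the smaller balls into the larger one. -/
structure IsChartRadius (B : LocalBox Ecs Eu x₀) (δ δ' : ℝ) : Prop where
  isHolonomyRadius : B.IsHolonomyRadius δ
  pos : 0 < δ'
  le : δ' ≤ δ
  hol_mem : ∀ z ∈ Metric.ball (extChartAt (𝓡 d) x₀ x₀) δ',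
    ∀ b ∈ Metric.ball (B.proj (extChartAt (𝓡 d) x₀ x₀)) δ',
    B.hol z b ∈ Metric.ball (extChartAt (𝓡 d) x₀ x₀) δ

theorem IsHolonomyRadius.exists_isChartRadius {B : LocalBox Ecs Eu x₀} {δ : ℝ}
    (hδ : B.IsHolonomyRadius δ) : ∃ δ', B.IsChartRadius δ δ' := by
  have h1 := hδ.continuousAt _ (Metric.mem_ball_self hδ.pos) _ (Metric.mem_ball_self hδ.pos)
  have h2 : Metric.ball (extChartAt (𝓡 d) x₀ x₀) δ ∈ 𝓝 (B.hol (extChartAt (𝓡 d) x₀ x₀)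
      (B.proj (extChartAt (𝓡 d) x₀ x₀))) := by
    rw [hol_proj]; exact Metric.ball_mem_nhds _ hδ.pos
  obtain ⟨τ, hτ, h3⟩ := Metric.mem_nhds_iff.1 (h1 h2)
  rw [← ball_prod_same] at h3
  refine ⟨min τ δ, hδ, lt_min hτ hδ.pos, min_le_right _ _, fun z hz b hb => @h3 (z, b) ⟨?_, ?_⟩⟩
  · exact Metric.ball_subset_ball (min_le_left _ _) hz
  · exact Metric.ball_subset_ball (min_le_left _ _) hb

variable (B : LocalBox Ecs Eu x₀) (δ' : ℝ)

/-- A small transversal through the centre of the box. -/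
def transversal : Set M :=
  {p | p ∈ (extChartAt (𝓡 d) x₀).source ∧
    extChartAt (𝓡 d) x₀ p ∈ Metric.ball (extChartAt (𝓡 d) x₀ x₀) δ' ∧
    B.proj (extChartAt (𝓡 d) x₀ p) = B.proj (extChartAt (𝓡 d) x₀ x₀)}

/-- A diffeomorphism from the model space onto a ball around the projection of the centre. -/
def ballParam : OpenPartialHomeomorph (EuclideanSpace ℝ (Fin B.k)) (EuclideanSpace ℝ (Fin B.k)) :=
  OpenPartialHomeomorph.univBall (B.proj (extChartAt (𝓡 d) x₀ x₀)) δ'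

/-- The point of the chart with plaque coordinate `b` on the plaque through `t`. -/
def plaqueCoord (p : EuclideanSpace ℝ (Fin B.k) × B.transversal δ') : EuclideanSpace ℝ (Fin d) :=
  B.hol (extChartAt (𝓡 d) x₀ p.2) (B.ballParam δ' p.1)

/-- The parametrization of a neighbourhood of the centre by plaques. -/
def plaqueParam (p : EuclideanSpace ℝ (Fin B.k) × B.transversal δ') : M :=
  (extChartAt (𝓡 d) x₀).symm (B.plaqueCoord δ' p)

variable {B} {δ δ' : ℝ}

theorem IsChartRadius.ballParam_mem (h : B.IsChartRadius δ δ') (b : EuclideanSpace ℝ (Fin B.k)) :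
    B.ballParam δ' b ∈ Metric.ball (B.proj (extChartAt (𝓡 d) x₀ x₀)) δ' := by
  have := (B.ballParam δ').map_source (x := b) (by simp [ballParam])
  rwa [ballParam, OpenPartialHomeomorph.univBall_target _ h.pos] at this

theorem ballParam_symm_apply (b : EuclideanSpace ℝ (Fin B.k)) :
    (B.ballParam δ').symm (B.ballParam δ' b) = b :=
  (B.ballParam δ').left_inv (by simp [ballParam])

theorem IsChartRadius.ballParam_symm (h : B.IsChartRadius δ δ') {b : EuclideanSpace ℝ (Fin B.k)}
    (hb : b ∈ Metric.ball (B.proj (extChartAt (𝓡 d) x₀ x₀)) δ') :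
    B.ballParam δ' ((B.ballParam δ').symm b) = b :=
  (B.ballParam δ').right_inv (by rwa [ballParam, OpenPartialHomeomorph.univBall_target _ h.pos])

theorem contDiff_ballParam : ContDiff ℝ 1 (B.ballParam δ') :=
  OpenPartialHomeomorph.contDiff_univBall

theorem contDiffAt_ballParam_symm {b : EuclideanSpace ℝ (Fin B.k)}
    (hb : b ∈ Metric.ball (B.proj (extChartAt (𝓡 d) x₀ x₀)) δ') :
    ContDiffAt ℝ 1 (B.ballParam δ').symm b :=
  (OpenPartialHomeomorph.contDiffOn_univBall_symm).contDiffAt (Metric.isOpen_ball.mem_nhds hb)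

theorem IsChartRadius.fderiv_ballParam_injective (h : B.IsChartRadius δ δ')
    (b : EuclideanSpace ℝ (Fin B.k)) : Function.Injective (fderiv ℝ (B.ballParam δ') b) := by
  have h1 := ((contDiffAt_ballParam_symm (h.ballParam_mem b)).differentiableAt
    one_ne_zero).hasFDerivAt.comp b
    ((contDiff_ballParam (B := B) (δ' := δ')).differentiable one_ne_zero b).hasFDerivAt
  have h2 : (B.ballParam δ').symm ∘ B.ballParam δ' = id := funext ballParam_symm_apply
  rw [h2] at h1
  exact Function.LeftInverse.injective fun v =>
    DFunLike.congr_fun (h1.unique (hasFDerivAt_id b)) v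

theorem IsChartRadius.ball_subset (h : B.IsChartRadius δ δ') (c : EuclideanSpace ℝ (Fin d)) :
    Metric.ball c δ' ⊆ Metric.ball c δ := Metric.ball_subset_ball h.le

theorem IsChartRadius.ball_subset' (h : B.IsChartRadius δ δ') (c : EuclideanSpace ℝ (Fin B.k)) :
    Metric.ball c δ' ⊆ Metric.ball c δ := Metric.ball_subset_ball h.le

theorem IsChartRadius.plaqueCoord_mem_ball (h : B.IsChartRadius δ δ')
    (b : EuclideanSpace ℝ (Fin B.k)) (t : B.transversal δ') : B.plaqueCoord δ' (b, t) ∈ B.ball :=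
  h.isHolonomyRadius.mem_ball _ (h.ball_subset _ t.2.2.1) _ (h.ball_subset' _ (h.ballParam_mem b))

theorem IsChartRadius.chart_plaqueParam (h : B.IsChartRadius δ δ')
    (b : EuclideanSpace ℝ (Fin B.k)) (t : B.transversal δ') :
    extChartAt (𝓡 d) x₀ (B.plaqueParam δ' (b, t)) = B.plaqueCoord δ' (b, t) :=
  (extChartAt (𝓡 d) x₀).right_inv (B.ball_subset (h.plaqueCoord_mem_ball b t))

theorem IsChartRadius.plaqueParam_mem_source (h : B.IsChartRadius δ δ')
    (b : EuclideanSpace ℝ (Fin B.k)) (t : B.transversal δ') :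
    B.plaqueParam δ' (b, t) ∈ (extChartAt (𝓡 d) x₀).source :=
  (extChartAt (𝓡 d) x₀).map_target (B.ball_subset (h.plaqueCoord_mem_ball b t))

/-- By transitivity, going back to the projection of the centre recovers the point of the
transversal. This is the transverse coordinate, whence injectivity and the local inverse of the
parametrization. -/
theorem IsChartRadius.hol_plaqueCoord (h : B.IsChartRadius δ δ')
    (b : EuclideanSpace ℝ (Fin B.k)) (t : B.transversal δ') :
    B.hol (B.plaqueCoord δ' (b, t)) (B.proj (extChartAt (𝓡 d) x₀ x₀))
      = extChartAt (𝓡 d) x₀ (t : M) := by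
  have h1 := h.isHolonomyRadius.hol_hol _ (h.ball_subset _ t.2.2.1) _
    (h.ball_subset' _ (h.ballParam_mem b)) _ (Metric.mem_ball_self h.isHolonomyRadius.pos)
  refine h1.trans ?_
  conv_lhs => rw [← t.2.2.2]
  exact B.hol_proj _

theorem IsChartRadius.hasFDerivAt_plaqueCoord (h : B.IsChartRadius δ δ')
    (b : EuclideanSpace ℝ (Fin B.k)) (t : B.transversal δ') :
    HasFDerivAt (fun b => B.plaqueCoord δ' (b, t))
      ((B.lift (B.plaqueCoord δ' (b, t))).comp (fderiv ℝ (B.ballParam δ') b)) b :=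
  (h.isHolonomyRadius.hasFDerivAt (h.ball_subset _ t.2.2.1)
    (h.ball_subset' _ (h.ballParam_mem b))).comp b
    ((contDiff_ballParam (B := B) (δ' := δ')).differentiable one_ne_zero b).hasFDerivAt

theorem IsChartRadius.hasMFDerivAt_plaqueParam (h : B.IsChartRadius δ δ')
    (b : EuclideanSpace ℝ (Fin B.k)) (t : B.transversal δ') :
    HasMFDerivAt (𝓡 B.k) (𝓡 d) (fun b => B.plaqueParam δ' (b, t)) b
      ((chartInv x₀ (B.plaqueCoord δ' (b, t))).comp
        ((B.lift (B.plaqueCoord δ' (b, t))).comp (fderiv ℝ (B.ballParam δ') b))) :=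
  (hasMFDerivAt_chart_symm (B.ball_subset (h.plaqueCoord_mem_ball b t))).comp b
    (h.hasFDerivAt_plaqueCoord b t).hasMFDerivAt

theorem IsChartRadius.continuous_plaqueCoord (h : B.IsChartRadius δ δ') : Continuous (B.plaqueCoord δ') := by
  rw [continuous_iff_continuousAt]
  rintro ⟨b, t⟩
  have h1 := h.isHolonomyRadius.continuousAt _ (h.ball_subset _ t.2.2.1) _
    (h.ball_subset' _ (h.ballParam_mem b))
  refine ContinuousAt.comp (x := (b, t))
    (f := fun p : EuclideanSpace ℝ (Fin B.k) × B.transversal δ' =>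
    (extChartAt (𝓡 d) x₀ (p.2 : M), B.ballParam δ' p.1)) h1 ?_
  refine ContinuousAt.prodMk ?_ ?_
  · exact ContinuousAt.comp (x := (b, t)) (f := fun p : EuclideanSpace ℝ (Fin B.k) × B.transversal δ' =>
      (p.2 : M)) (continuousAt_extChartAt' t.2.1)
      (continuous_subtype_val.comp continuous_snd).continuousAt
  · exact ((contDiff_ballParam (B := B) (δ' := δ')).continuous.comp continuous_fst).continuousAt

theorem IsChartRadius.continuous_plaqueParam (h : B.IsChartRadius δ δ') : Continuous (B.plaqueParam δ') :=
  (continuousOn_extChartAt_symm x₀).comp_continuous h.continuous_plaqueCoord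
    fun p => B.ball_subset (h.plaqueCoord_mem_ball p.1 p.2)

theorem IsChartRadius.injective_plaqueParam (h : B.IsChartRadius δ δ') : Function.Injective (B.plaqueParam δ') := by
  rintro ⟨b, t⟩ ⟨b', t'⟩ he
  have h1 : B.plaqueCoord δ' (b, t) = B.plaqueCoord δ' (b', t') := by
    rw [← h.chart_plaqueParam, ← h.chart_plaqueParam, he]
  have h2 : B.ballParam δ' b = B.ballParam δ' b' := by
    have := congrArg B.proj h1
    simpa [plaqueCoord] using this
  have h3 : b = b' := by
    rw [← ballParam_symm_apply (B := B) (δ' := δ') b, h2, ballParam_symm_apply]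
  have h4 : extChartAt (𝓡 d) x₀ (t : M) = extChartAt (𝓡 d) x₀ (t' : M) := by
    rw [← h.hol_plaqueCoord b t, h1, h.hol_plaqueCoord]
  exact Prod.ext h3 (Subtype.ext ((extChartAt (𝓡 d) x₀).injOn t.2.1 t'.2.1 h4))

/-- Near a point of the image there is a continuous right inverse, sending `q` to its projection and
to the point where its holonomy meets the transversal. The two radii matter here: `q` lies only in
the `δ`-ball, where transitivity still holds. -/
theorem IsChartRadius.isOpenMap_plaqueParam (h : B.IsChartRadius δ δ') : IsOpenMap (B.plaqueParam δ') := by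
  refine IsOpenMap.of_nhds_le ?_
  rintro ⟨b, t⟩
  set χ := extChartAt (𝓡 d) x₀
  set q₀ := B.plaqueParam δ' (b, t)
  have hq₀ : χ q₀ = B.plaqueCoord δ' (b, t) := h.chart_plaqueParam b t
  have hz₀ : χ q₀ ∈ Metric.ball (χ x₀) δ := by
    rw [hq₀]; exact h.hol_mem _ t.2.2.1 _ (h.ballParam_mem b)
  have hself := Metric.mem_ball_self (x := B.proj (χ x₀)) h.isHolonomyRadius.pos
  have hχ : ContinuousAt χ q₀ := continuousAt_extChartAt' (h.plaqueParam_mem_source b t)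
  have hc : ContinuousAt (fun q => B.hol (χ q) (B.proj (χ x₀))) q₀ :=
    ContinuousAt.comp (f := fun q => (χ q, B.proj (χ x₀)))
      (h.isHolonomyRadius.continuousAt _ hz₀ _ hself) (hχ.prodMk continuousAt_const)
  have hcq₀ : B.hol (χ q₀) (B.proj (χ x₀)) = χ t := by rw [hq₀]; exact h.hol_plaqueCoord b t
  have hpb : B.proj (χ q₀) = B.ballParam δ' b := by
    rw [hq₀, plaqueCoord, proj_hol]
  -- a local inverse
  classical
  let g : M → EuclideanSpace ℝ (Fin B.k) × B.transversal δ' := fun q =>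
    ((B.ballParam δ').symm (B.proj (χ q)),
      if hq : χ.symm (B.hol (χ q) (B.proj (χ x₀))) ∈ B.transversal δ' then ⟨_, hq⟩ else t)
  have ht0 : B.hol (χ q₀) (B.proj (χ x₀)) ∈ B.ball ∩ Metric.ball (χ x₀) δ' := by
    rw [hcq₀]
    refine ⟨?_, t.2.2.1⟩
    have := h.isHolonomyRadius.mem_ball _ (h.ball_subset _ t.2.2.1) _ hself
    conv at this => rw [← t.2.2.2, hol_proj]
    exact this
  have hev : ∀ᶠ q in 𝓝 q₀, q ∈ χ.source ∧ χ q ∈ Metric.ball (χ x₀) δ ∧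
      B.proj (χ q) ∈ Metric.ball (B.proj (χ x₀)) δ' ∧
      B.hol (χ q) (B.proj (χ x₀)) ∈ Metric.ball (χ x₀) δ' := by
    refine Eventually.and ((isOpen_extChartAt_source x₀).mem_nhds
      (h.plaqueParam_mem_source b t)) (Eventually.and (hχ (Metric.isOpen_ball.mem_nhds hz₀))
      (Eventually.and ((B.proj.continuous.continuousAt.comp hχ) (Metric.isOpen_ball.mem_nhds ?_))
      (hc (Metric.isOpen_ball.mem_nhds ht0.2))))
    show B.proj (χ q₀) ∈ _
    rw [hpb]; exact h.ballParam_mem b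
  have hT : ∀ q, χ q ∈ Metric.ball (χ x₀) δ → B.hol (χ q) (B.proj (χ x₀)) ∈ Metric.ball (χ x₀) δ' →
      B.hol (χ q) (B.proj (χ x₀)) ∈ χ.target ∧
      χ.symm (B.hol (χ q) (B.proj (χ x₀))) ∈ B.transversal δ' := by
    intro q h1 h2
    have h3 := B.ball_subset (h.isHolonomyRadius.mem_ball _ h1 _ hself)
    exact ⟨h3, χ.map_target h3, by rwa [χ.right_inv h3], by rw [χ.right_inv h3, proj_hol]⟩
  have hright : ∀ᶠ q in 𝓝 q₀, B.plaqueParam δ' (g q) = q := by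
    filter_upwards [hev] with q ⟨h1, h2, h3, h4⟩
    obtain ⟨h5, h6⟩ := hT q h2 h4
    have h7 : B.hol (B.hol (χ q) (B.proj (χ x₀))) (B.proj (χ q)) = χ q := by
      rw [h.isHolonomyRadius.hol_hol _ h2 _ hself _ (h.ball_subset' _ h3), hol_proj]
    simp only [plaqueParam, plaqueCoord, g, dif_pos h6]
    rw [χ.right_inv h5, h.ballParam_symm h3, h7, χ.left_inv h1]
  have hgc : Tendsto g (𝓝 q₀) (𝓝 (b, t)) := by
    rw [nhds_prod_eq]
    refine Tendsto.prodMk ?_ ?_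
    · have h1 : ContinuousAt (fun q => (B.ballParam δ').symm (B.proj (χ q))) q₀ := by
        refine ContinuousAt.comp (g := (B.ballParam δ').symm) (f := fun q => B.proj (χ q)) ?_
          (B.proj.continuous.continuousAt.comp hχ)
        rw [hpb]
        exact (contDiffAt_ballParam_symm (h.ballParam_mem b)).continuousAt
      have h2 := h1.tendsto
      rwa [hpb, ballParam_symm_apply] at h2
    · rw [tendsto_subtype_rng]
      have h1 : ContinuousAt (fun q => χ.symm (B.hol (χ q) (B.proj (χ x₀)))) q₀ := by
        refine ContinuousAt.comp (g := χ.symm) (f := fun q => B.hol (χ q) (B.proj (χ x₀))) ?_ hc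
        exact (continuousOn_extChartAt_symm x₀).continuousAt
          ((isOpen_chart_target x₀).mem_nhds (B.ball_subset ht0.1))
      have h2 := h1.tendsto
      rw [hcq₀, χ.left_inv t.2.1] at h2
      refine h2.congr' ?_
      filter_upwards [hev] with q ⟨_, h2, _, h4⟩
      simp only [dif_pos (hT q h2 h4).2]
  intro S hS
  filter_upwards [hgc hS, hright] with q h1 h2
  rw [← h2]; exact h1

/-- The lamination chart around the centre of a box. -/
def IsChartRadius.chart (h : B.IsChartRadius δ δ') : LaminationChart d M where
  dim := B.k
  T := B.transversal δ'
  φ := B.plaqueParam δ'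
  isOpenEmbedding := .of_continuous_injective_isOpenMap h.continuous_plaqueParam
    h.injective_plaqueParam h.isOpenMap_plaqueParam
  contMDiff_slice t := by
    have h1 : ContDiff ℝ 1 fun b => B.plaqueCoord δ' (b, t) := by
      rw [contDiff_one_iff_fderiv]
      refine ⟨fun b => (h.hasFDerivAt_plaqueCoord b t).differentiableAt, ?_⟩
      rw [funext fun b => (h.hasFDerivAt_plaqueCoord b t).fderiv]
      have h2 : Continuous fun b => B.plaqueCoord δ' (b, t) :=
        h.continuous_plaqueCoord.comp (by fun_prop)
      exact (B.continuous_lift.comp h2).clm_comp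
        ((contDiff_ballParam (B := B) (δ' := δ')).continuous_fderiv one_ne_zero)
    exact ContMDiffOn.comp_contMDiff (I' := 𝓡 d) (contMDiffOn_extChartAt_symm x₀) h1.contMDiff
      fun b => B.ball_subset (h.plaqueCoord_mem_ball b t)
  injective_mfderiv b t := by
    rw [(h.hasMFDerivAt_plaqueParam b t).mfderiv]
    have h1 := vderiv_chart_chartInv (B.ball_subset (h.plaqueCoord_mem_ball b t))
    exact (Function.LeftInverse.injective h1).comp
      ((Function.LeftInverse.injective (B.proj_lift _)).comp (h.fderiv_ballParam_injective b))
  continuous_mfderiv := by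
    have h1 : Continuous fun p : (EuclideanSpace ℝ (Fin B.k) × B.transversal δ') ×
        EuclideanSpace ℝ (Fin B.k) => (B.plaqueCoord δ' p.1,
          B.lift (B.plaqueCoord δ' p.1) (fderiv ℝ (B.ballParam δ') p.1.1 p.2)) := by
      have h2 := h.continuous_plaqueCoord
      have h3 := (contDiff_ballParam (B := B) (δ' := δ')).continuous_fderiv one_ne_zero
      have h4 := B.continuous_lift
      fun_prop
    refine ((continuousOn_chartInv x₀).comp_continuous h1 fun p =>
      ⟨B.ball_subset (h.plaqueCoord_mem_ball p.1.1 p.1.2), trivial⟩).congr fun p => ?_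
    rw [(h.hasMFDerivAt_plaqueParam p.1.1 p.1.2).mfderiv]
    rfl

theorem IsChartRadius.mem_range_chart (h : B.IsChartRadius δ δ') : x₀ ∈ range h.chart.φ := by
  have hx₀ : x₀ ∈ B.transversal δ' :=
    ⟨mem_extChartAt_source x₀, Metric.mem_ball_self h.pos, rfl⟩
  refine ⟨((B.ballParam δ').symm (B.proj (extChartAt (𝓡 d) x₀ x₀)), ⟨x₀, hx₀⟩), ?_⟩
  show (extChartAt (𝓡 d) x₀).symm (B.hol _ (B.ballParam δ' _)) = x₀
  rw [h.ballParam_symm (Metric.mem_ball_self h.pos), hol_proj, extChartAt_to_inv]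

/-- The derivative is `lift` composed with an invertible map, and the range of `lift` read in the
chart is `Ecs`. -/
theorem IsChartRadius.range_mfderiv_plaqueParam (h : B.IsChartRadius δ δ')
    (b : EuclideanSpace ℝ (Fin B.k)) (t : B.transversal δ') :
    LinearMap.range (mfderiv (𝓡 B.k) (𝓡 d) (fun b' => B.plaqueParam δ' (b', t)) b).toLinearMap
      = Ecs (B.plaqueParam δ' (b, t)) := by
  have h0 := h.plaqueCoord_mem_ball b t
  have h1 := (h.hasMFDerivAt_plaqueParam b t).mfderiv
  have hsurj : Function.Surjective (fderiv ℝ (B.ballParam δ') b) :=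
    (LinearMap.injective_iff_surjective (f := (fderiv ℝ (B.ballParam δ') b).toLinearMap)).1
      (h.fderiv_ballParam_injective b)
  rw [h1]
  ext v
  constructor
  · rintro ⟨u, rfl⟩
    refine (B.mem_iff _ h0 _).2 ?_
    show B.lift _ (B.proj (B.lift _ _)) = B.lift _ _
    rw [B.proj_lift]
  · intro hv
    have h2 := chartInv_vderiv_chart (B.ball_subset h0) v
    have h3 : B.lift (B.plaqueCoord δ' (b, t)) (B.proj (vderiv (extChartAt (𝓡 d) x₀)
        ((extChartAt (𝓡 d) x₀).symm (B.plaqueCoord δ' (b, t))) v)) = vderiv (extChartAt (𝓡 d) x₀)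
        ((extChartAt (𝓡 d) x₀).symm (B.plaqueCoord δ' (b, t))) v := by
      refine (B.mem_iff _ h0 _).1 ?_
      rw [h2]; exact hv
    obtain ⟨u, hu⟩ := hsurj (B.proj (vderiv (extChartAt (𝓡 d) x₀)
        ((extChartAt (𝓡 d) x₀).symm (B.plaqueCoord δ' (b, t))) v))
    refine ⟨u, ?_⟩
    show chartInv x₀ (B.plaqueCoord δ' (b, t)) (B.lift _ (fderiv ℝ (B.ballParam δ') b u)) = v
    rw [hu, h3, h2]

/-- The plaque coordinate as a function on the manifold. -/
theorem IsChartRadius.exists_leftInverse_plaqueParam (h : B.IsChartRadius δ δ') :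
    ∃ G : M → EuclideanSpace ℝ (Fin B.k), ∀ b t,
      ContMDiffAt (𝓡 d) (𝓡 B.k) 1 G (B.plaqueParam δ' (b, t)) ∧
        G (B.plaqueParam δ' (b, t)) = b := by
  refine ⟨fun q => (B.ballParam δ').symm (B.proj (extChartAt (𝓡 d) x₀ q)), fun b t => ?_⟩
  have h1 : B.proj (extChartAt (𝓡 d) x₀ (B.plaqueParam δ' (b, t))) = B.ballParam δ' b := by
    rw [h.chart_plaqueParam, plaqueCoord, proj_hol]
  constructor
  · refine ContMDiffAt.comp (I' := 𝓡 B.k) (g := (B.ballParam δ').symm)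
      (f := B.proj ∘ extChartAt (𝓡 d) x₀) (B.plaqueParam δ' (b, t)) ?_
      (B.contMDiffAt_proj_chart (h.plaqueParam_mem_source b t))
    rw [Function.comp_apply, h1]
    exact (contDiffAt_ballParam_symm (h.ballParam_mem b)).contMDiffAt
  · show (B.ballParam δ').symm (B.proj (extChartAt (𝓡 d) x₀ (B.plaqueParam δ' (b, t)))) = b
    rw [h1, ballParam_symm_apply]

end LocalBox

theorem exists_laminationChart [IsRiemannianManifold (𝓡 d) M]
    [IsContinuousRiemannianBundle (EuclideanSpace ℝ (Fin d)) (fun x : M => TangentSpace (𝓡 d) x)]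
    {f : M → M} (hf : ContMDiff (𝓡 d) (𝓡 d) 1 f) (hEcs : IsContinuousSubbundle Ecs)
    (hsplit : ∀ x : M, IsCompl (Ecs x) (Eu x)) (K : ConeField f Eu) {C : ℝ} (hC₀ : 0 ≤ C)
    (hC : ∀ (n : ℕ) (x : M), ∀ v ∈ Ecs x, ‖mfderiv (𝓡 d) (𝓡 d) (f^[n]) x v‖ ≤ C * ‖v‖) (x : M) :
    ∃ c : LaminationChart d M, x ∈ range c.φ ∧ c.IsTangentTo Ecs ∧ c.HasPlaqueCoordinate := by
  obtain ⟨B⟩ := exists_localBox hEcs hsplit x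
  obtain ⟨δ, hδ⟩ := B.exists_isHolonomyRadius K hf hC₀ hC
  obtain ⟨δ', h⟩ := hδ.exists_isChartRadius
  exact ⟨h.chart, h.mem_range_chart, h.range_mfderiv_plaqueParam, h.exists_leftInverse_plaqueParam⟩

end Charts

/-! ### Plaques tangent to `Ecs`, and the leaves as chains of tangent paths. -/

section Slices

variable {d : ℕ} {M : Type*} [TopologicalSpace M] [ChartedSpace (EuclideanSpace ℝ (Fin d)) M]
  [IsManifold (𝓡 d) ∞ M] (c : LaminationChart d M) (t : c.T)
  {Ecs Eu : ∀ x : M, Submodule ℝ (TangentSpace (𝓡 d) x)}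

namespace LaminationChart

theorem isC1Path_slice {η : ℝ → EuclideanSpace ℝ (Fin c.dim)} (hη : ContDiff ℝ 1 η) :
    IsC1Path d (fun u => c.φ (η u, t)) :=
  ((c.contMDiff_slice t).comp hη.contMDiff).contMDiffOn

theorem mfderivWithin_slice {η : ℝ → EuclideanSpace ℝ (Fin c.dim)}
    {η' : EuclideanSpace ℝ (Fin c.dim)} {u : ℝ} (hη : HasDerivAt η η' u) (hu : u ∈ Icc (0 : ℝ) 1) :
    mfderivWithin 𝓘(ℝ, ℝ) (𝓡 d) (fun u => c.φ (η u, t)) (Icc 0 1) u (1 : ℝ)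
      = mfderiv (𝓡 c.dim) (𝓡 d) (fun b' => c.φ (b', t)) (η u) η' := by
  have h1 := ((c.contMDiff_slice t).mdifferentiable one_ne_zero (η u)).hasMFDerivAt
  have h2 : HasMFDerivAt 𝓘(ℝ, ℝ) (𝓡 c.dim) η u (ContinuousLinearMap.toSpanSingleton ℝ η') :=
    hη.hasFDerivAt.hasMFDerivAt
  have h3 := ((h1.comp u h2).hasMFDerivWithinAt (s := Icc 0 1)).mfderivWithin
    (uniqueMDiffWithinAt_unitInterval hu)
  refine (DFunLike.congr_fun h3 (1 : ℝ)).trans ?_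
  show mfderiv (𝓡 c.dim) (𝓡 d) (fun b' => c.φ (b', t)) (η u) ((1 : ℝ) • η') = _
  rw [one_smul]

/-- The segment from `b` to `b'`. -/
def segmentPath {k : ℕ} (b b' : EuclideanSpace ℝ (Fin k)) (u : ℝ) : EuclideanSpace ℝ (Fin k) :=
  b + u • (b' - b)

theorem hasDerivAt_segmentPath {k : ℕ} (b b' : EuclideanSpace ℝ (Fin k)) (u : ℝ) :
    HasDerivAt (segmentPath b b') (b' - b) u := by
  have := ((hasDerivAt_id u).smul_const (b' - b)).const_add b
  rwa [one_smul] at this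

theorem contDiff_segmentPath {k : ℕ} (b b' : EuclideanSpace ℝ (Fin k)) :
    ContDiff ℝ 1 (segmentPath b b') := by
  unfold segmentPath; fun_prop

variable {c} {t}

theorem IsTangentTo.isTangentPath_slice (hc : c.IsTangentTo Ecs)
    (b b' : EuclideanSpace ℝ (Fin c.dim)) :
    IsTangentPath Ecs (fun u => c.φ (segmentPath b b' u, t)) := by
  intro u hu
  rw [c.mfderivWithin_slice t (hasDerivAt_segmentPath b b' u) hu, ← hc]
  exact ⟨_, rfl⟩

theorem IsTangentTo.tangentJoined (hc : c.IsTangentTo Ecs) {x y : M} (hx : x ∈ c.plaque t)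
    (hy : y ∈ c.plaque t) : TangentJoined Ecs x y := by
  obtain ⟨b, rfl⟩ := hx
  obtain ⟨b', rfl⟩ := hy
  exact ⟨_, c.isC1Path_slice t (contDiff_segmentPath b b'), hc.isTangentPath_slice b b',
    by simp [segmentPath], by simp [segmentPath]⟩

variable (c t) in
theorem eventually_norm_mfderiv_segment_le [RiemannianBundle (fun x : M => TangentSpace (𝓡 d) x)]
    [IsContinuousRiemannianBundle (EuclideanSpace ℝ (Fin d)) (fun x : M => TangentSpace (𝓡 d) x)]
    (b : EuclideanSpace ℝ (Fin c.dim)) {τ : ℝ} (hτ : 0 < τ) :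
    ∀ᶠ b' in 𝓝 b, ∀ u ∈ Icc (0 : ℝ) 1, ‖mfderivWithin 𝓘(ℝ, ℝ) (𝓡 d)
      (fun u => c.φ (segmentPath b b' u, t)) (Icc 0 1) u (1 : ℝ)‖ ≤ τ := by
  have h1 : Continuous fun p : EuclideanSpace ℝ (Fin c.dim) × EuclideanSpace ℝ (Fin c.dim) =>
      ‖mfderiv (𝓡 c.dim) (𝓡 d) (fun b' => c.φ (b', t)) p.1 p.2‖ :=
    (continuous_norm_tangentBundle (d := d) (M := M)).comp
      (c.continuous_mfderiv.comp (g := _) (f := fun p : EuclideanSpace ℝ (Fin c.dim) ×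
        EuclideanSpace ℝ (Fin c.dim) => ((p.1, t), p.2)) (by fun_prop))
  have h2 : ∀ᶠ p in 𝓝 (b, (0 : EuclideanSpace ℝ (Fin c.dim))),
      ‖mfderiv (𝓡 c.dim) (𝓡 d) (fun b' => c.φ (b', t)) p.1 p.2‖ < τ := by
    refine h1.continuousAt.eventually_lt continuousAt_const ?_
    have h0 : mfderiv (𝓡 c.dim) (𝓡 d) (fun b' => c.φ (b', t)) b
      (0 : EuclideanSpace ℝ (Fin c.dim)) = 0 := ContinuousLinearMap.map_zero _
    show ‖mfderiv (𝓡 c.dim) (𝓡 d) (fun b' => c.φ (b', t)) b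
      (0 : EuclideanSpace ℝ (Fin c.dim))‖ < τ
    rwa [h0, norm_zero]
  obtain ⟨ε, hε, h3⟩ := Metric.eventually_nhds_iff.1 h2
  filter_upwards [Metric.ball_mem_nhds b hε] with b' hb' u hu
  rw [c.mfderivWithin_slice t (hasDerivAt_segmentPath b b' u) hu]
  refine (@h3 (segmentPath b b' u, b' - b) ?_).le
  rw [Metric.mem_ball, dist_eq_norm] at hb'
  rw [Prod.dist_eq, dist_zero_right, dist_eq_norm, segmentPath, add_sub_cancel_left, norm_smul,
    Real.norm_of_nonneg hu.1]
  exact max_lt ((mul_le_of_le_one_left (norm_nonneg _) hu.2).trans_lt hb') hb'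

end LaminationChart

end Slices

section LocalPlaques

variable {d : ℕ} {M : Type*} [EMetricSpace M] [ChartedSpace (EuclideanSpace ℝ (Fin d)) M]
  [IsManifold (𝓡 d) ∞ M] [RiemannianBundle (fun x : M => TangentSpace (𝓡 d) x)]
  [IsRiemannianManifold (𝓡 d) M]
  [IsContinuousRiemannianBundle (EuclideanSpace ℝ (Fin d)) (fun x : M => TangentSpace (𝓡 d) x)]
  {Ecs Eu : ∀ x : M, Submodule ℝ (TangentSpace (𝓡 d) x)} {c : LaminationChart d M}
  {f : M → M} {C : ℝ}

theorem LaminationChart.IsTangentTo.eventually_staysClose (hc : c.IsTangentTo Ecs)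
    (hf : ContMDiff (𝓡 d) (𝓡 d) 1 f)
    (hC : ∀ (n : ℕ) (x : M), ∀ v ∈ Ecs x, ‖mfderiv (𝓡 d) (𝓡 d) (f^[n]) x v‖ ≤ C * ‖v‖)
    (b : EuclideanSpace ℝ (Fin c.dim)) (t : c.T) {ρ : ℝ} (hρ : 0 < ρ) :
    ∀ᶠ b' in 𝓝 b, StaysClose f (ENNReal.ofReal ρ) (c.φ (b, t)) (c.φ (b', t)) := by
  have hC1 : 0 < max C 1 := lt_max_of_lt_right one_pos
  filter_upwards [c.eventually_norm_mfderiv_segment_le t b (div_pos hρ hC1)] with b' hb'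
  have h1 := (hc.isTangentPath_slice (t := t) b b').staysClose hf hC
    (c.isC1Path_slice t (LaminationChart.contDiff_segmentPath b b')) le_rfl zero_le_one le_rfl
  simp only [LaminationChart.segmentPath, zero_smul, add_zero, one_smul, add_sub_cancel] at h1
  refine h1.mono ?_
  calc _ ≤ ENNReal.ofReal (max C 1) * ENNReal.ofReal (ρ / max C 1) := by
        gcongr
        · exact le_max_left _ _
        · exact pathELength_le_of_enorm_le hb'
    _ = ENNReal.ofReal ρ := by
        rw [← ENNReal.ofReal_mul hC1.le, mul_div_cancel₀ _ hC1.ne']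

/-- Points whose forward orbit stays close to the one of a point of a plaque of a chart tangent
to `Ecs` lie on this plaque. -/
theorem LaminationChart.IsTangentTo.exists_mem_plaque (hc : c.IsTangentTo Ecs)
    (hf : ContMDiff (𝓡 d) (𝓡 d) 1 f) (hEcs : IsContinuousSubbundle Ecs)
    (hsplit : ∀ x : M, IsCompl (Ecs x) (Eu x)) (K : ConeField f Eu)
    (hC : ∀ (n : ℕ) (x : M), ∀ v ∈ Ecs x, ‖mfderiv (𝓡 d) (𝓡 d) (f^[n]) x v‖ ≤ C * ‖v‖)
    (b : EuclideanSpace ℝ (Fin c.dim)) (t : c.T) :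
    ∃ ρ : ℝ, 0 < ρ ∧ ∀ q, StaysClose f (ENNReal.ofReal ρ) (c.φ (b, t)) q → q ∈ c.plaque t := by
  set p := c.φ (b, t)
  obtain ⟨B⟩ := exists_localBox hEcs hsplit p
  obtain ⟨r, hr, hu⟩ := B.exists_eq_of_proj_eq K
  set g : M → EuclideanSpace ℝ (Fin B.k) := B.proj ∘ extChartAt (𝓡 d) p
  have hp : p ∈ (extChartAt (𝓡 d) p).source := mem_extChartAt_source p
  have hg : ContMDiffAt (𝓡 d) 𝓘(ℝ, EuclideanSpace ℝ (Fin B.k)) 1 g p := B.contMDiffAt_proj_chart hp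
  have hs := (c.contMDiff_slice t).contMDiffAt (x := b)
  set h : EuclideanSpace ℝ (Fin c.dim) → EuclideanSpace ℝ (Fin B.k) := fun b' => g (c.φ (b', t))
  have hh : ContDiffAt ℝ 1 h b := (hg.comp b hs).contDiffAt
  have hd : ∀ w : EuclideanSpace ℝ (Fin c.dim), fderiv ℝ h b w
      = vderiv g p (mfderiv (𝓡 c.dim) (𝓡 d) (fun b' => c.φ (b', t)) b w) := by
    intro w
    have h1 := (hg.mdifferentiableAt one_ne_zero).hasMFDerivAt.comp b
      (hs.mdifferentiableAt one_ne_zero).hasMFDerivAt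
    let L : EuclideanSpace ℝ (Fin c.dim) →L[ℝ] EuclideanSpace ℝ (Fin B.k) :=
      (vderiv g p).comp (mfderiv (𝓡 c.dim) (𝓡 d) (fun b' => c.φ (b', t)) b)
    have h2 : HasFDerivAt h L b := h1.hasFDerivAt
    rw [h2.fderiv]; rfl
  -- The plaque is tangent to `Ecs p`, a complement of the kernel `Eu p` of the projected chart, so
  -- `h` is a submersion and its image of any neighbourhood of `b` is a neighbourhood. A point `q`
  -- near `p` thus has the same projection as some nearby plaque point; both stay close to `p`,
  -- hence they coincide.
  have hsurj : (fderiv ℝ h b).range = ⊤ := by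
    refine LinearMap.range_eq_top.2 fun u => ?_
    obtain ⟨y, rfl⟩ := B.proj_surjective u
    obtain ⟨v, rfl⟩ := surjective_vderiv_chart hp y
    have hv : v ∈ Ecs p ⊔ Eu p := (hsplit p).sup_eq_top ▸ Submodule.mem_top
    obtain ⟨v1, hv1, v2, hv2, rfl⟩ := Submodule.mem_sup.1 hv
    rw [← hc b t] at hv1
    obtain ⟨w, rfl⟩ := hv1
    refine ⟨w, (hd w).trans ?_⟩
    rw [map_add, map_add, (B.proj_eq_zero v2).2 hv2, add_zero]
    exact B.vderiv_proj_chart hp _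
  have hmap := (hh.hasStrictFDerivAt one_ne_zero).map_nhds_eq_of_surj hsurj
  have hN := hc.eventually_staysClose hf hC b t (half_pos hr)
  have himg : h '' {b' | StaysClose f (ENNReal.ofReal (r / 2)) p (c.φ (b', t))} ∈ 𝓝 (g p) := by
    have : 𝓝 (g p) = map h (𝓝 b) := hmap.symm
    rw [this]
    exact image_mem_map hN
  obtain ⟨ε, hε, hε'⟩ := EMetric.mem_nhds_iff.1 (hg.continuousAt himg)
  obtain ⟨ρ, hρ0, hρ⟩ := ENNReal.lt_iff_exists_nnreal_btwn.1 hε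
  have hr2 : r / 2 ≤ r := by linarith
  refine ⟨min ρ (r / 2), lt_min (by exact_mod_cast hρ0) (half_pos hr), fun q hq => ?_⟩
  have hq1 : q ∈ Metric.eball p ε := by
    rw [Metric.mem_eball, edist_comm]
    refine (hq.edist_le.trans (ENNReal.ofReal_le_ofReal (min_le_left _ _))).trans_lt ?_
    simpa using hρ
  obtain ⟨b', hb', hbq⟩ := hε' hq1
  have hq2 : StaysClose f (ENNReal.ofReal (r / 2)) p q :=
    hq.mono (ENNReal.ofReal_le_ofReal (min_le_right _ _))
  have hb2 : StaysClose f (ENNReal.ofReal (r / 2)) p (c.φ (b', t)) := hb'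
  refine ⟨b', hu _ _ ?_ ?_ hbq ?_⟩
  · rw [edist_comm]
    exact hb2.edist_le.trans (ENNReal.ofReal_le_ofReal hr2)
  · rw [edist_comm]
    exact hq2.edist_le.trans (ENNReal.ofReal_le_ofReal hr2)
  · refine (hb2.symm.trans hq2).mono ?_
    rw [← ENNReal.ofReal_add (by positivity) (by positivity), add_halves]

theorem Lamination.IsTangentTo.samePlaque_tangentJoined {W : Lamination d M}
    (hW : W.IsTangentTo Ecs) {x y : M} (h : W.SamePlaque x y) : TangentJoined Ecs x y := by
  obtain ⟨c, hc, t, hx, hy⟩ := h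
  exact LaminationChart.IsTangentTo.tangentJoined (hW c hc) hx hy

theorem Lamination.SamePlaque.symm {W : Lamination d M} {x y : M} (h : W.SamePlaque x y) :
    W.SamePlaque y x := by
  obtain ⟨c, hc, t, hx, hy⟩ := h
  exact ⟨c, hc, t, hy, hx⟩

/-- Close parameters give points whose forward orbits stay close, hence points on a common plaque;
connectedness of the interval chains the plaques. -/
theorem Lamination.IsTangentTo.mem_leaf_of_isTangentPath {W : Lamination d M}
    (hW : W.IsTangentTo Ecs) (hf : ContMDiff (𝓡 d) (𝓡 d) 1 f) (hEcs : IsContinuousSubbundle Ecs)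
    (hsplit : ∀ x : M, IsCompl (Ecs x) (Eu x)) (K : ConeField f Eu)
    (hC : ∀ (n : ℕ) (x : M), ∀ v ∈ Ecs x, ‖mfderiv (𝓡 d) (𝓡 d) (f^[n]) x v‖ ≤ C * ‖v‖)
    {γ : ℝ → M} (hγ : IsC1Path d γ) (hγ' : IsTangentPath Ecs γ) {s t : ℝ}
    (hs : s ∈ Icc (0 : ℝ) 1) (ht : t ∈ Icc (0 : ℝ) 1) : γ t ∈ W.leaf (γ s) := by
  obtain ⟨A, hA0, hA⟩ := hγ'.exists_staysClose hf hC hγ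
  refine isPreconnected_Icc.induction₂ (fun s t => γ t ∈ W.leaf (γ s)) ?_ ?_ ?_ hs ht
  · intro s hs
    obtain ⟨c, hc, ⟨b, τ⟩, hb⟩ := W.covers (γ s)
    obtain ⟨ρ, hρ, h⟩ := LaminationChart.IsTangentTo.exists_mem_plaque (hW c hc) hf hEcs hsplit K
      hC b τ
    have h1 : ∀ᶠ t in 𝓝 s, A * |s - t| < ρ := by
      refine ContinuousAt.eventually_lt (by fun_prop) continuousAt_const ?_
      simpa using hρ
    filter_upwards [nhdsWithin_le_nhds h1, self_mem_nhdsWithin] with t h1 ht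
    refine Relation.ReflTransGen.single ⟨c, hc, τ, ⟨b, hb⟩, h _ ?_⟩
    rw [hb]
    exact (hA s hs t ht).mono (ENNReal.ofReal_le_ofReal h1.le)
  · intro x y z _ _ _ h1 h2
    exact Relation.ReflTransGen.trans h1 h2
  · intro x y _ _ h
    have : Std.Symm W.SamePlaque := ⟨fun _ _ h => h.symm⟩
    exact Relation.ReflTransGen.stdSymm.symm _ _ h

/-- The leaves of a lamination tangent to `Ecs` are the classes of points which are joined by
chains of paths tangent to `Ecs`. -/
theorem Lamination.IsTangentTo.leaf_eq {W : Lamination d M}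
    (hW : W.IsTangentTo Ecs) (hf : ContMDiff (𝓡 d) (𝓡 d) 1 f) (hEcs : IsContinuousSubbundle Ecs)
    (hsplit : ∀ x : M, IsCompl (Ecs x) (Eu x)) (K : ConeField f Eu)
    (hC : ∀ (n : ℕ) (x : M), ∀ v ∈ Ecs x, ‖mfderiv (𝓡 d) (𝓡 d) (f^[n]) x v‖ ≤ C * ‖v‖) (x : M) :
    W.leaf x = {y | Relation.ReflTransGen (TangentJoined Ecs) x y} := by
  ext y
  constructor
  · exact Relation.ReflTransGen.mono (fun _ _ h => hW.samePlaque_tangentJoined h) x y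
  · intro h
    induction h with
    | refl => exact Relation.ReflTransGen.refl
    | tail _ h ih =>
      obtain ⟨γ, h1, h2, rfl, rfl⟩ := h
      exact Relation.ReflTransGen.trans ih (hW.mem_leaf_of_isTangentPath hf hEcs hsplit K hC h1 h2
        (left_mem_Icc.2 zero_le_one) (right_mem_Icc.2 zero_le_one))

/-- Compactness provides a finite atlas. Compatibility is automatic: near a common point of two
plaques, the points of the first have forward orbits close to that of the common point, so they lie
on the second. Finiteness and plaque coordinates are recorded to show later that `C¹` paths in a
leaf are tangent to `Ecs`. -/
theorem exists_lamination [CompactSpace M] (hf : ContMDiff (𝓡 d) (𝓡 d) 1 f)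
    (hEcs : IsContinuousSubbundle Ecs) (hsplit : ∀ x : M, IsCompl (Ecs x) (Eu x))
    (K : ConeField f Eu) (hC₀ : 0 ≤ C)
    (hC : ∀ (n : ℕ) (x : M), ∀ v ∈ Ecs x, ‖mfderiv (𝓡 d) (𝓡 d) (f^[n]) x v‖ ≤ C * ‖v‖) :
    ∃ W : Lamination d M, W.IsTangentTo Ecs ∧ W.atlas.Finite ∧
      ∀ c ∈ W.atlas, c.HasPlaqueCoordinate := by
  choose c hxc hc hG using exists_laminationChart hf hEcs hsplit K hC₀ hC
  obtain ⟨s, hs⟩ := isCompact_univ.elim_nhds_subcover (fun x => range (c x).φ)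
    fun x _ => (c x).isOpenEmbedding.isOpen_range.mem_nhds (hxc x)
  refine ⟨⟨c '' s, ?_, ?_⟩, ?_, ?_, ?_⟩
  · intro x
    obtain ⟨y, hy, hxy⟩ := mem_iUnion₂.1 (hs.2 (mem_univ x))
    exact ⟨c y, mem_image_of_mem _ hy, hxy⟩
  · rintro _ ⟨x, -, rfl⟩ _ ⟨y, -, rfl⟩ t t'
    rw [isOpen_iff_eventually]
    rintro b ⟨b', hb'⟩
    obtain ⟨ρ, hρ, h⟩ := (hc y).exists_mem_plaque hf hEcs hsplit K hC b' t'
    filter_upwards [(hc x).eventually_staysClose hf hC b t hρ] with b₁ hb₁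
    refine h _ ?_
    rwa [show (c y).φ (b', t') = _ from hb']
  · rintro _ ⟨x, -, rfl⟩
    exact hc x
  · exact s.finite_toSet.image _
  · rintro _ ⟨x, -, rfl⟩
    exact hG x

theorem Lamination.IsTangentTo.isInvariant {W : Lamination d M}
    (hW : W.IsTangentTo Ecs) (g : M ≃ₘ^1⟮𝓡 d, 𝓡 d⟯ M) (hEcs : IsContinuousSubbundle Ecs)
    (hsplit : ∀ x : M, IsCompl (Ecs x) (Eu x)) (K : ConeField g Eu)
    (hC : ∀ (n : ℕ) (x : M), ∀ v ∈ Ecs x, ‖mfderiv (𝓡 d) (𝓡 d) (g^[n]) x v‖ ≤ C * ‖v‖)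
    (hinv : IsInvariantSubbundle g Ecs) : W.IsInvariant g := by
  intro x
  have hg := g.contMDiff
  rw [hW.leaf_eq hg hEcs hsplit K hC, hW.leaf_eq hg hEcs hsplit K hC]
  have h1 : ∀ x, ∀ v ∈ Ecs x, mfderiv (𝓡 d) (𝓡 d) g x v ∈ Ecs (g x) :=
    fun x v hv => hinv.mfderiv_mem hv
  -- Invariance is an equality of subspaces, so the derivative of the inverse preserves `Ecs` too.
  -- The heterogeneous equality below only transports along `g.symm (g y) = y`.
  have h2 : ∀ x, ∀ v ∈ Ecs x, mfderiv (𝓡 d) (𝓡 d) g.symm x v ∈ Ecs (g.symm x) := by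
    have key : ∀ y, ∀ w ∈ Ecs (g y), mfderiv (𝓡 d) (𝓡 d) g.symm (g y) w ∈ Ecs (g.symm (g y)) := by
      intro y w hw
      rw [← hinv y] at hw
      obtain ⟨v, hv, rfl⟩ := hw
      have h3 := (g.symm.contMDiff.mdifferentiable one_ne_zero (g y)).hasMFDerivAt.comp y
        (hg.mdifferentiable one_ne_zero y).hasMFDerivAt
      have h4 : g.symm ∘ g = id := funext g.symm_apply_apply
      rw [h4] at h3
      have h5 := hasMFDerivAt_unique h3 (hasMFDerivAt_id y)
      have h6 := DFunLike.congr_fun h5 v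
      have h7 : ∀ z, z = y → ∀ v' : TangentSpace (𝓡 d) z, HEq v' v → v' ∈ Ecs z := by
        rintro z rfl v' hv'
        rw [eq_of_heq hv']; exact hv
      exact h7 _ (g.symm_apply_apply y) _ (heq_of_eq h6)
    intro x v hv
    have := key (g.symm x)
    rw [g.apply_symm_apply] at this
    exact this v hv
  ext y
  constructor
  · rintro ⟨z, hz, rfl⟩
    exact Relation.ReflTransGen.lift g (fun _ _ h => TangentJoined.map hg h1 h) _ _ hz
  · intro hy
    refine ⟨g.symm y, ?_, g.apply_symm_apply y⟩
    have := Relation.ReflTransGen.lift g.symm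
      (fun _ _ h => TangentJoined.map g.symm.contMDiff h2 h) _ _ hy
    rw [Function.onFun, g.symm_apply_apply] at this
    exact this

end LocalPlaques

/-! ### Expansivity for pairs of pseudo-orbits in the cone. -/

section PseudoOrbits

/-- Each jump is an error of at most `ε` for all future times, so errors add up linearly instead of
being amplified. -/
theorem StaysClose.pseudoOrbit {M : Type*} [EMetricSpace M] {f : M → M} {ε : ℝ} (hε : 0 ≤ ε)
    {x : ℤ → M} (hx : ∀ n, StaysClose f (ENNReal.ofReal ε) (f (x n)) (x (n + 1))) (j : ℕ) (n : ℤ) :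
    StaysClose f (ENNReal.ofReal (j * ε)) (f^[j] (x n)) (x (n + j)) := by
  induction j generalizing n with
  | zero => simpa using StaysClose.refl f (x n)
  | succ j ih =>
    have h1 := ((hx n).iterate j).trans (ih (n + 1))
    rw [← ENNReal.ofReal_add hε (by positivity)] at h1
    rw [Function.iterate_succ_apply]
    convert h1 using 2
    · push_cast; ring
    · push_cast; ring

variable {d : ℕ} {M : Type*} [EMetricSpace M] [ChartedSpace (EuclideanSpace ℝ (Fin d)) M]
  [IsManifold (𝓡 d) ∞ M] {f : M → M} {Eu : ∀ x : M, Submodule ℝ (TangentSpace (𝓡 d) x)}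

/-- Two pseudo-orbits, with jumps preserving the forward orbits up to a small error, which stay
close to each other and in a cone of each other, start from the same point. -/
theorem ConeField.exists_eq_of_pseudoOrbits (K : ConeField f Eu) :
    ∃ ε : ℝ, 0 < ε ∧ ∀ x z : ℤ → M, (∀ n, K.Cone (x n) (z n)) →
      (∀ n, StaysClose f (ENNReal.ofReal ε) (f (x n)) (x (n + 1))) →
      (∀ n, StaysClose f (ENNReal.ofReal ε) (f (z n)) (z (n + 1))) →
      (∀ n, edist (x n) (z n) ≤ ENNReal.ofReal ε) → x 0 = z 0 := by
  obtain ⟨D, hD, hsmall⟩ := K.small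
  obtain ⟨r, hr, h⟩ := exists_forall_edist_le_of_uniformity
    ((K.step.and K.eq_of_height).and hD)
  obtain ⟨η, hη, hηU⟩ := hsmall {p | edist p.1 p.2 ≤ ENNReal.ofReal (r / 2)} (by
    filter_upwards [edist_mem_uniformity (ENNReal.ofReal_pos.2 (half_pos hr))] with p hp
    exact le_of_lt hp)
  -- A pair in the cone that can still be doubled `J` times has height below `η`, hence its distance
  -- is at most `r / 2`.
  obtain ⟨J, hJ0, hJ⟩ : ∃ J : ℕ, 0 < J ∧ K.bound < 2 ^ J * η := by
    obtain ⟨J, hJ⟩ := pow_unbounded_of_one_lt (K.bound / η) one_lt_two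
    refine ⟨J + 1, J.succ_pos, ((div_lt_iff₀ hη).1 hJ).trans_le ?_⟩
    gcongr
    · exact one_le_two
    · exact J.le_succ
  set N := K.m * J
  -- Over `N` steps both pseudo-orbits drift by at most `N ε` from the true orbits; with their
  -- mutual distance `ε` this makes `r / 2`.
  set ε := r / (2 * (2 * N + 1))
  have hε : 0 < ε := by positivity
  have hεr : 2 * (N * ε) + ε = r / 2 := by simp only [ε]; field_simp
  refine ⟨ε, hε, fun x z hcone hx hz hxz => ?_⟩
  have hstep := fun p q h' => (h p q h').1.1
  -- comparison of the true orbits with the pseudo-orbits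
  have hcmp : ∀ j : ℕ, j ≤ N → ∀ n i, edist (f^[i] (f^[j] (x n))) (f^[i] (f^[j] (z n)))
      ≤ ENNReal.ofReal (2 * (N * ε)) + edist (f^[i] (x (n + j))) (f^[i] (z (n + j))) := by
    intro j hj n i
    have h1 := StaysClose.pseudoOrbit hε.le hx j n i
    have h2 := StaysClose.pseudoOrbit hε.le hz j n i
    have h3 : ENNReal.ofReal (j * ε) ≤ ENNReal.ofReal (N * ε) := by gcongr
    have h4 := edist_triangle4 (f^[i] (f^[j] (x n))) (f^[i] (x (n + j))) (f^[i] (z (n + j)))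
      (f^[i] (f^[j] (z n)))
    rw [edist_comm] at h2
    calc _ ≤ _ := h4
      _ ≤ ENNReal.ofReal (N * ε) + edist (f^[i] (x (n + j))) (f^[i] (z (n + j)))
          + ENNReal.ofReal (N * ε) := by gcongr <;> exact le_trans ‹_› h3
      _ = _ := by
        rw [add_right_comm, ← ENNReal.ofReal_add (by positivity) (by positivity), two_mul]
  -- The true orbits of `x n` and `z n` stay `r`-close, by induction on `j` for all `n` at once. Up
  -- to `J`, they follow the pseudo-orbits. For `i + J`, the pair at `n + N` is `r`-close before
  -- time `i + J`, so at time `i` it can be doubled `J` more times and is `r / 2`-close; the drift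
  -- over the first `N` steps costs at most another `r / 2`.
  have key : ∀ j : ℕ, ∀ n, edist ((f^[K.m])^[j] (x n)) ((f^[K.m])^[j] (z n))
      ≤ ENNReal.ofReal r := by
    intro j
    induction j using Nat.strong_induction_on with
    | _ j ih =>
    intro n
    rcases le_or_gt j J with hjJ | hjJ
    · have h1 := hcmp (K.m * j) (Nat.mul_le_mul_left _ hjJ) n 0
      simp only [Function.iterate_zero, id] at h1
      rw [← Function.iterate_mul]
      refine h1.trans ?_
      calc _ ≤ ENNReal.ofReal (2 * (N * ε)) + ENNReal.ofReal ε := by gcongr; exact hxz _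
        _ = ENNReal.ofReal (r / 2) := by rw [← ENNReal.ofReal_add (by positivity) hε.le, hεr]
        _ ≤ _ := ENNReal.ofReal_le_ofReal (by linarith)
    · obtain ⟨i, rfl⟩ : ∃ i, j = i + J := ⟨j - J, by omega⟩
      have hi : ∀ i' < i + J, edist ((f^[K.m])^[i'] (x (n + N))) ((f^[K.m])^[i'] (z (n + N)))
          ≤ ENNReal.ofReal r := fun i' hi' => ih i' hi' _
      have h1 : edist ((f^[K.m])^[i] (x (n + N))) ((f^[K.m])^[i] (z (n + N)))
          ≤ ENNReal.ofReal (r / 2) := by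
        have c1 := (K.iterate hstep (hcone (n + N)) (j := i) fun i' hi' => hi i' (by omega)).1
        have c2 := (K.iterate hstep c1 (j := J) fun i' hi' => by
          rw [← Function.iterate_add_apply, ← Function.iterate_add_apply]
          exact hi _ (by omega)).2.trans (K.height_le _ _)
        exact hηU _ (h _ _ (hi i (by omega))).2 c1
          (lt_of_mul_lt_mul_left (c2.trans_lt hJ) (by positivity))
      have h2 := hcmp N le_rfl n (K.m * i)
      rw [Function.iterate_mul] at h2
      have h3 : ∀ p, (f^[K.m])^[i + J] p = (f^[K.m])^[i] (f^[N] p) := fun p => by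
        rw [Function.iterate_add_apply]; simp only [N, Function.iterate_mul]
      rw [h3, h3]
      refine h2.trans ?_
      calc _ ≤ ENNReal.ofReal (2 * (N * ε)) + ENNReal.ofReal (r / 2) := by gcongr
        _ = ENNReal.ofReal (2 * (N * ε) + r / 2) := by
          rw [← ENNReal.ofReal_add (by positivity) (by positivity)]
        _ ≤ _ := ENNReal.ofReal_le_ofReal (by linarith)
  exact K.eq_of_forall_edist_le hstep (fun p q h' => (h p q h').1.2) (hcone 0) fun j => key j 0

end PseudoOrbits

/-! ### Sliding a point along `Ecs` into the cone of a nearby one. -/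

section Slide

variable {d : ℕ} {M : Type*} [EMetricSpace M] [CompactSpace M]
  [ChartedSpace (EuclideanSpace ℝ (Fin d)) M]
  [IsManifold (𝓡 d) ∞ M] [RiemannianBundle (fun x : M => TangentSpace (𝓡 d) x)]
  [IsContinuousRiemannianBundle (EuclideanSpace ℝ (Fin d)) (fun x : M => TangentSpace (𝓡 d) x)]
  {f : M → M} {Ecs Eu : ∀ x : M, Submodule ℝ (TangentSpace (𝓡 d) x)}

/-- A point close to `x` can be moved along a short path tangent to `Ecs` into the cone of `x`. -/
theorem ConeField.eventually_exists_slide (K : ConeField f Eu) (hEcs : IsContinuousSubbundle Ecs)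
    (hsplit : ∀ x : M, IsCompl (Ecs x) (Eu x)) {ρ : ℝ} (hρ : 0 < ρ) :
    ∀ᶠ p in 𝓤 M, ∃ γ : ℝ → M, IsC1Path d γ ∧ IsTangentPath Ecs γ ∧ γ 0 = p.2 ∧
      K.Cone p.1 (γ 1) ∧ pathELength (𝓡 d) γ 0 1 < ENNReal.ofReal ρ := by
  refine eventually_uniformity_of_nhds_diagonal fun x₀ => ?_
  obtain ⟨B⟩ := exists_localBox hEcs hsplit x₀
  set χ := extChartAt (𝓡 d) x₀
  have hx₀ : x₀ ∈ χ.source := mem_extChartAt_source x₀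
  have hBC := B.C_pos
  have h1 := K.cone_of_eq B.k (B.proj ∘ χ) x₀ (B.contMDiffAt_proj_chart hx₀)
    (fun v => by rw [B.vderiv_proj_chart hx₀]; exact B.proj_eq_zero v) (fun u => by
      obtain ⟨w, rfl⟩ := B.proj_surjective u
      obtain ⟨v, rfl⟩ := surjective_vderiv_chart hx₀ w
      exact ⟨v, B.vderiv_proj_chart hx₀ v⟩)
  have hχ : Tendsto χ (𝓝 x₀) (𝓝 (χ x₀)) := continuousAt_extChartAt x₀
  have hχ1 : Tendsto (fun p : M × M => χ p.1) (𝓝 (x₀, x₀)) (𝓝 (χ x₀)) :=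
    hχ.comp (continuous_fst.tendsto (x₀, x₀))
  have hχ2 : Tendsto (fun p : M × M => χ p.2) (𝓝 (x₀, x₀)) (𝓝 (χ x₀)) :=
    hχ.comp (continuous_snd.tendsto (x₀, x₀))
  have hv : Tendsto (fun p : M × M => B.C * ‖B.proj (χ p.1) - B.proj (χ p.2)‖) (𝓝 (x₀, x₀))
      (𝓝 0) := by
    have := ((((B.proj.continuous.tendsto _).comp hχ1).sub
      ((B.proj.continuous.tendsto _).comp hχ2)).norm).const_mul B.C
    simpa using this
  have hhol : Tendsto (fun p : M × M => B.hol (χ p.2) (B.proj (χ p.1))) (𝓝 (x₀, x₀))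
      (𝓝 (χ x₀)) := by
    have h2 : Tendsto (fun p : M × M => B.hol (χ p.2) (B.proj (χ p.1)) - χ p.2) (𝓝 (x₀, x₀))
        (𝓝 0) := squeeze_zero_norm (fun p => B.norm_hol_sub_le _ _) hv
    simpa using h2.add hχ2
  have hz : Tendsto (fun p : M × M => (p.1, χ.symm (B.hol (χ p.2) (B.proj (χ p.1)))))
      (𝓝 (x₀, x₀)) (𝓝 (x₀, x₀)) := by
    have h2 := (continuousAt_extChartAt_symm (I := 𝓡 d) x₀).tendsto
    rw [extChartAt_to_inv] at h2
    exact (continuous_fst.tendsto (x₀, x₀)).prodMk_nhds (h2.comp hhol)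
  have hsmall : ∀ᶠ p : M × M in 𝓝 (x₀, x₀),
      ‖χ p.2 - χ x₀‖ + B.C * ‖B.proj (χ p.1) - B.proj (χ p.2)‖ < B.ρ := by
    have h2 := ((hχ2.sub_const (χ x₀)).norm).add hv
    rw [sub_self, norm_zero, add_zero] at h2
    exact h2.eventually_lt_const B.ρ_pos
  have hlen : ∀ᶠ p : M × M in 𝓝 (x₀, x₀),
      B.C * (B.C * ‖B.proj (χ p.1) - B.proj (χ p.2)‖) < ρ := by
    have h2 := hv.const_mul B.C
    rw [mul_zero] at h2
    exact h2.eventually_lt_const hρ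
  have htgt := hhol.eventually ((isOpen_chart_target x₀).mem_nhds (mem_extChartAt_target x₀))
  have hsrc := (continuous_snd.tendsto (x₀, x₀)).eventually
    ((isOpen_extChartAt_source (I := 𝓡 d) x₀).mem_nhds hx₀)
  filter_upwards [hz.eventually h1, hsmall, hlen, htgt, hsrc] with p h2 h3 h4 h5 h6
  -- The holonomy takes `p.2` to a point with the same projection as `p.1`, hence in its cone.
  obtain ⟨ζ, hζ, hζ1⟩ := B.hol_spec (χ p.2) (B.proj (χ p.1))
  refine ⟨χ.symm ∘ ζ, hζ.isC1Path h3.le, hζ.isTangentPath h3.le, ?_, ?_, ?_⟩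
  · simp only [Function.comp, hζ.zero]
    exact χ.left_inv h6
  · simp only [Function.comp, hζ1]
    refine h2 ?_
    simp only [Function.comp]
    rw [χ.right_inv h5, LocalBox.proj_hol]
  · refine (hζ.pathELength_le h3.le).trans_lt ?_
    rwa [ENNReal.ofReal_lt_ofReal_iff hρ]

end Slide

/-! ### `C¹` paths inside a leaf are tangent to the bundle. -/

section LeafPaths

theorem countable_setOf_reflTransGen {α : Type*} {r : α → α → Prop}
    (h : ∀ a, {b | r a b}.Countable) (a : α) : {b | Relation.ReflTransGen r a b}.Countable := by
  let S : ℕ → Set α := fun n => Nat.rec {a} (fun _ T => ⋃ x ∈ T, {b | r x b}) n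
  have hS : ∀ n, (S n).Countable := by
    intro n
    induction n with
    | zero => exact countable_singleton a
    | succ n ih => exact ih.biUnion fun x _ => h x
  refine (countable_iUnion hS).mono fun b hb => ?_
  induction hb with
  | refl => exact mem_iUnion.2 ⟨0, rfl⟩
  | tail _ hbc ih =>
    obtain ⟨n, hn⟩ := mem_iUnion.1 ih
    exact mem_iUnion.2 ⟨n + 1, mem_iUnion₂.2 ⟨_, hn, hbc⟩⟩

theorem subsingleton_of_isPreconnected_of_countable {X : Type*} [TopologicalSpace X]
    [TopologicalSpace.MetrizableSpace X] {s : Set X} (hs : IsPreconnected s) (hc : s.Countable) :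
    s.Subsingleton := by
  let := TopologicalSpace.metrizableSpaceMetric X
  exact hc.isTotallyDisconnected s subset_rfl hs

variable {d : ℕ} {M : Type*} [TopologicalSpace M] [ChartedSpace (EuclideanSpace ℝ (Fin d)) M]
  [IsManifold (𝓡 d) ∞ M] {E : ∀ x : M, Submodule ℝ (TangentSpace (𝓡 d) x)}

namespace Lamination

variable (W : Lamination d M)

/-- The plaques of the atlas of a lamination. -/
def PlaqueIndex : Type _ := Σ c : W.atlas, (c : LaminationChart d M).T

/-- Two plaques of the atlas intersect. -/
def Meets (P Q : W.PlaqueIndex) : Prop :=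
  (P.1.1.plaque P.2 ∩ Q.1.1.plaque Q.2).Nonempty

variable {W}

/-- The plaques of one chart cut a given plaque in disjoint sets, open by compatibility, and a
Euclidean space contains only countably many disjoint nonempty open sets. -/
theorem countable_setOf_meets (hW : W.atlas.Countable) (P : W.PlaqueIndex) :
    {Q | W.Meets P Q}.Countable := by
  have := hW.to_subtype
  have h1 : ∀ c : W.atlas, {t : c.1.T | W.Meets P ⟨c, t⟩}.Countable := by
    intro c
    refine PairwiseDisjoint.countable_of_isOpen
      (s := fun t => {b | P.1.1.φ (b, P.2) ∈ c.1.plaque t}) ?_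
      (fun t _ => W.compatible _ P.1.2 _ c.2 _ _) ?_
    · intro t _ t' _ htt
      refine Set.disjoint_left.2 ?_
      rintro b ⟨b1, h1⟩ ⟨b2, h2⟩
      exact htt (congrArg Prod.snd (c.1.isOpenEmbedding.injective (h1.trans h2.symm)))
    · rintro t ⟨y, ⟨b, rfl⟩, h2⟩
      exact ⟨b, h2⟩
  refine (countable_iUnion fun c : W.atlas => (h1 c).image fun t =>
    (⟨c, t⟩ : W.PlaqueIndex)).mono ?_
  rintro ⟨c, t⟩ h
  exact mem_iUnion.2 ⟨c, t, h, rfl⟩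

/-- A leaf contains countably many plaques of each chart of a countable atlas. -/
theorem countable_plaques_leaf (hW : W.atlas.Countable) {c : LaminationChart d M}
    (hc : c ∈ W.atlas) (x : M) : {t : c.T | ∃ y ∈ c.plaque t, y ∈ W.leaf x}.Countable := by
  obtain ⟨c₀, hc₀, ⟨b₀, t₀⟩, h₀⟩ := W.covers x
  let P₀ : W.PlaqueIndex := ⟨⟨c₀, hc₀⟩, t₀⟩
  have key : ∀ y ∈ W.leaf x, ∃ P, Relation.ReflTransGen W.Meets P₀ P ∧
      y ∈ P.1.1.plaque P.2 := by
    intro y hy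
    induction hy with
    | refl => exact ⟨P₀, .refl, b₀, h₀⟩
    | tail _ h ih =>
      obtain ⟨P, hP, hyP⟩ := ih
      obtain ⟨c', hc', t', h1, h2⟩ := h
      exact ⟨⟨⟨c', hc'⟩, t'⟩, hP.tail ⟨_, hyP, h1⟩, h2⟩
  refine ((countable_setOf_reflTransGen (countable_setOf_meets hW) P₀).preimage
    (f := fun t : c.T => (⟨⟨c, hc⟩, t⟩ : W.PlaqueIndex)) ?_).mono ?_
  · intro t t' h
    exact eq_of_heq (Sigma.mk.inj h).2
  · rintro t ⟨y, hyt, hy⟩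
    obtain ⟨P, hP, hyP⟩ := key y hy
    exact hP.tail ⟨y, hyP, hyt⟩

/-- A `C¹` path which stays in a leaf of a lamination tangent to `E` is tangent to `E`. -/
theorem IsTangentTo.isTangentPath [TopologicalSpace.MetrizableSpace M] (hE : W.IsTangentTo E)
    (hW : W.atlas.Countable) (hG : ∀ c ∈ W.atlas, c.HasPlaqueCoordinate) {γ : ℝ → M}
    (hγ : IsC1Path d γ) {x : M} (hx : ∀ t ∈ Icc (0 : ℝ) 1, γ t ∈ W.leaf x) :
    IsTangentPath E γ := by
  intro s hs
  obtain ⟨c, hc, ⟨b₀, t₀⟩, h₀⟩ := W.covers (γ s)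
  obtain ⟨G, hG⟩ := hG c hc
  have hne : Nonempty (EuclideanSpace ℝ (Fin c.dim) × c.T) := ⟨(b₀, t₀)⟩
  let ψ := c.isOpenEmbedding.toOpenPartialHomeomorph c.φ
  have hcont : ContinuousOn γ (Icc 0 1) := hγ.continuousOn
  obtain ⟨ε, hε, hball⟩ := Metric.mem_nhdsWithin_iff.1
    ((hcont s hs) (c.isOpenEmbedding.isOpen_range.mem_nhds ⟨_, h₀⟩))
  set I := Metric.ball s ε ∩ Icc 0 1
  have hsI : s ∈ I := ⟨Metric.mem_ball_self hε, hs⟩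
  have hI : IsPreconnected I := by
    refine OrdConnected.isPreconnected ?_
    simp only [I, Real.ball_eq_Ioo]
    exact ordConnected_Ioo.inter ordConnected_Icc
  have hψ : ∀ u ∈ I, c.φ (ψ.symm (γ u)) = γ u := fun u hu =>
    ψ.right_inv (by simpa [ψ] using hball hu)
  have hτ : ContinuousOn (fun u => (ψ.symm (γ u)).2) I :=
    continuous_snd.comp_continuousOn (ψ.continuousOn_symm.comp (hcont.mono inter_subset_right)
      fun u hu => by simpa [ψ] using hball hu)
  -- Near `s` the transverse coordinate of the path is continuous on an interval with countably many
  -- values, so it is constant: the path remains on one plaque there.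
  have hsub := subsingleton_of_isPreconnected_of_countable (hI.image _ hτ)
    ((countable_plaques_leaf hW hc x).mono (by
      rintro _ ⟨u, hu, rfl⟩
      exact ⟨γ u, ⟨(ψ.symm (γ u)).1, hψ u hu⟩, hx u hu.2⟩))
  have hs0 : ψ.symm (γ s) = (b₀, t₀) :=
    c.isOpenEmbedding.injective ((hψ s hsI).trans h₀.symm)
  have hloc : ∀ u ∈ I, γ u = c.φ (G (γ u), t₀) := by
    intro u hu
    -- The `C¹` plaque coordinate `G` writes the path as a differentiable curve in the slice, so the
    -- chain rule puts its velocity in the tangent space of the plaque.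
    have h1 : (ψ.symm (γ u)).2 = t₀ := by
      have := hsub (mem_image_of_mem _ hu) (mem_image_of_mem _ hsI)
      simpa [hs0] using this
    have h2 := hψ u hu
    have h3 := (hG (ψ.symm (γ u)).1 (ψ.symm (γ u)).2).2
    rw [Prod.mk.eta, h2] at h3
    rw [h3, ← h1, Prod.mk.eta, h2]
  have hGs : G (γ s) = b₀ := by rw [← h₀]; exact (hG b₀ t₀).2
  have hG1 : MDifferentiableAt (𝓡 d) (𝓡 c.dim) G (γ s) := by
    rw [← h₀]; exact (hG b₀ t₀).1.mdifferentiableAt one_ne_zero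
  have hslice : HasMFDerivAt (𝓡 c.dim) (𝓡 d) (fun b => c.φ (b, t₀)) (G (γ s))
      (mfderiv (𝓡 c.dim) (𝓡 d) (fun b => c.φ (b, t₀)) b₀) := by
    rw [hGs]
    exact ((c.contMDiff_slice t₀).mdifferentiable one_ne_zero b₀).hasMFDerivAt
  have hd := hslice.comp_hasMFDerivWithinAt s (hG1.hasMFDerivAt.comp_hasMFDerivWithinAt s
    (hγ.mdifferentiableOn one_ne_zero s hs).hasMFDerivWithinAt)
  have hev : γ =ᶠ[𝓝[Icc 0 1] s] (fun b => c.φ (b, t₀)) ∘ G ∘ γ := by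
    filter_upwards [inter_mem (mem_nhdsWithin_of_mem_nhds (Metric.ball_mem_nhds s hε))
      self_mem_nhdsWithin] with u hu
    exact hloc u hu
  have hd' := (hd.congr_of_eventuallyEq hev (hloc s hsI)).mfderivWithin
    (uniqueMDiffWithinAt_unitInterval hs)
  have hmem : ∀ p, p = c.φ (b₀, t₀) → ∀ v : EuclideanSpace ℝ (Fin d),
      (show TangentSpace (𝓡 d) (c.φ (b₀, t₀)) from v) ∈ E (c.φ (b₀, t₀)) →
      (show TangentSpace (𝓡 d) p from v) ∈ E p := by
    rintro p rfl v hv; exact hv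
  rw [hd']
  refine hmem _ h₀.symm _ ?_
  rw [← hE c hc b₀ t₀]
  exact ⟨_, rfl⟩

end Lamination

end LeafPaths

/-! ### Plaque expansivity and the main theorem. -/

section PlaqueExpansive

variable {d : ℕ} {M : Type*} [EMetricSpace M] [CompactSpace M]
  [ChartedSpace (EuclideanSpace ℝ (Fin d)) M]
  [IsManifold (𝓡 d) ∞ M] [RiemannianBundle (fun x : M => TangentSpace (𝓡 d) x)]
  [IsRiemannianManifold (𝓡 d) M]
  [IsContinuousRiemannianBundle (EuclideanSpace ℝ (Fin d)) (fun x : M => TangentSpace (𝓡 d) x)]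
  {f : M → M} {Ecs Eu : ∀ x : M, Submodule ℝ (TangentSpace (𝓡 d) x)}

theorem Lamination.IsTangentTo.isPlaqueExpansive {W : Lamination d M} (hW : W.IsTangentTo Ecs)
    (hfin : W.atlas.Countable) (hG : ∀ c ∈ W.atlas, c.HasPlaqueCoordinate)
    (hf : ContMDiff (𝓡 d) (𝓡 d) 1 f) (hEcs : IsContinuousSubbundle Ecs)
    (hsplit : ∀ x : M, IsCompl (Ecs x) (Eu x)) (K : ConeField f Eu) {C : ℝ}
    (hC : ∀ (n : ℕ) (x : M), ∀ v ∈ Ecs x, ‖mfderiv (𝓡 d) (𝓡 d) (f^[n]) x v‖ ≤ C * ‖v‖) :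
    W.IsPlaqueExpansive f := by
  intro η hη
  obtain ⟨ε₁, hε₁, hK⟩ := K.exists_eq_of_pseudoOrbits
  have hC1 : 0 < max C 1 := lt_max_of_lt_right one_pos
  -- A jump of the slid sequence consists of three pieces (slide back, jump, slide forward) and its
  -- distance to `x n` of two, each at most `e` in forward distance or distance; both totals are
  -- below `ε₁`.
  set e := ε₁ / 4
  have he : 0 < e := by positivity
  have heC : e / max C 1 ≤ e := div_le_self he.le (le_max_right _ _)
  obtain ⟨r, hr, hslide⟩ := exists_forall_edist_le_of_uniformity
    (K.eventually_exists_slide hEcs hsplit (lt_min hη (div_pos he hC1)))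
  refine ⟨min r (e / max C 1), lt_min hr (div_pos he hC1), fun x y hx hy hxy => ?_⟩
  have hshort : ∀ (γ : ℝ → M) (ρ : ℝ), ρ ≤ e / max C 1 → IsC1Path d γ → IsTangentPath Ecs γ →
      pathELength (𝓡 d) γ 0 1 < ENNReal.ofReal ρ →
      StaysClose f (ENNReal.ofReal e) (γ 0) (γ 1) := by
    intro γ ρ hρ h1 h2 h3
    refine (h2.staysClose hf hC h1 le_rfl zero_le_one le_rfl).mono ?_
    calc _ ≤ ENNReal.ofReal (max C 1) * ENNReal.ofReal (e / max C 1) := by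
          gcongr
          · exact le_max_left _ _
          · exact h3.le.trans (ENNReal.ofReal_le_ofReal hρ)
      _ = _ := by rw [← ENNReal.ofReal_mul hC1.le, mul_div_cancel₀ _ hC1.ne']
  have hjump : ∀ x : ℤ → M, W.IsPseudoOrbit f (min r (e / max C 1)) x →
      ∀ n, StaysClose f (ENNReal.ofReal e) (f (x n)) (x (n + 1)) := by
    intro x hx n
    obtain ⟨γ, h1, h2, h3, h4, h5⟩ := hx n
    have := hshort γ _ (min_le_right _ _) h1 (hW.isTangentPath hfin hG h1 h4) h5
    rw [h2, h3] at this
    exact this.symm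
  choose γ hγ1 hγ2 hγ0 hcone hlen using fun n => hslide (x n) (y n)
    ((hxy n).le.trans (ENNReal.ofReal_le_ofReal (min_le_left _ _)))
  have hyz : ∀ n, StaysClose f (ENNReal.ofReal e) (y n) (γ n 1) := by
    intro n
    have := hshort (γ n) _ (min_le_right _ _) (hγ1 n) (hγ2 n) (hlen n)
    rwa [hγ0 n] at this
  have h0 : x 0 = γ 0 1 := by
    refine hK x (fun n => γ n 1) hcone (fun n => (hjump x hx n).mono ?_) (fun n => ?_) fun n => ?_
    · exact ENNReal.ofReal_le_ofReal (by simp only [e]; linarith)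
    · refine ((((hyz n).symm.iterate 1).trans (hjump y hy n)).trans (hyz (n + 1))).mono ?_
      rw [← ENNReal.ofReal_add he.le he.le, ← ENNReal.ofReal_add (by positivity) he.le]
      exact ENNReal.ofReal_le_ofReal (by simp only [e]; linarith)
    · refine (edist_triangle _ (y n) _).trans ?_
      calc _ ≤ ENNReal.ofReal e + ENNReal.ofReal e := by
            refine add_le_add ((hxy n).le.trans (ENNReal.ofReal_le_ofReal ?_)) (hyz n).edist_le
            exact (min_le_right _ _).trans heC
        _ ≤ _ := by
            rw [← ENNReal.ofReal_add he.le he.le]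
            exact ENNReal.ofReal_le_ofReal (by simp only [e]; linarith)
  refine ⟨γ 0, hγ1 0, hγ0 0, h0.symm, fun t ht => ?_, (hlen 0).trans_le ?_⟩
  · have := hW.mem_leaf_of_isTangentPath hf hEcs hsplit K hC (hγ1 0) (hγ2 0)
      (left_mem_Icc.2 zero_le_one) ht
    rwa [hγ0] at this
  · exact ENNReal.ofReal_le_ofReal (min_le_left _ _)

end PlaqueExpansive

end PlaqueExp

end

theorem mainTheorem1 {d : ℕ} {M : Type*} [EMetricSpace M] [CompactSpace M]
    [ChartedSpace (EuclideanSpace ℝ (Fin d)) M] [IsManifold (𝓡 d) ∞ M]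
    [RiemannianBundle (fun x : M => TangentSpace (𝓡 d) x)]
    [IsContMDiffRiemannianBundle (𝓡 d) ∞ (EuclideanSpace ℝ (Fin d))
      (fun x : M => TangentSpace (𝓡 d) x)]
    [IsRiemannianManifold (𝓡 d) M]
    (f : M ≃ₘ^1⟮𝓡 d, 𝓡 d⟯ M)
    (Ecs Eu : ∀ x : M, Submodule ℝ (TangentSpace (𝓡 d) x))
    (hEcs : PlaqueExp.IsContinuousSubbundle Ecs) (hEu : PlaqueExp.IsContinuousSubbundle Eu)
    (hsplit : ∀ x : M, IsCompl (Ecs x) (Eu x))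
    (hEcs_inv : PlaqueExp.IsInvariantSubbundle f Ecs)
    (hEu_inv : PlaqueExp.IsInvariantSubbundle f Eu)
    (hexp : PlaqueExp.IsExpandingOn f Eu)
    (hlyap : PlaqueExp.IsLyapunovStable f Ecs) :
    ∃ W : PlaqueExp.Lamination d M,
      W.IsTangentTo Ecs ∧ W.IsInvariant f ∧
      (∀ W' : PlaqueExp.Lamination d M, W'.IsTangentTo Ecs → ∀ x : M, W'.leaf x = W.leaf x) ∧
      W.IsPlaqueExpansive f := by
  -- Only the continuity of the metric is used from here on.
  have hbundle : IsContinuousRiemannianBundle (EuclideanSpace ℝ (Fin d))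
      (fun x : M => TangentSpace (𝓡 d) x) := by
    obtain ⟨g, hg, hg'⟩ := IsContMDiffRiemannianBundle.exists_contMDiff (IB := 𝓡 d) (n := ∞)
      (F := EuclideanSpace ℝ (Fin d)) (E := fun x : M => TangentSpace (𝓡 d) x)
    exact ⟨g, hg.continuous, hg'⟩
  have hf := f.contMDiff
  obtain ⟨C, hC₀, hC⟩ := hlyap.exists_norm_mfderiv_iterate_le hf hEcs hsplit
  obtain ⟨K⟩ := PlaqueExp.exists_coneField hf hEcs hEu hsplit hEcs_inv hEu_inv hexp hC₀.le hC
  obtain ⟨W, hW, hfin, hG⟩ := PlaqueExp.exists_lamination hf hEcs hsplit K hC₀.le hC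
  refine ⟨W, hW, hW.isInvariant f hEcs hsplit K hC hEcs_inv, fun W' hW' x => ?_,
    hW.isPlaqueExpansive hfin.countable hG hf hEcs hsplit K hC⟩
  rw [hW'.leaf_eq hf hEcs hsplit K hC, hW.leaf_eq hf hEcs hsplit K hC]
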